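/- **Conventions.** $H',H$ are real Hilbert spaces. For a Euclidean space $V$, $Cl(V)$ is the complex Clifford algebra of $V$ as a $C^*$-algebra, with $v^2=\|v\|^2$ and $v^*=v$ for $v\in V$. For finite-dimensional $E$ and $V$, $C_0(\mathbb R)$ is graded by even and odd functions, $\hat\otimes$ is the graded tensor product, and $S\mathfrak C(E)=C_0(\mathbb R)\hat\otimes C_0(E,Cl(E))$; for $s>0$, $S_s\mathfrak C(D_s)=C_0(-s,s)\hat\otimes C_0(D_s,Cl(E))$, where $D_s\subset E$ is the open ball of radius $s$ about $0$. For $E_1\subset E_2$ the standard Bott map $\beta:S\mathfrak C(E_1)\to S\mathfrak C(E_2)$ is $f\hat\otimes u\mapsto \big(v+w\mapsto f(X\hat\otimes 1+1\hat\otimes w)\,u(v)\big)$, $v\in E_1$, $w\in E_2\ominus E_1$. For an invertible bounded linear operator $l$, $\bar l$ is the unitary of its polar decomposition. An isomorphism $l:H'\cong H$ is *asymptotically unitary* if for every $\varepsilon>0$ there is a finite-dimensional $V\subset H'$ with $\|(l-\bar l)|_{V^\perp}\|\le\varepsilon$. **Finite approximations.** Let $F=l+c:H'\to H$ be a map with linear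 part an isomorphism $l$. A *finite approximation* of $F$ consists of an increasing sequence of finite-dimensional $W'_i\subset H'$ ($i\ge 0$) with dense union, and continuous maps $F_i=l_i+c_i:W'_i\to W_i$ with linear isomorphisms $l_i:W'_i\cong W_i=l_i(W'_i)\subset H$, $W_i\subset W_{i+1}$, such that (a) there are $0<s_0<s_1<\dots\to\infty$ and $r_0<r_1<\dots\to\infty$ with $r_i\ge s_i$ and $F_i^{-1}(D_{s_i})\subset D'_{r_i}$ (open balls of $W_i$, $W'_i$); (b) for each $i_0$, $\sup_{m\in D'_{r_{i_0}}}\|F(m)-F_i(m)\|\to0$; (c) $l$ is asymptotically unitary, $\|(l-l_i)|_{W'_{i_0}}\|\to0$ for each $i_0$, and $C^{-1}\|l\|\le\|l_i\|\le C\|l\|$ for some $C>0$ and all $i$. Put $F_i^*(h)(v')=\bar l_i^{-1}(h(F_i(v')))$. An element $u\in S_{s_{i_0}}\mathfrak C(D_{s_{i_0}})$, $D_{s_{i_0}}\subset W_{i_0}$, such that $u_i=\beta(u)\in S_{s_i}\mathfrak C(D_{s_i})$ for all $i\ge i_0$ gives the *$F$-compatible sequence* $[u]=\{F_i^*(u_i)\}_{i\ge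 i_0}$. The *induced Clifford $C^*$-algebra* $S\mathfrak C_F(H')$ (with respect to the given finite approximation) is the $C^*$-algebra generated by the $F$-compatible sequences, with termwise operations, for the norm $\|\{\alpha_i\}\|=\lim_j\lim_i\|\alpha_i|_{D'_{r_j}}\|$ (limit superior in $i$), sequences of norm $0$ being identified with $0$. **The algebra $S\mathfrak C_l(H')$.** Let $l:H'\cong H$ be asymptotically unitary, $C_l=\bar l^{-1}l$, and for finite-dimensional $E'\subset H'$ let $\bar E'=\bar l^{-1}(l(E'))$ and $S\mathfrak C_l(E')=C_0(\mathbb R)\hat\otimes C_0(E',Cl(\bar E'))$. For $E'_a\subset E'_b$ let $\widehat{pr}$ be the unitary of the polar decomposition of the orthogonal projection $C_l(E'_b\ominus E'_a)\to\bar E'_b\ominus\bar E'_a$ and let $\beta_{ba}:S\mathfrak C_l(E'_a)\to S\mathfrak C_l(E'_b)$ be $f\hat\otimes u\mapsto\big(v+w\mapsto f(X\hat\otimes1+1\hat\otimes\widehat{pr}\,C_l(w))\,u(v)\big)$, $v\in E'_a$, $w\in E'_b\ominus E'_a$. Then $S\mathfrak C_l(H')$ is the direct limit $C^*$-algebra: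 the closed $*$-algebra generated by the nets $[h]=\{\beta_{ba}(h)\}_b$, $h\in S\mathfrak C_l(E'_a)$, in the algebra of bounded nets modulo those tending to $0$ in norm. For $u\in S\mathfrak C(l(E'))$ put $l^*(u)(v')=\bar l^{-1}(u(l(v')))$, so that $l^*(u)\in S\mathfrak C_l(E')$. **The model case.** $H'$ and $H$ are the Hilbert sums of finite-dimensional orthogonal subspaces $E'_0,E'_1,\dots$ and $E_k=l(E'_k)$, where $l:H'\cong H$ is asymptotically unitary, and $F=(F_0,F_1,\dots):H'\to H$ is continuous with $F_k:E'_k\to E_k$ proper. Write $E'_{\le i}=E'_0\oplus\dots\oplus E'_i$, $E_{\le i}=l(E'_{\le i})$, $F_{\le i}=(F_0,\dots,F_i)$, $l_{\le i}=l|_{E'_{\le i}}$, $F_{\le i}^*(u)(v')=\bar l_{\le i}^{-1}(u(F_{\le i}(v')))$ and $S\mathfrak C_F(E'_{\le i})=F_{\le i}^*(S\mathfrak C(E_{\le i}))$. The induced Bott maps $\beta_{i,j}:S\mathfrak C_F(E'_{\le i})\to S\mathfrak C_F(E'_{\le j})$ are $f\hat\otimes u\mapsto\big(v+w\mapsto f(X\hat\otimes1+1\hat\otimes\bar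 l^{-1}_{(i,j]}F_{(i,j]}(w))\,u(v)\big)$, $v\in E'_{\le i}$, $w\in E'_{i+1}\oplus\dots\oplus E'_j$, where $F_{(i,j]}=(F_{i+1},\dots,F_j)$ has linear part $l_{(i,j]}$. The *model algebra* is the direct limit $\varinjlim_j S\mathfrak C_F(E'_{\le j})$ with norm $\lim_j\|\beta_{i,j}(a)\|$; $[u]$ denotes the class of $F_{\le i}^*(u)$, $u\in S\mathfrak C(E_{\le i})$. **Lemma.** (1) In the model case, for some $N$ there is a finite approximation of $F$ with $W'_i=E'_{\le N+i}$, $l_i=l|_{W'_i}$ and $F_i=F_{\le N+i}$. For every finite approximation of $F$ there is a $*$-isomorphism $\Phi$ from the induced Clifford algebra $S\mathfrak C_F(H')$ onto the model algebra with $\|\Phi([u])-[v]\|\le\|\beta(u)-\beta(v)\|_{S\mathfrak C(W_i+E_{\le j})}$ for every $F$-compatible sequence $[u]$ with $u\in S\mathfrak C(W_i)$ and every $v\in S\mathfrak C(E_{\le j})$. (2) Let $F=l$ be asymptotically unitary. For every finite approximation of $l$ there is a $*$-isomorphism $\Phi:S\mathfrak C_F(H')\cong S\mathfrak C_l(H')$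 with $\Phi([u])=\lim_{E'}\,[\,l^*(\beta(u))\,]$ for every $F$-compatible sequence $[u]$, $u\in S\mathfrak C(W_i)$; the limit is over the finite-dimensional $E'\subset H'$ with $W_i\subset l(E')$, $\beta:S\mathfrak C(W_i)\to S\mathfrak C(l(E'))$. (3) Let a group $\Gamma$ act on $H'$ and $H$ by linear isometries, and let $F=l+c:H'\to H$ be continuous and metrically proper (preimages of bounded sets are bounded), with $F$ and $l$ $\Gamma$-equivariant. Take two finite approximations of $F$ that are $\Gamma$-finite, i.e. $\bigcup_i(\gamma(W'_i)\cap W'_i)$ is dense in $H'$ for every $\gamma\in\Gamma$. Then there is a $*$-isomorphism $\Phi$ between the two induced Clifford algebras $S\mathfrak C_F(H')$ with $\|\Phi([u])-[v]\|\le\|\beta(u)-\beta(v)\|_{S\mathfrak C(W^1_i+W^2_j)}$ for all compatible sequences $[u]$, $u\in S\mathfrak C(W^1_i)$, of the first and $[v]$, $v\in S\mathfrak C(W^2_j)$, of the second. -/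

import Mathlib

open scoped ENNReal InnerProductSpace
open Filter Topology

namespace InducedClifford

noncomputable section

/-! ### Polar decomposition of a bounded below operator between real Hilbert spaces -/

section Polar

/-- Self-adjoint operators that are positive and bounded below have positive square roots. -/
theorem exists_sqrt_of_bounded_below {X : Type*} [NormedAddCommGroup X] [InnerProductSpace ℝ X]
    [CompleteSpace X] (Q : X →L[ℝ] X) (hQ : IsSelfAdjoint Q) {c : ℝ} (hc : 0 < c)
    (hcQ : ∀ x, c * ‖x‖ ^ 2 ≤ ⟪Q x, x⟫_ℝ) :
    ∃ P : X ≃L[ℝ] X, (P : X →L[ℝ] X).IsPositive ∧ ∀ x, P (P x) = Q x := by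
  set m : ℝ := ‖Q‖ ^ 2 + 1 with hm
  have hm0 : 0 < m := by positivity
  set M : ℝ := m / c with hM
  have hM0 : 0 < M := by positivity
  set B : X →L[ℝ] X := 1 - M⁻¹ • Q with hB
  have hBsa : IsSelfAdjoint B := by
    rw [hB]
    exact (IsSelfAdjoint.one _).sub (IsSelfAdjoint.smul (by simp [IsSelfAdjoint]) hQ)
  set b : ℝ := Real.sqrt (max 0 (1 - c ^ 2 / m)) with hb
  have hb0 : 0 ≤ b := Real.sqrt_nonneg _
  have hb1 : b < 1 := by
    rw [hb, Real.sqrt_lt' one_pos, one_pow, max_lt_iff]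
    exact ⟨one_pos, by have : 0 < c ^ 2 / m := by positivity
                       linarith⟩
  have hBx : ∀ x, ‖B x‖ ^ 2 ≤ (1 - c ^ 2 / m) * ‖x‖ ^ 2 := by
    intro x
    have h1 : ‖B x‖ ^ 2 = ‖x‖ ^ 2 - 2 * (M⁻¹ * ⟪Q x, x⟫_ℝ) + (M⁻¹) ^ 2 * ‖Q x‖ ^ 2 := by
      have : B x = x - M⁻¹ • Q x := by simp [hB]
      rw [this, norm_sub_sq_real, inner_smul_right, real_inner_comm, norm_smul, mul_pow]
      simp
    have h2 : ‖Q x‖ ^ 2 ≤ (m * ‖x‖ ^ 2) := by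
      have := Q.le_opNorm x
      calc ‖Q x‖ ^ 2 ≤ (‖Q‖ * ‖x‖) ^ 2 := by gcongr
        _ = ‖Q‖ ^ 2 * ‖x‖ ^ 2 := by ring
        _ ≤ _ := by gcongr; linarith
    have h3 : M⁻¹ * (c * ‖x‖ ^ 2) ≤ M⁻¹ * ⟪Q x, x⟫_ℝ := by
      have := hcQ x
      gcongr
    have h4 : (M⁻¹) ^ 2 * ‖Q x‖ ^ 2 ≤ (M⁻¹) ^ 2 * (m * ‖x‖ ^ 2) := by gcongr
    have h5 : M⁻¹ * (c * ‖x‖ ^ 2) = c ^ 2 / m * ‖x‖ ^ 2 := by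
      rw [hM]; field_simp
    have h6 : (M⁻¹) ^ 2 * (m * ‖x‖ ^ 2) = c ^ 2 / m * ‖x‖ ^ 2 := by
      rw [hM]; field_simp
    rw [h1]; nlinarith
  have hBn : ‖B‖ ≤ b := by
    refine B.opNorm_le_bound hb0 fun x => ?_
    rw [← Real.sqrt_sq (norm_nonneg (B x)), ← Real.sqrt_sq (norm_nonneg x), hb,
      ← Real.sqrt_mul (le_max_left _ _)]
    refine Real.sqrt_le_sqrt ((hBx x).trans ?_)
    gcongr
    exact le_max_right _ _
  -- the fixed point of `Y ↦ (B + Y²) / 2` in the ball of radius `b`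
  let f : (X →L[ℝ] X) → (X →L[ℝ] X) := fun Y => (2 : ℝ)⁻¹ • (B + Y * Y)
  let s : Set (X →L[ℝ] X) := {Y | ‖Y‖ ≤ b ∧ IsSelfAdjoint Y}
  have hs : IsComplete s := by
    apply IsClosed.isComplete
    have h1 : IsClosed {Y : X →L[ℝ] X | ‖Y‖ ≤ b} := isClosed_le continuous_norm continuous_const
    have h2 : IsClosed {Y : X →L[ℝ] X | IsSelfAdjoint Y} :=
      isClosed_eq continuous_star continuous_id
    exact h1.inter h2
  have hsf : Set.MapsTo f s s := by
    rintro Y ⟨hY, hYs⟩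
    refine ⟨?_, ?_⟩
    · calc ‖f Y‖ ≤ ‖(2 : ℝ)⁻¹‖ * ‖B + Y * Y‖ := ContinuousLinearMap.opNorm_smul_le _ _
        _ ≤ 2⁻¹ * (b + b * b) := by
          have h := norm_mul_le Y Y
          have h' : ‖Y‖ * ‖Y‖ ≤ b * b := by gcongr
          have h'' := norm_add_le B (Y * Y)
          rw [Real.norm_of_nonneg (by norm_num)]
          gcongr
          linarith
        _ ≤ b := by nlinarith
    · refine IsSelfAdjoint.smul (by simp [IsSelfAdjoint]) (hBsa.add ?_)
      rw [IsSelfAdjoint, star_mul, hYs.star_eq]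
  have hcon : ContractingWith ⟨b, hb0⟩ (hsf.restrict f s s) := by
    refine ⟨by exact_mod_cast hb1, LipschitzWith.of_dist_le_mul ?_⟩
    rintro ⟨Y, hY, hYs⟩ ⟨Z, hZ, hZs⟩
    change dist (f Y) (f Z) ≤ b * dist Y Z
    rw [dist_eq_norm, dist_eq_norm]
    have : f Y - f Z = (2 : ℝ)⁻¹ • (Y * (Y - Z) + (Y - Z) * Z) := by
      simp only [f, ← smul_sub]
      congr 1
      noncomm_ring
    rw [this]
    calc ‖(2 : ℝ)⁻¹ • (Y * (Y - Z) + (Y - Z) * Z)‖ ≤ ‖(2 : ℝ)⁻¹‖ * ‖Y * (Y - Z) + (Y - Z) * Z‖ :=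
          ContinuousLinearMap.opNorm_smul_le _ _
      _ ≤ 2⁻¹ * (b * ‖Y - Z‖ + ‖Y - Z‖ * b) := by
          rw [Real.norm_of_nonneg (by norm_num)]
          have h1 := norm_mul_le Y (Y - Z)
          have h2 := norm_mul_le (Y - Z) Z
          have h3 : ‖Y‖ * ‖Y - Z‖ ≤ b * ‖Y - Z‖ := by gcongr
          have h4 : ‖Y - Z‖ * ‖Z‖ ≤ ‖Y - Z‖ * b := by gcongr
          have h5 := norm_add_le (Y * (Y - Z)) ((Y - Z) * Z)
          gcongr
          linarith
      _ = b * ‖Y - Z‖ := by ring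
  obtain ⟨Y, ⟨hYb, hYs⟩, hfix, -⟩ := ContractingWith.exists_fixedPoint' hs hsf hcon
    (x := 0) ⟨by simpa using hb0, IsSelfAdjoint.zero _⟩ (edist_ne_top _ _)
  have hfix' : (2 : ℝ)⁻¹ • (B + Y * Y) = Y := hfix
  have hsq : (1 - Y) * (1 - Y) = M⁻¹ • Q := by
    have h1 : B + Y * Y = (2 : ℝ) • Y := by
      conv_rhs => rw [← hfix']
      rw [smul_smul]; norm_num
    have h2 : Y * Y = (2 : ℝ) • Y - B := eq_sub_of_add_eq' h1
    calc (1 - Y) * (1 - Y) = 1 - (2 : ℝ) • Y + Y * Y := by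
          rw [two_smul]; noncomm_ring
      _ = 1 - B := by rw [h2]; abel
      _ = _ := by rw [hB]; abel
  have hunit : IsUnit (1 - Y) := isUnit_one_sub_of_norm_lt_one (hYb.trans_lt hb1)
  obtain ⟨u, hu⟩ := hunit
  have hM1 : Real.sqrt M ≠ 0 := (Real.sqrt_pos.2 hM0).ne'
  refine ⟨(ContinuousLinearEquiv.unitsEquiv ℝ X u).trans
    (ContinuousLinearEquiv.smulLeft (Units.mk0 _ hM1)), ?_, ?_⟩
  · have hPx : ∀ x, ((ContinuousLinearEquiv.unitsEquiv ℝ X u).trans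
        (ContinuousLinearEquiv.smulLeft (Units.mk0 _ hM1)) : X →L[ℝ] X) x
          = Real.sqrt M • ((1 - Y) x) := by
      intro x
      rw [← hu]; rfl
    have hP : ((ContinuousLinearEquiv.unitsEquiv ℝ X u).trans
        (ContinuousLinearEquiv.smulLeft (Units.mk0 _ hM1)) : X →L[ℝ] X)
          = Real.sqrt M • (1 - Y) := by
      ext x; exact hPx x
    rw [hP]
    refine (ContinuousLinearMap.isPositive_def' ).2 ⟨?_, fun x => ?_⟩
    · exact IsSelfAdjoint.smul (by simp [IsSelfAdjoint]) ((IsSelfAdjoint.one _).sub hYs)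
    · have h1 : ⟪Y x, x⟫_ℝ ≤ ‖x‖ ^ 2 := by
        calc ⟪Y x, x⟫_ℝ ≤ ‖Y x‖ * ‖x‖ := real_inner_le_norm _ _
          _ ≤ (‖Y‖ * ‖x‖) * ‖x‖ := by gcongr; exact Y.le_opNorm x
          _ ≤ (1 * ‖x‖) * ‖x‖ := by gcongr; linarith
          _ = _ := by ring
      have h2 : ⟪(1 - Y) x, x⟫_ℝ = ‖x‖ ^ 2 - ⟪Y x, x⟫_ℝ := by
        simp [inner_sub_left]
      have : (Real.sqrt M • (1 - Y)).reApplyInnerSelf x = Real.sqrt M * ⟪(1 - Y) x, x⟫_ℝ := by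
        simp [ContinuousLinearMap.reApplyInnerSelf_apply, inner_smul_left]
      rw [this, h2]
      have := Real.sqrt_nonneg M
      exact mul_nonneg this (by linarith)
  · intro x
    have hPx : ∀ x, ((ContinuousLinearEquiv.unitsEquiv ℝ X u).trans
        (ContinuousLinearEquiv.smulLeft (Units.mk0 _ hM1))) x
          = Real.sqrt M • ((1 - Y) x) := by
      intro x
      rw [← hu]; rfl
    rw [hPx, hPx, map_smul, smul_smul, Real.mul_self_sqrt hM0.le]
    have : (1 - Y) ((1 - Y) x) = M⁻¹ • Q x := by
      have := congrArg (fun T : X →L[ℝ] X => T x) hsq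
      simpa using this
    rw [this, smul_smul, mul_inv_cancel₀ hM0.ne', one_smul]

variable {X Y : Type*} [NormedAddCommGroup X] [InnerProductSpace ℝ X] [CompleteSpace X]
  [NormedAddCommGroup Y] [InnerProductSpace ℝ Y] [CompleteSpace Y]

theorem exists_absOp (A : X →L[ℝ] Y) (hA : ∃ c > 0, ∀ x, c * ‖x‖ ≤ ‖A x‖) :
    ∃ P : X ≃L[ℝ] X, (P : X →L[ℝ] X).IsPositive ∧ ∀ x, P (P x) = A.adjoint (A x) := by
  obtain ⟨c, hc, hcA⟩ := hA
  refine exists_sqrt_of_bounded_below (A.adjoint ∘L A)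
    ((ContinuousLinearMap.isPositive_adjoint_comp_self A).isSelfAdjoint) (c := c ^ 2)
    (by positivity) fun x => ?_
  have h : ⟪(A.adjoint ∘L A) x, x⟫_ℝ = ‖A x‖ ^ 2 := by
    rw [ContinuousLinearMap.comp_apply, ContinuousLinearMap.adjoint_inner_left,
      real_inner_self_eq_norm_sq]
  rw [h, ← mul_pow]
  have := hcA x
  gcongr

/-- `√(A* A)`, the positive square root. -/
def absOp (A : X →L[ℝ] Y) (hA : ∃ c > 0, ∀ x, c * ‖x‖ ≤ ‖A x‖) : X ≃L[ℝ] X :=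
  (exists_absOp A hA).choose

/-- The isometry `A ∘ √(A* A)⁻¹` of the polar decomposition of `A`. -/
def polarIsometry (A : X →L[ℝ] Y) (hA : ∃ c > 0, ∀ x, c * ‖x‖ ≤ ‖A x‖) : X →ₗᵢ[ℝ] Y where
  toLinearMap := (A ∘L ((absOp A hA).symm : X →L[ℝ] X)).toLinearMap
  norm_map' x := by
    obtain ⟨hp, hs⟩ := (exists_absOp A hA).choose_spec
    change ‖A ((absOp A hA).symm x)‖ = ‖x‖
    set z := (absOp A hA).symm x with hz
    have hx : x = absOp A hA z := by simp [hz]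
    have h : ‖A z‖ ^ 2 = ‖absOp A hA z‖ ^ 2 := by
      rw [← real_inner_self_eq_norm_sq, ← ContinuousLinearMap.adjoint_inner_left, ← hs z,
        ← real_inner_self_eq_norm_sq]
      exact hp.isSymmetric (absOp A hA z) z
    rw [hx]
    exact (pow_left_inj₀ (norm_nonneg _) (norm_nonneg _) two_ne_zero).1 h

theorem bounded_below_of_equiv {X Y : Type*} [NormedAddCommGroup X] [InnerProductSpace ℝ X]
    [NormedAddCommGroup Y] [InnerProductSpace ℝ Y] (A : X ≃L[ℝ] Y) :
    ∃ c > 0, ∀ x, c * ‖x‖ ≤ ‖(A : X →L[ℝ] Y) x‖ := by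
  refine ⟨(‖(A.symm : Y →L[ℝ] X)‖ + 1)⁻¹, by positivity, fun x => ?_⟩
  rw [inv_mul_le_iff₀ (by positivity)]
  have h := (A.symm : Y →L[ℝ] X).le_opNorm (A x)
  have h' : ‖x‖ ≤ ‖(A.symm : Y →L[ℝ] X)‖ * ‖A x‖ := by simpa using h
  have := norm_nonneg (A x)
  calc ‖x‖ ≤ ‖(A.symm : Y →L[ℝ] X)‖ * ‖A x‖ := h'
    _ ≤ (‖(A.symm : Y →L[ℝ] X)‖ + 1) * ‖A x‖ := by gcongr; linarith

/-- The unitary `Ā = A ∘ √(A* A)⁻¹` of the polar decomposition of an isomorphism `A`. -/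
def polarUnitary (A : X ≃L[ℝ] Y) : X ≃ₗᵢ[ℝ] Y :=
  LinearIsometryEquiv.ofSurjective (polarIsometry (A : X →L[ℝ] Y) (bounded_below_of_equiv A)) (by
    intro y
    refine ⟨absOp (A : X →L[ℝ] Y) (bounded_below_of_equiv A) (A.symm y), ?_⟩
    change A ((absOp (A : X →L[ℝ] Y) (bounded_below_of_equiv A)).symm _) = y
    simp)

end Polar
/-! ### The complex Clifford algebra as a C*-algebra -/

section Clifford

/-- The quadratic form `v ↦ ‖v‖²`. -/
def normForm (V : Type*) [NormedAddCommGroup V] [InnerProductSpace ℝ V] : QuadraticForm ℝ V :=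
  LinearMap.BilinMap.toQuadraticMap (innerₗ V)

/-- Operators on `ℂⁿ⁺¹`. -/
def OpC (n : ℕ) : Type :=
  EuclideanSpace ℂ (Fin (n + 1)) →L[ℂ] EuclideanSpace ℂ (Fin (n + 1))

instance (n : ℕ) : CStarAlgebra (OpC n) :=
  inferInstanceAs (CStarAlgebra
    (EuclideanSpace ℂ (Fin (n + 1)) →L[ℂ] EuclideanSpace ℂ (Fin (n + 1))))

instance (n : ℕ) : NormOneClass (OpC n) :=
  inferInstanceAs (NormOneClass
    (EuclideanSpace ℂ (Fin (n + 1)) →L[ℂ] EuclideanSpace ℂ (Fin (n + 1))))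

/-- Finite-dimensional unitary Clifford modules: representations of the real Clifford algebra
`v² = ‖v‖²` on some `ℂⁿ⁺¹` in which the vectors act by self-adjoint operators. -/
def CliffRep (V : Type*) [NormedAddCommGroup V] [InnerProductSpace ℝ V] : Type _ :=
  Σ n : ℕ, {π : CliffordAlgebra (normForm V) →ₐ[ℝ] OpC n //
    ∀ v, IsSelfAdjoint (π (CliffordAlgebra.ι (normForm V) v))}

/-- The product C*-algebra of the algebras `B(ℂⁿ⁺¹)` over all Clifford modules. -/
def CliffProd (V : Type*) [NormedAddCommGroup V] [InnerProductSpace ℝ V] : Type _ :=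
  lp (fun π : CliffRep V => OpC π.1) ∞

/-- The C*-algebra structure of the product. -/
def cliffProdCStarAlgebra (V : Type*) [NormedAddCommGroup V] [InnerProductSpace ℝ V] :
    CStarAlgebra (lp (fun π : CliffRep V => OpC π.1) ∞) where
  toNormedRing := lp.inftyNormedRing
  toStarRing := lp.inftyStarRing
  toCompleteSpace := lp.completeSpace
  toCStarRing := lp.inftyCStarRing
  toNormedAlgebra := lp.inftyNormedAlgebra
  toStarModule := inferInstance

instance (V : Type*) [NormedAddCommGroup V] [InnerProductSpace ℝ V] :
    CStarAlgebra (CliffProd V) := cliffProdCStarAlgebra V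

variable {V W Z : Type*} [NormedAddCommGroup V] [InnerProductSpace ℝ V]
  [NormedAddCommGroup W] [InnerProductSpace ℝ W] [NormedAddCommGroup Z] [InnerProductSpace ℝ Z]

theorem CliffRep.norm_ι (π : CliffRep V) (v : V) :
    ‖π.2.1 (CliffordAlgebra.ι (normForm V) v)‖ = ‖v‖ := by
  have h1 : π.2.1 (CliffordAlgebra.ι (normForm V) v) * π.2.1 (CliffordAlgebra.ι (normForm V) v)
      = algebraMap ℝ (OpC π.1) (‖v‖ ^ 2) := by
    rw [← map_mul, CliffordAlgebra.ι_sq_scalar, AlgHom.commutes]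
    congr 1
    simp [normForm]
  have h2 := CStarRing.norm_star_mul_self (x := π.2.1 (CliffordAlgebra.ι (normForm V) v))
  rw [(π.2.2 v).star_eq, h1, norm_algebraMap'] at h2
  rw [Real.norm_of_nonneg (by positivity)] at h2
  nlinarith [norm_nonneg v, norm_nonneg (π.2.1 (CliffordAlgebra.ι (normForm V) v))]

/-- The vector `v` acting in all Clifford modules. -/
def CliffProd.vec (v : V) : CliffProd V :=
  ⟨fun π => π.2.1 (CliffordAlgebra.ι (normForm V) v), memℓp_infty ⟨‖v‖, by
    rintro _ ⟨π, rfl⟩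
    exact (π.norm_ι v).le⟩⟩

/-- The complex Clifford algebra `Cl(V)` of a Euclidean space `V`, with `v² = ‖v‖²` and `v* = v`,
as a C*-algebra: it is generated by `V` inside the product of all unitary Clifford modules. -/
def cliffSubalgebra (V : Type*) [NormedAddCommGroup V] [InnerProductSpace ℝ V] :
    StarSubalgebra ℂ (CliffProd V) :=
  (StarAlgebra.adjoin ℂ (Set.range (CliffProd.vec (V := V)))).topologicalClosure

/-- The complex Clifford algebra `Cl(V)` of a Euclidean space `V`, with `v² = ‖v‖²` and `v* = v`. -/
def Cl (V : Type*) [NormedAddCommGroup V] [InnerProductSpace ℝ V] : Type _ :=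
  cliffSubalgebra V

instance (V : Type*) [NormedAddCommGroup V] [InnerProductSpace ℝ V] : CStarAlgebra (Cl V) :=
  @StarSubalgebra.cstarAlgebra _ _ _ _ _ _ _ (cliffSubalgebra V)
    (StarSubalgebra.isClosed_topologicalClosure _)

/-- The Clifford operator `V → Cl(V)`. -/
def Cl.vec (v : V) : Cl V :=
  ⟨CliffProd.vec v, StarSubalgebra.le_topologicalClosure _
    (StarAlgebra.subset_adjoin ℂ _ ⟨v, rfl⟩)⟩

theorem Cl.isSelfAdjoint_vec (v : V) : IsSelfAdjoint (Cl.vec v) := by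
  refine Subtype.ext (Subtype.ext (funext fun π => ?_))
  exact (π.2.2 v).star_eq

/-- Restriction of Clifford modules along an isometry. -/
def CliffRep.comap (T : V →ₗᵢ[ℝ] W) (π : CliffRep W) : CliffRep V :=
  ⟨π.1, π.2.1.comp (CliffordAlgebra.map
    { toLinearMap := T.toLinearMap
      map_app' := fun v => by simp [normForm] }), fun v => by
    rw [AlgHom.comp_apply, CliffordAlgebra.map_apply_ι]; exact π.2.2 (T v)⟩

/-- The homomorphism of product algebras induced by an isometry. -/
def CliffProd.map (T : V →ₗᵢ[ℝ] W) : CliffProd V →⋆ₐ[ℂ] CliffProd W where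
  toFun a := ⟨fun π => a.1 (π.comap T), memℓp_infty ⟨‖a‖, by
    rintro _ ⟨π, rfl⟩
    exact lp.norm_apply_le_norm (E := fun π : CliffRep V => OpC π.1) (by simp) a (π.comap T)⟩⟩
  map_one' := rfl
  map_mul' _ _ := rfl
  map_zero' := rfl
  map_add' _ _ := rfl
  commutes' _ := rfl
  map_star' _ := rfl

theorem CliffProd.map_vec (T : V →ₗᵢ[ℝ] W) (v : V) : map T (vec v) = vec (T v) := by
  refine Subtype.ext (funext fun π => ?_)
  change (π.comap T).2.1 (CliffordAlgebra.ι (normForm V) v) =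
    π.2.1 (CliffordAlgebra.ι (normForm W) (T v))
  change π.2.1 (CliffordAlgebra.map _ (CliffordAlgebra.ι (normForm V) v)) = _
  rw [CliffordAlgebra.map_apply_ι]
  rfl

theorem CliffProd.norm_map_le (T : V →ₗᵢ[ℝ] W) (a : CliffProd V) : ‖map T a‖ ≤ ‖a‖ :=
  lp.norm_le_of_forall_le (norm_nonneg _) fun π =>
    lp.norm_apply_le_norm (E := fun π : CliffRep V => OpC π.1) (by simp) a (π.comap T)

theorem CliffProd.continuous_map (T : V →ₗᵢ[ℝ] W) : Continuous (map T) :=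
  AddMonoidHomClass.continuous_of_bound (map T) 1 fun a => by
    simpa using norm_map_le T a

/-- The functoriality `Cl(V) → Cl(W)` with respect to isometries, extending `v ↦ T v`. -/
def Cl.map (T : V →ₗᵢ[ℝ] W) : Cl V →⋆ₐ[ℂ] Cl W :=
  ((CliffProd.map T).comp (cliffSubalgebra V).subtype).codRestrict (cliffSubalgebra W) (by
    rintro ⟨a, ha⟩
    have h1 : (StarAlgebra.adjoin ℂ (Set.range (CliffProd.vec (V := V)))) ≤
        (cliffSubalgebra W).comap (CliffProd.map T) := by
      refine StarAlgebra.adjoin_le ?_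
      rintro _ ⟨v, rfl⟩
      change CliffProd.map T _ ∈ cliffSubalgebra W
      rw [CliffProd.map_vec]
      exact (Cl.vec (T v)).2
    have h2 := StarSubalgebra.topologicalClosure_minimal h1
      ((StarSubalgebra.isClosed_topologicalClosure _).preimage (CliffProd.continuous_map T))
    exact h2 ha)

theorem Cl.map_vec (T : V →ₗᵢ[ℝ] W) (v : V) : Cl.map T (Cl.vec v) = Cl.vec (T v) :=
  Subtype.ext (CliffProd.map_vec T v)

theorem Cl.norm_map_le (T : V →ₗᵢ[ℝ] W) (a : Cl V) : ‖Cl.map T a‖ ≤ ‖a‖ :=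
  CliffProd.norm_map_le T a.1

theorem Cl.continuous_map (T : V →ₗᵢ[ℝ] W) : Continuous (Cl.map T) :=
  AddMonoidHomClass.continuous_of_bound (Cl.map T) 1 fun a => by
    simpa using Cl.norm_map_le T a

end Clifford

/-! ### The graded tensor products -/

section Tensor

variable {U V W X Y : Type*} [NormedAddCommGroup U] [InnerProductSpace ℝ U]
  [NormedAddCommGroup V] [InnerProductSpace ℝ V] [NormedAddCommGroup W] [InnerProductSpace ℝ W]

/-- The Euclidean space `ℝ e ⊕ V`. -/
abbrev EPlus (V : Type*) : Type _ := WithLp 2 (ℝ × V)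

/-- The vector `t e + v` of `ℝ e ⊕ V`. -/
def EPlus.mk (t : ℝ) (v : V) : EPlus V := WithLp.toLp 2 (t, v)

/-- The inclusion `V → ℝ e ⊕ V`. -/
def EPlus.inr (V : Type*) [NormedAddCommGroup V] [InnerProductSpace ℝ V] : V →ₗᵢ[ℝ] EPlus V where
  toFun v := EPlus.mk 0 v
  map_add' v w := by simp [EPlus.mk, ← WithLp.toLp_add]
  map_smul' r v := by simp [EPlus.mk, ← WithLp.toLp_smul]
  norm_map' v := by simp [EPlus.mk]

/-- The isometry `id ⊕ T`. -/
def EPlus.map (T : V →ₗᵢ[ℝ] W) : EPlus V →ₗᵢ[ℝ] EPlus W :=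
  LinearIsometry.withLpProdMap 2 LinearIsometry.id T

/-- The reflection `t e + v ↦ - t e + v`. -/
def EPlus.refl (V : Type*) [NormedAddCommGroup V] [InnerProductSpace ℝ V] : EPlus V →ₗᵢ[ℝ] EPlus V :=
  LinearIsometry.withLpProdMap 2 (LinearIsometryEquiv.neg ℝ).toLinearIsometry LinearIsometry.id

/-- The C*-algebra of bounded functions on `ℝ × X` with values in `Cl(ℝ e ⊕ V)`. -/
abbrev BFun (X V : Type*) [NormedAddCommGroup V] [InnerProductSpace ℝ V] : Type _ :=
  lp (fun _ : ℝ × X => Cl (EPlus V)) ∞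

/-- The graded tensor product `C₀(ℝ) ⊗̂ C₀(X, Cl(V))`, where `C₀(ℝ)` is graded by even and odd
functions: it is realised on the continuous functions `h : ℝ × X → Cl(ℝ e ⊕ V)` vanishing at
infinity such that `h (-x, v)` is the image of `h (x, v)` under the automorphism `e ↦ -e`.
The elementary tensor `f ⊗̂ u` is the function `(x, v) ↦ f(x e) u(v)`, where
`f(x e) = f_even(x) + f_odd(x) e` is the functional calculus of the self-adjoint element `x e`. -/
def SCliff (X V : Type*) [TopologicalSpace X] [NormedAddCommGroup V] [InnerProductSpace ℝ V] :
    NonUnitalStarSubalgebra ℂ (BFun X V) where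
  carrier := {h | Continuous (fun p => h p) ∧ Tendsto (fun p => h p) (cocompact (ℝ × X)) (𝓝 0) ∧
    ∀ x v, h (-x, v) = Cl.map (EPlus.refl V) (h (x, v))}
  zero_mem' := ⟨continuous_const, tendsto_const_nhds, fun _ _ => (map_zero _).symm⟩
  add_mem' := by
    rintro f g ⟨hf, hf', hf''⟩ ⟨hg, hg', hg''⟩
    refine ⟨hf.add hg, by simpa using hf'.add hg', fun x v => ?_⟩
    simp [hf'', hg'']
  mul_mem' := by
    rintro f g ⟨hf, hf', hf''⟩ ⟨hg, hg', hg''⟩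
    refine ⟨by simpa [lp.infty_coeFn_mul] using! hf.mul hg,
      by simpa [lp.infty_coeFn_mul] using! hf'.mul hg', fun x v => ?_⟩
    simp [lp.infty_coeFn_mul, hf'', hg'']
  smul_mem' := by
    rintro c f ⟨hf, hf', hf''⟩
    refine ⟨hf.const_smul c, by simpa using hf'.const_smul c, fun x v => ?_⟩
    simp [hf'']
  star_mem' := by
    rintro f ⟨hf, hf', hf''⟩
    refine ⟨hf.star, by simpa using hf'.star, fun x v => ?_⟩
    simp [hf'', map_star]

/-- The sub-C*-algebra `C₀(-s, s) ⊗̂ C₀(D_s, Cl(V))`, `D_s` the open ball of radius `s`, consists of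
the elements of `C₀(ℝ) ⊗̂ C₀(X, Cl(V))` that vanish off `(-s, s) × D_s`. -/
def SuppIn {X V : Type*} [NormedAddCommGroup X] [NormedAddCommGroup V] [InnerProductSpace ℝ V]
    (s : ℝ) (h : BFun X V) : Prop :=
  ∀ (x : ℝ) (v : X), s ≤ |x| ∨ s ≤ ‖v‖ → h (x, v) = 0

/-- The unit vector in the direction of `n` (and `e` if `n = 0`). -/
def EPlus.dir (n : EPlus V) : EPlus V := open Classical in if n = 0 then EPlus.mk 1 0 else ‖n‖⁻¹ • n

theorem EPlus.norm_dir (n : EPlus V) : ‖EPlus.dir n‖ = 1 := by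
  unfold EPlus.dir
  split_ifs with h
  · simp [EPlus.mk]
  · rw [norm_smul, norm_inv, norm_norm, inv_mul_cancel₀ (norm_ne_zero_iff.2 h)]

theorem EPlus.norm_smul_dir (n : EPlus V) : ‖n‖ • EPlus.dir n = n := by
  unfold EPlus.dir
  split_ifs with h
  · simp [h]
  · rw [smul_smul, mul_inv_cancel₀ (norm_ne_zero_iff.2 h), one_smul]

/-- For `n ∈ ℝ e ⊕ V` orthogonal to the image of `ι : U → V`, the isometry `ℝ e ⊕ U → ℝ e ⊕ V`
that sends `e` to the direction of `n` and is `ι` on `U`. -/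
def bottIsometry (ι : U →ₗᵢ[ℝ] V) (n : EPlus V) (hn : ∀ u, ⟪n.snd, ι u⟫_ℝ = 0) :
    EPlus U →ₗᵢ[ℝ] EPlus V where
  toFun p := p.fst • EPlus.dir n + EPlus.inr V (ι p.snd)
  map_add' p q := by simp [add_smul]; abel
  map_smul' r p := by simp [mul_smul]
  norm_map' p := by
    have h0 : ⟪EPlus.dir n, EPlus.inr V (ι p.snd)⟫_ℝ = 0 := by
      unfold EPlus.dir
      split_ifs with h
      · simp [EPlus.inr, EPlus.mk]
      · rw [inner_smul_left]
        have : ⟪n, EPlus.inr V (ι p.snd)⟫_ℝ = 0 := by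
          simp [EPlus.inr, EPlus.mk, WithLp.prod_inner_apply]
          exact hn _
        simp [this]
    refine (pow_left_inj₀ (norm_nonneg _) (norm_nonneg _) two_ne_zero).1 ?_
    change ‖p.fst • EPlus.dir n + EPlus.inr V (ι p.snd)‖ ^ 2 = ‖p‖ ^ 2
    rw [norm_add_sq_real, inner_smul_left, h0, norm_smul, EPlus.norm_dir, LinearIsometry.norm_map,
      LinearIsometry.norm_map, WithLp.prod_norm_sq_eq_of_L2]
    simp

/-- The fibrewise Bott map. For `h = f ⊗̂ a` it is `f(n) ι(a)`, where `f(n)` is the functional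
calculus of the self-adjoint element `n` of `Cl(ℝ e ⊕ V)`; see `bottFibre_tmul`. -/
def bottFibre (ι : U →ₗᵢ[ℝ] V) (n : EPlus V) (hn : ∀ u, ⟪n.snd, ι u⟫_ℝ = 0)
    (h : ℝ → Cl (EPlus U)) : Cl (EPlus V) :=
  Cl.map (bottIsometry ι n hn) (h ‖n‖)

theorem norm_bottFibre_le (ι : U →ₗᵢ[ℝ] V) (n : EPlus V) (hn : ∀ u, ⟪n.snd, ι u⟫_ℝ = 0)
    (h : ℝ → Cl (EPlus U)) {C : ℝ} (hC : ∀ x, ‖h x‖ ≤ C) : ‖bottFibre ι n hn h‖ ≤ C :=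
  (Cl.norm_map_le _ _).trans (hC _)

theorem Cl.map_map {V₁ V₂ V₃ : Type*} [NormedAddCommGroup V₁] [InnerProductSpace ℝ V₁]
    [NormedAddCommGroup V₂] [InnerProductSpace ℝ V₂] [NormedAddCommGroup V₃]
    [InnerProductSpace ℝ V₃] (S : V₂ →ₗᵢ[ℝ] V₃) (T : V₁ →ₗᵢ[ℝ] V₂) (a : Cl V₁) :
    Cl.map S (Cl.map T a) = Cl.map (S.comp T) a := by
  refine Subtype.ext (Subtype.ext (funext fun π => ?_))
  have h : (π.comap S).comap T = π.comap (S.comp T) := by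
    refine Sigma.ext rfl (heq_of_eq (Subtype.ext ?_))
    change (π.2.1.comp (CliffordAlgebra.map _)).comp (CliffordAlgebra.map _) = π.2.1.comp _
    rw [AlgHom.comp_assoc, CliffordAlgebra.map_comp_map]
    rfl
  exact eq_of_heq (congr_arg_heq a.1.1 h)

/-- On elementary tensors the Bott map is given by the functional calculus. -/
theorem bottFibre_tmul (ι : U →ₗᵢ[ℝ] V) (n : EPlus V) (hn : ∀ u, ⟪n.snd, ι u⟫_ℝ = 0)
    (f : C(ℝ, ℂ)) (a : Cl U) :
    bottFibre ι n hn (fun x => cfc (fun z : ℂ => f z.re) (Cl.vec (EPlus.mk x (0 : U))) *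
      Cl.map (EPlus.inr U) a) =
    cfc (fun z : ℂ => f z.re) (Cl.vec n) * Cl.map (EPlus.inr V) (Cl.map ι a) := by
  have hf : Continuous fun z : ℂ => f z.re := f.continuous.comp Complex.continuous_re
  unfold bottFibre
  rw [map_mul, StarAlgHom.map_cfc (S := ℂ) (Cl.map (bottIsometry ι n hn)) _ _ hf.continuousOn
    (Cl.continuous_map _) (Cl.isSelfAdjoint_vec _).isStarNormal
    (by rw [Cl.map_vec]; exact (Cl.isSelfAdjoint_vec _).isStarNormal), Cl.map_vec, Cl.map_map,
    Cl.map_map]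
  congr 2
  · congr 1
    change ‖n‖ • EPlus.dir n + EPlus.inr V (ι 0) = n
    rw [map_zero, map_zero, add_zero, EPlus.norm_smul_dir]
  · congr 1
    ext u
    change (0 : ℝ) • EPlus.dir n + EPlus.inr V (ι u) = _
    rw [zero_smul, zero_add]
    rfl

end Tensor

/-! ### Bounded families modulo families vanishing along a filter -/

section Asymptotic

variable {P : Type*}

/-- Bounded families of elements of the C*-algebras `B p`, with the seminorm
`limsup ‖a p‖` along the filter `F`. -/
def AsymFun (_F : Filter P) (B : P → Type*) [∀ p, NonUnitalCStarAlgebra (B p)] : Type _ :=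
  lp B ∞

variable (F : Filter P) (B : P → Type*) [∀ p, NonUnitalCStarAlgebra (B p)]

instance : NonUnitalRing (AsymFun F B) := lp.nonUnitalRing

instance : Module ℂ (AsymFun F B) := inferInstanceAs (Module ℂ (lp B ∞))

instance : StarRing (AsymFun F B) := lp.inftyStarRing

instance : StarModule ℂ (AsymFun F B) := inferInstanceAs (StarModule ℂ (lp B ∞))

instance : IsScalarTower ℂ (AsymFun F B) (AsymFun F B) :=
  inferInstanceAs (IsScalarTower ℂ (lp B ∞) (lp B ∞))

instance : SMulCommClass ℂ (AsymFun F B) (AsymFun F B) :=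
  inferInstanceAs (SMulCommClass ℂ (lp B ∞) (lp B ∞))

variable {F B}

/-- The limit superior of the norms: the least `c ≥ 0` such that, for every `ε > 0`,
`‖a p‖ ≤ c + ε` eventually. -/
def asymNorm (a : AsymFun F B) : ℝ := sInf {c : ℝ | 0 ≤ c ∧ ∀ᶠ p in F, ‖a.1 p‖ ≤ c}

theorem asymNorm_bddBelow (a : AsymFun F B) :
    BddBelow {c : ℝ | 0 ≤ c ∧ ∀ᶠ p in F, ‖a.1 p‖ ≤ c} := ⟨0, fun _ h => h.1⟩

theorem asymNorm_le {a : AsymFun F B} {c : ℝ} (hc : 0 ≤ c) (h : ∀ᶠ p in F, ‖a.1 p‖ ≤ c) :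
    asymNorm a ≤ c := csInf_le (asymNorm_bddBelow a) ⟨hc, h⟩

theorem asymNorm_nonempty (a : AsymFun F B) :
    {c : ℝ | 0 ≤ c ∧ ∀ᶠ p in F, ‖a.1 p‖ ≤ c}.Nonempty := by
  refine ⟨‖(show lp B ∞ from a)‖, lp.norm_nonneg' _, Eventually.of_forall fun p => ?_⟩
  exact lp.norm_apply_le_norm (E := B) (by simp) _ p

theorem asymNorm_nonneg (a : AsymFun F B) : 0 ≤ asymNorm a :=
  le_csInf (asymNorm_nonempty a) fun _ h => h.1

theorem eventually_of_asymNorm_lt {a : AsymFun F B} {c : ℝ} (h : asymNorm a < c) :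
    ∀ᶠ p in F, ‖a.1 p‖ ≤ c := by
  obtain ⟨d, ⟨-, hd⟩, hdc⟩ := exists_lt_of_csInf_lt (asymNorm_nonempty a) h
  exact hd.mono fun p hp => hp.trans hdc.le

theorem asymNorm_le_iff {a : AsymFun F B} {c : ℝ} (hc : 0 ≤ c) :
    asymNorm a ≤ c ↔ ∀ ε > 0, ∀ᶠ p in F, ‖a.1 p‖ ≤ c + ε := by
  constructor
  · intro h ε hε
    exact eventually_of_asymNorm_lt (by linarith)
  · intro h
    refine le_of_forall_pos_le_add fun ε hε => asymNorm_le (by positivity) (h ε hε)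

theorem asymNorm_add_le (a b : AsymFun F B) : asymNorm (a + b) ≤ asymNorm a + asymNorm b := by
  refine (asymNorm_le_iff (add_nonneg (asymNorm_nonneg a) (asymNorm_nonneg b))).2 fun ε hε => ?_
  filter_upwards [eventually_of_asymNorm_lt (show asymNorm a < asymNorm a + ε / 2 by linarith),
    eventually_of_asymNorm_lt (show asymNorm b < asymNorm b + ε / 2 by linarith)] with p h1 h2
  have : ‖(a + b).1 p‖ ≤ ‖a.1 p‖ + ‖b.1 p‖ := norm_add_le _ _
  linarith

theorem asymNorm_mul_le (a b : AsymFun F B) : asymNorm (a * b) ≤ asymNorm a * asymNorm b := by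
  have key : ∀ c > asymNorm a, ∀ d > asymNorm b, asymNorm (a * b) ≤ c * d := by
    intro c hc d hd
    have hc0 := (asymNorm_nonneg a).trans hc.le
    have hd0 := (asymNorm_nonneg b).trans hd.le
    refine asymNorm_le (mul_nonneg hc0 hd0) ?_
    filter_upwards [eventually_of_asymNorm_lt hc, eventually_of_asymNorm_lt hd] with p h1 h2
    have : ‖(a * b).1 p‖ ≤ ‖a.1 p‖ * ‖b.1 p‖ := norm_mul_le _ _
    exact this.trans (mul_le_mul h1 h2 (norm_nonneg _) hc0)
  have h1 : ∀ d > asymNorm b, asymNorm (a * b) ≤ asymNorm a * d := by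
    intro d hd
    have ht : Tendsto (fun c => c * d) (𝓝[>] asymNorm a) (𝓝 (asymNorm a * d)) :=
      ((continuous_mul_const d).tendsto _).mono_left nhdsWithin_le_nhds
    exact ge_of_tendsto ht (eventually_nhdsWithin_of_forall fun c hc => key c hc d hd)
  have ht : Tendsto (fun d => asymNorm a * d) (𝓝[>] asymNorm b) (𝓝 (asymNorm a * asymNorm b)) :=
    ((continuous_const_mul _).tendsto _).mono_left nhdsWithin_le_nhds
  exact ge_of_tendsto ht (eventually_nhdsWithin_of_forall fun d hd => h1 d hd)

theorem asymNorm_smul_le (z : ℂ) (a : AsymFun F B) : asymNorm (z • a) ≤ ‖z‖ * asymNorm a := by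
  have key : ∀ c > asymNorm a, asymNorm (z • a) ≤ ‖z‖ * c := by
    intro c hc
    refine asymNorm_le (mul_nonneg (norm_nonneg _) ((asymNorm_nonneg a).trans hc.le)) ?_
    filter_upwards [eventually_of_asymNorm_lt hc] with p h1
    have : ‖(z • a).1 p‖ ≤ ‖z‖ * ‖a.1 p‖ := norm_smul_le _ _
    exact this.trans (by gcongr)
  have ht : Tendsto (fun d => ‖z‖ * d) (𝓝[>] asymNorm a) (𝓝 (‖z‖ * asymNorm a)) :=
    ((continuous_const_mul _).tendsto _).mono_left nhdsWithin_le_nhds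
  exact ge_of_tendsto ht (eventually_nhdsWithin_of_forall fun d hd => key d hd)

theorem asymNorm_star (a : AsymFun F B) : asymNorm (star a) = asymNorm a := by
  unfold asymNorm
  have : ∀ p, ‖(star a).1 p‖ = ‖a.1 p‖ := fun p => norm_star (a.1 p)
  simp_rw [this]

theorem asymNorm_neg (a : AsymFun F B) : asymNorm (-a) = asymNorm a := by
  unfold asymNorm
  have : ∀ p, ‖(-a).1 p‖ = ‖a.1 p‖ := fun p => norm_neg (a.1 p)
  simp_rw [this]

theorem asymNorm_zero : asymNorm (0 : AsymFun F B) = 0 :=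
  le_antisymm (asymNorm_le le_rfl (Eventually.of_forall fun _ => norm_zero.le)) (asymNorm_nonneg _)

theorem asymNorm_mul_self_le (a : AsymFun F B) :
    asymNorm a * asymNorm a ≤ asymNorm (star a * a) := by
  have key : ∀ c > asymNorm (star a * a), asymNorm a * asymNorm a ≤ c := by
    intro c hc
    have hc0 := (asymNorm_nonneg _).trans hc.le
    have : asymNorm a ≤ Real.sqrt c := by
      refine asymNorm_le (Real.sqrt_nonneg _) ?_
      filter_upwards [eventually_of_asymNorm_lt hc] with p h1
      refine Real.le_sqrt_of_sq_le ?_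
      have h2 : ‖(star a * a).1 p‖ = ‖a.1 p‖ * ‖a.1 p‖ := CStarRing.norm_star_mul_self
      rw [sq, ← h2]
      exact h1
    calc asymNorm a * asymNorm a ≤ Real.sqrt c * Real.sqrt c :=
          mul_le_mul this this (asymNorm_nonneg _) (Real.sqrt_nonneg _)
      _ = c := Real.mul_self_sqrt hc0
  exact le_of_forall_gt_imp_ge_of_dense key

variable (F B)

/-- The seminorm as a bundled object. -/
def asymSeminorm : AddGroupSeminorm (AsymFun F B) where
  toFun := asymNorm
  map_zero' := asymNorm_zero
  add_le' := asymNorm_add_le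
  neg' := asymNorm_neg

instance : NonUnitalSeminormedRing (AsymFun F B) where
  toNorm := ⟨asymNorm⟩
  toNonUnitalRing := inferInstance
  toPseudoMetricSpace := (asymSeminorm F B).toSeminormedAddGroup.toPseudoMetricSpace
  dist_eq := (asymSeminorm F B).toSeminormedAddGroup.dist_eq
  norm_mul_le := asymNorm_mul_le

instance : NormedSpace ℂ (AsymFun F B) where
  norm_smul_le := asymNorm_smul_le

instance : NormedStarGroup (AsymFun F B) where
  norm_star_le a := (asymNorm_star a).le

variable {F B}

theorem AsymFun.norm_def (a : AsymFun F B) : ‖a‖ = asymNorm a := rfl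

/-- The identity map. -/
def AsymFun.of (F : Filter P) (B : P → Type*) [∀ p, NonUnitalCStarAlgebra (B p)] :
    lp B ∞ →+ AsymFun F B := AddMonoidHom.id (lp B ∞)

theorem AsymFun.norm_of_le (a : lp B ∞) : ‖AsymFun.of F B a‖ ≤ ‖a‖ :=
  asymNorm_le (lp.norm_nonneg' _) (Eventually.of_forall fun p =>
    lp.norm_apply_le_norm (E := B) (by simp) _ p)

theorem AsymFun.exists_tendsto_sum (u : ℕ → AsymFun F B) (hu : Summable (‖u ·‖)) :
    ∃ a, Tendsto (fun n => ∑ i ∈ Finset.range n, u i) atTop (𝓝 a) := by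
  classical
  -- replace `u n` by a family of small supremum norm with the same class
  let v : ℕ → lp B ∞ := fun n => ⟨fun p => if ‖(u n).1 p‖ ≤ ‖u n‖ + (1 / 2) ^ n then (u n).1 p else 0,
    memℓp_infty ⟨‖u n‖ + (1 / 2) ^ n, by
      rintro _ ⟨p, rfl⟩
      dsimp only
      split_ifs with h
      · exact h
      · rw [norm_zero]; positivity⟩⟩
  have hv : ∀ n, ‖v n‖ ≤ ‖u n‖ + (1 / 2) ^ n := by
    intro n
    refine lp.norm_le_of_forall_le (by positivity) fun p => ?_
    change ‖if ‖(u n).1 p‖ ≤ ‖u n‖ + (1 / 2) ^ n then (u n).1 p else 0‖ ≤ _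
    split_ifs with h
    · exact h
    · rw [norm_zero]; positivity
  have huv : ∀ n, ‖u n - AsymFun.of F B (v n)‖ = 0 := by
    intro n
    refine le_antisymm (asymNorm_le le_rfl ?_) (norm_nonneg _)
    have : ‖u n‖ < ‖u n‖ + (1 / 2) ^ n := by
      have : (0 : ℝ) < (1 / 2) ^ n := by positivity
      linarith
    filter_upwards [eventually_of_asymNorm_lt this] with p hp
    change ‖(u n).1 p - if ‖(u n).1 p‖ ≤ ‖u n‖ + (1 / 2) ^ n then (u n).1 p else 0‖ ≤ 0
    rw [if_pos hp, sub_self, norm_zero]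
  have hvs : Summable fun n => ‖v n‖ :=
    Summable.of_nonneg_of_le (fun n => norm_nonneg _) hv
      (hu.add (summable_geometric_of_lt_one (by norm_num) (by norm_num)))
  have hvs' : Summable v := hvs.of_norm
  refine ⟨AsymFun.of F B (∑' n, v n), ?_⟩
  rw [tendsto_iff_norm_sub_tendsto_zero]
  have h2 := tendsto_iff_norm_sub_tendsto_zero.1 hvs'.hasSum.tendsto_sum_nat
  refine squeeze_zero (fun _ => norm_nonneg _) (fun N => ?_) h2
  have h3 : ‖∑ i ∈ Finset.range N, u i - ∑ i ∈ Finset.range N, AsymFun.of F B (v i)‖ ≤ 0 := by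
    rw [← Finset.sum_sub_distrib]
    refine (norm_sum_le _ _).trans ?_
    simp [huv]
  have h4 : ‖∑ i ∈ Finset.range N, AsymFun.of F B (v i) -
      AsymFun.of F B (∑' n, v n)‖ ≤ ‖∑ i ∈ Finset.range N, v i - ∑' n, v n‖ := by
    rw [← map_sum, ← map_sub]
    exact AsymFun.norm_of_le _
  calc _ ≤ _ := norm_sub_le_norm_sub_add_norm_sub _ (∑ i ∈ Finset.range N, AsymFun.of F B (v i)) _
    _ ≤ 0 + _ := add_le_add h3 h4
    _ = _ := zero_add _

variable (F B)

/-- The C*-algebra of bounded families modulo the families with `limsup ‖a p‖ = 0` along `F`,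
with the norm `limsup ‖a p‖`. -/
def AsymAlg : Type _ := SeparationQuotient (AsymFun F B)

instance : NonUnitalNormedRing (AsymAlg F B) :=
  inferInstanceAs (NonUnitalNormedRing (SeparationQuotient (AsymFun F B)))

instance : NormedSpace ℂ (AsymAlg F B) :=
  inferInstanceAs (NormedSpace ℂ (SeparationQuotient (AsymFun F B)))

instance : CompleteSpace (AsymAlg F B) := by
  refine NormedAddCommGroup.completeSpace_of_summable_imp_tendsto fun u hu => ?_
  choose w hw using fun n => SeparationQuotient.surjective_mk (X := AsymFun F B) (u n)
  obtain ⟨a, ha⟩ := AsymFun.exists_tendsto_sum w (by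
    refine hu.congr fun n => ?_
    rw [← hw n]
    exact (SeparationQuotient.norm_mk (w n)).symm)
  refine ⟨SeparationQuotient.mkCLM ℂ (AsymFun F B) a, ?_⟩
  refine (((SeparationQuotient.mkCLM ℂ (AsymFun F B)).continuous.tendsto a).comp ha).congr
    fun n => ?_
  rw [Function.comp_apply, map_sum]
  exact Finset.sum_congr rfl fun i _ => hw i

/-- The class of a bounded family. -/
def AsymAlg.mk (a : lp B ∞) : AsymAlg F B := SeparationQuotient.mk (AsymFun.of F B a)

instance : StarRing (AsymAlg F B) where
  star := SeparationQuotient.lift (fun a => SeparationQuotient.mk (star a)) fun a b h =>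
    SeparationQuotient.mk_eq_mk.2 (h.map continuous_star)
  star_involutive := by
    rintro ⟨a⟩
    exact congrArg SeparationQuotient.mk (star_star a)
  star_mul := by
    rintro ⟨a⟩ ⟨b⟩
    exact congrArg SeparationQuotient.mk (star_mul a b)
  star_add := by
    rintro ⟨a⟩ ⟨b⟩
    exact congrArg SeparationQuotient.mk (star_add a b)

instance : CStarRing (AsymAlg F B) where
  norm_mul_self_le := by
    rintro ⟨a⟩
    exact asymNorm_mul_self_le a

instance : StarModule ℂ (AsymAlg F B) where
  star_smul := by
    rintro z ⟨a⟩
    exact congrArg SeparationQuotient.mk (star_smul z a)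

instance : IsScalarTower ℂ (AsymAlg F B) (AsymAlg F B) where
  smul_assoc := by
    rintro z ⟨a⟩ ⟨b⟩
    exact congrArg SeparationQuotient.mk (smul_assoc z a b)

instance : SMulCommClass ℂ (AsymAlg F B) (AsymAlg F B) where
  smul_comm := by
    rintro z ⟨a⟩ ⟨b⟩
    exact congrArg SeparationQuotient.mk (smul_comm z a b)

instance : NonUnitalCStarAlgebra (AsymAlg F B) where

variable {F B}

theorem AsymAlg.norm_mk_le_iff (a : lp B ∞) {c : ℝ} (hc : 0 ≤ c) :
    ‖AsymAlg.mk F B a‖ ≤ c ↔ ∀ ε > 0, ∀ᶠ p in F, ‖a p‖ ≤ c + ε :=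
  asymNorm_le_iff (F := F) (B := B) (a := a) hc

/-- The sub-C*-algebra generated by a set. -/
def cstarGen {A : Type*} [NonUnitalCStarAlgebra A] (s : Set A) : NonUnitalStarSubalgebra ℂ A :=
  (NonUnitalStarAlgebra.adjoin ℂ s).topologicalClosure

instance {A : Type*} [NonUnitalCStarAlgebra A] (s : Set A) : NonUnitalCStarAlgebra (cstarGen s) :=
  @NonUnitalStarSubalgebra.nonUnitalCStarAlgebra _ _ _ _ _ _ _ (cstarGen s)
    (NonUnitalStarSubalgebra.isClosed_topologicalClosure _)

theorem subset_cstarGen {A : Type*} [NonUnitalCStarAlgebra A] (s : Set A) :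
    s ⊆ (cstarGen s : Set A) :=
  (NonUnitalStarAlgebra.subset_adjoin ℂ s).trans
    (NonUnitalStarSubalgebra.le_topologicalClosure _)

end Asymptotic

/-! ### Bott maps and pull-backs -/

section Maps

variable {H : Type*} [NormedAddCommGroup H] [InnerProductSpace ℝ H]

/-- A finite-dimensional subspace is complete. -/
instance (E : Submodule ℝ H) [FiniteDimensional ℝ E] : CompleteSpace E :=
  FiniteDimensional.complete ℝ E

/-- The inclusion of subspaces as an isometry. -/
def inclIso {E₁ E₂ : Submodule ℝ H} (h : E₁ ≤ E₂) : E₁ →ₗᵢ[ℝ] E₂ :=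
  ⟨Submodule.inclusion h, fun _ => rfl⟩

variable {U V X Y : Type*} [NormedAddCommGroup U] [InnerProductSpace ℝ U]
  [NormedAddCommGroup V] [InnerProductSpace ℝ V]

/-- The map `f ⊗̂ u ↦ ((x, y) ↦ f(x e + N y) ι(u(pr y)))`, for `N y` orthogonal to `ι(U)`. -/
def bottMap (ι : U →ₗᵢ[ℝ] V) (pr : Y → X) (N : Y → V) (hN : ∀ y u, ⟪N y, ι u⟫_ℝ = 0)
    (h : BFun X U) : BFun Y V :=
  ⟨fun p => bottFibre ι (EPlus.mk p.1 (N p.2)) (hN p.2) (fun t => h (t, pr p.2)),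
    memℓp_infty ⟨‖h‖, by
      rintro _ ⟨p, rfl⟩
      exact norm_bottFibre_le _ _ _ _ fun t => lp.norm_apply_le_norm (by simp) h _⟩⟩

/-- The map `f ⊗̂ u ↦ f ⊗̂ (y ↦ T(u(G y)))`. -/
def pullBack (T : U →ₗᵢ[ℝ] V) (G : Y → X) (h : BFun X U) : BFun Y V :=
  ⟨fun p => Cl.map (EPlus.map T) (h (p.1, G p.2)), memℓp_infty ⟨‖h‖, by
    rintro _ ⟨p, rfl⟩
    exact (Cl.norm_map_le _ _).trans (lp.norm_apply_le_norm (by simp) h _)⟩⟩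

/-- The family indexed by `i` and a point of `ℝ × X i`, which is `0` outside `i ∈ S`
and is made of uniformly bounded functions `h i`. -/
def famOf {I : Type*} {X V : I → Type*} [∀ i, NormedAddCommGroup (V i)]
    [∀ i, InnerProductSpace ℝ (V i)] (S : I → Prop) (h : ∀ i, S i → BFun (X i) (V i)) (C : ℝ)
    (hC : ∀ i hi, ‖h i hi‖ ≤ C) :
    lp (fun p : Σ i, ℝ × X i => Cl (EPlus (V p.1))) ∞ :=
  open Classical in
  ⟨fun p => if hp : S p.1 then h p.1 hp p.2 else 0, memℓp_infty ⟨max C 0, by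
    rintro _ ⟨p, rfl⟩
    dsimp only
    split_ifs with hp
    · exact (lp.norm_apply_le_norm (by simp) (h p.1 hp) p.2).trans ((hC _ _).trans (le_max_left _ _))
    · rw [norm_zero]; exact le_max_right _ _⟩⟩

theorem norm_bottMap_le (ι : U →ₗᵢ[ℝ] V) (pr : Y → X) (N : Y → V)
    (hN : ∀ y u, ⟪N y, ι u⟫_ℝ = 0) (h : BFun X U) : ‖bottMap ι pr N hN h‖ ≤ ‖h‖ :=
  lp.norm_le_of_forall_le (norm_nonneg _) fun _ =>
    norm_bottFibre_le _ _ _ _ fun _ => lp.norm_apply_le_norm (by simp) h _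

theorem norm_pullBack_le (T : U →ₗᵢ[ℝ] V) (G : Y → X) (h : BFun X U) : ‖pullBack T G h‖ ≤ ‖h‖ :=
  lp.norm_le_of_forall_le (norm_nonneg _) fun _ =>
    (Cl.norm_map_le _ _).trans (lp.norm_apply_le_norm (by simp) h _)

/-- The standard Bott map `β : S𝔠(E₁) → S𝔠(E₂)` of finite-dimensional subspaces `E₁ ≤ E₂`, given by
`f ⊗̂ u ↦ ((x, v + w) ↦ f(x e + w) u(v))` for `v ∈ E₁` and `w ∈ E₂ ⊖ E₁`. -/
def bott {E₁ E₂ : Submodule ℝ H} [FiniteDimensional ℝ E₁] (h : E₁ ≤ E₂) :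
    BFun E₁ E₁ → BFun E₂ E₂ :=
  bottMap (inclIso h) (fun y => E₁.orthogonalProjectionOnto y)
    (fun y => y - inclIso h (E₁.orthogonalProjectionOnto y)) (by
      intro y u
      exact Submodule.sub_starProjection_mem_orthogonal (K := E₁) (y : H) u u.2 ▸ by
        rw [real_inner_comm]; rfl)

end Maps

/-! ### Finite approximations and the induced Clifford C*-algebra -/

section Induced

variable {H' H : Type*} [NormedAddCommGroup H'] [InnerProductSpace ℝ H'] [CompleteSpace H']
  [NormedAddCommGroup H] [InnerProductSpace ℝ H] [CompleteSpace H]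

/-- `l` is asymptotically unitary: for every `ε > 0`, `‖(l - l̄)|Vᗮ‖ ≤ ε` for some
finite-dimensional `V`, where `l̄` is the unitary of the polar decomposition of `l`. -/
def AsymUnitary (l : H' ≃L[ℝ] H) : Prop :=
  ∀ ε > 0, ∃ V : Submodule ℝ H', FiniteDimensional ℝ V ∧
    ∀ v ∈ Vᗮ, ‖l v - polarUnitary l v‖ ≤ ε * ‖v‖

/-- A finite approximation of a map `F = l + c` with linear part `l`: maps `F_i = l_i + c_i`
from an increasing family of finite-dimensional subspaces `W'_i`, with dense union, to
`W_i = l_i(W'_i)`. -/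
structure FinApprox (F : H' → H) (l : H' ≃L[ℝ] H) where
  /-- The subspaces of the source. -/
  W' : ℕ → Submodule ℝ H'
  finite_dim : ∀ i, FiniteDimensional ℝ (W' i)
  mono' : Monotone W'
  dense : Dense (⋃ i, (W' i : Set H'))
  /-- The subspaces of the target; they increase, so that the standard Bott maps between the
  algebras `S𝔠(W_i)` are defined. -/
  W : ℕ → Submodule ℝ H
  mono : Monotone W
  /-- The linear parts `l_i`. -/
  lin : ∀ i, W' i ≃L[ℝ] W i
  /-- The maps `F_i`. -/
  map : ∀ i, W' i → W i
  continuous_map : ∀ i, Continuous (map i)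
  /-- The radii in the target. -/
  s : ℕ → ℝ
  /-- The radii in the source. -/
  r : ℕ → ℝ
  s_pos : 0 < s 0
  s_mono : StrictMono s
  s_tendsto : Tendsto s atTop atTop
  r_mono : StrictMono r
  r_tendsto : Tendsto r atTop atTop
  s_le_r : ∀ i, s i ≤ r i
  proper : ∀ i (m : W' i), ‖map i m‖ < s i → ‖m‖ < r i
  map_tendsto : ∀ i₀, ∀ ε > 0, ∀ᶠ i in atTop, ∀ (h : i₀ ≤ i) (m : W' i₀), ‖m‖ < r i₀ →
    ‖F m - map i (inclIso (mono' h) m)‖ ≤ ε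
  asymUnitary : AsymUnitary l
  lin_tendsto : ∀ i₀, ∀ ε > 0, ∀ᶠ i in atTop, ∀ (h : i₀ ≤ i) (m : W' i₀),
    ‖l m - lin i (inclIso (mono' h) m)‖ ≤ ε * ‖m‖
  lin_bound : ∃ C > 0, ∀ i, C⁻¹ * ‖(l : H' →L[ℝ] H)‖ ≤ ‖(lin i : W' i →L[ℝ] W i)‖ ∧
    ‖(lin i : W' i →L[ℝ] W i)‖ ≤ C * ‖(l : H' →L[ℝ] H)‖

namespace FinApprox

variable {F : H' → H} {l : H' ≃L[ℝ] H} (D : FinApprox F l)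

instance (i : ℕ) : FiniteDimensional ℝ (D.W' i) := D.finite_dim i

instance (i : ℕ) : FiniteDimensional ℝ (D.W i) :=
  LinearEquiv.finiteDimensional (D.lin i).toLinearEquiv

/-- The homomorphism `F_i^*`, `F_i^*(h)(v') = l̄_i⁻¹(h(F_i(v')))`. -/
def pull (i : ℕ) : BFun (D.W i) (D.W i) → BFun (D.W' i) (D.W' i) :=
  pullBack (polarUnitary (D.lin i)).symm.toLinearIsometry (D.map i)

/-- `u ∈ S_{s_{i₀}}𝔠(D_{s_{i₀}})` defines a compatible sequence:
`u_i = β(u)` lies in `S_{s_i}𝔠(D_{s_i})` for all `i ≥ i₀`. -/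
def Compatible (i₀ : ℕ) (u : BFun (D.W i₀) (D.W i₀)) : Prop :=
  u ∈ SCliff (D.W i₀) (D.W i₀) ∧ SuppIn (D.s i₀) u ∧
    ∀ i (h : i₀ ≤ i), SuppIn (D.s i) (bott (D.mono h) u)

/-- The sequence `α_i = F_i^*(β(u))`, `i ≥ i₀`, (extended by `0` to `i < i₀`). -/
def seq (i₀ : ℕ) (u : BFun (D.W i₀) (D.W i₀)) :
    lp (fun p : Σ i, ℝ × D.W' i => Cl (EPlus (D.W' p.1))) ∞ :=
  famOf (X := fun i => D.W' i) (V := fun i => D.W' i) (fun i => i₀ ≤ i)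
    (fun i h => D.pull i (bott (D.mono h) u)) ‖u‖
    fun _ _ => (norm_pullBack_le _ _ _).trans (norm_bottMap_le _ _ _ _ _)

/-- The filter on the points `(i, x, v')`, `v' ∈ W'_i`, along which the limit superior of `‖α_i(x, v')‖`
is `lim_j limsup_i ‖α_i|D'_{r_j}‖`, with `D'_{r_j} ⊆ W'_j` the open ball of radius `r_j`. -/
def filter : Filter (Σ i, ℝ × D.W' i) :=
  ⨆ j, comap Sigma.fst atTop ⊓
    𝓟 {p | (p.2.2 : H') ∈ D.W' j ∧ ‖p.2.2‖ < D.r j}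

theorem eventually_filter {Q : (Σ i, ℝ × D.W' i) → Prop} :
    (∀ᶠ p in D.filter, Q p) ↔ ∀ j, ∀ᶠ i in atTop, ∀ (x : ℝ) (v : D.W' i),
      (v : H') ∈ D.W' j → ‖v‖ < D.r j → Q ⟨i, x, v⟩ := by
  simp only [filter, eventually_iSup, eventually_inf_principal, eventually_comap]
  refine forall_congr' fun j => eventually_congr (Eventually.of_forall fun i => ?_)
  constructor
  · intro h x v hv hr
    exact h ⟨i, x, v⟩ rfl ⟨hv, hr⟩
  · rintro h ⟨_, x, v⟩ rfl ⟨hv, hr⟩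
    exact h x v hv hr

/-- The algebra of bounded sequences `α_i : ℝ × W'_i → Cl(ℝ e ⊕ W'_i)` modulo the sequences of
norm `0`, with the norm `lim_j limsup_i ‖α_i|D'_{r_j}‖`. -/
abbrev Seqs : Type _ :=
  AsymAlg D.filter (fun p : Σ i, ℝ × D.W' i => Cl (EPlus (D.W' p.1)))

theorem norm_mk_le_iff (a : lp (fun p : Σ i, ℝ × D.W' i => Cl (EPlus (D.W' p.1))) ∞) {c : ℝ}
    (hc : 0 ≤ c) : ‖(AsymAlg.mk _ _ a : D.Seqs)‖ ≤ c ↔ ∀ ε > 0, ∀ j, ∀ᶠ i in atTop,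
      ∀ (x : ℝ) (v : D.W' i), (v : H') ∈ D.W' j → ‖v‖ < D.r j → ‖a ⟨i, x, v⟩‖ ≤ c + ε := by
  rw [AsymAlg.norm_mk_le_iff a hc]
  simp only [eventually_filter]

/-- The induced Clifford C*-algebra `S𝔠_F(H')`: the norm closure of (the algebra of) all
`F`-compatible sequences. -/
abbrev InducedAlg : Type _ :=
  cstarGen {a : D.Seqs | ∃ i₀ u, D.Compatible i₀ u ∧ a = AsymAlg.mk _ _ (D.seq i₀ u)}

/-- The element of `S𝔠_F(H')` given by a compatible sequence. -/
def cls (i₀ : ℕ) (u : BFun (D.W i₀) (D.W i₀)) (hu : D.Compatible i₀ u) : D.InducedAlg :=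
  ⟨AsymAlg.mk _ _ (D.seq i₀ u), subset_cstarGen _ ⟨i₀, u, hu, rfl⟩⟩

end FinApprox

end Induced

/-! ### The algebra `S𝔠_l(H')` -/

section Linear

variable {H' H : Type*} [NormedAddCommGroup H'] [InnerProductSpace ℝ H'] [CompleteSpace H']
  [NormedAddCommGroup H] [InnerProductSpace ℝ H] [CompleteSpace H]

/-- The finite-dimensional subspaces, ordered by inclusion. -/
abbrev FinSub (H : Type*) [NormedAddCommGroup H] [InnerProductSpace ℝ H] : Type _ :=
  {E : Submodule ℝ H // FiniteDimensional ℝ E}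

instance (E : FinSub H) : FiniteDimensional ℝ E.1 := E.2

variable (l : H' ≃L[ℝ] H)

/-- The operator `C_l = l̄⁻¹ ∘ l`. -/
def indOp : H' ≃L[ℝ] H' := l.trans (polarUnitary l).symm.toContinuousLinearEquiv

/-- `Ē' = l̄⁻¹(l(E'))`. -/
def barSub (E : Submodule ℝ H') : Submodule ℝ H' := E.map (indOp l : H' →ₗ[ℝ] H')

instance (E : Submodule ℝ H') [FiniteDimensional ℝ E] : FiniteDimensional ℝ (barSub l E) :=
  inferInstanceAs (FiniteDimensional ℝ (E.map (indOp l : H' →ₗ[ℝ] H')))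

variable {l} {Ea Eb : Submodule ℝ H'} [FiniteDimensional ℝ Ea] [FiniteDimensional ℝ Eb]

/-- The orthogonal projection from `C_l(E'_b ⊖ E'_a)` to `Ē'_b ⊖ Ē'_a`. -/
def prHat (l : H' ≃L[ℝ] H) (Ea Eb : Submodule ℝ H') [FiniteDimensional ℝ Ea] [FiniteDimensional ℝ Eb] :
    barSub l (Eb ⊓ Eaᗮ) →L[ℝ] (barSub l Eb ⊓ (barSub l Ea)ᗮ : Submodule ℝ H') :=
  (barSub l Eb ⊓ (barSub l Ea)ᗮ).orthogonalProjectionOnto.comp (barSub l (Eb ⊓ Eaᗮ)).subtypeL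

theorem prHat_bounded_below (h : Ea ≤ Eb) :
    ∃ c > 0, ∀ x, c * ‖x‖ ≤ ‖prHat l Ea Eb x‖ := by
  have hinj : Function.Injective (prHat l Ea Eb) := by
    rw [injective_iff_map_eq_zero]
    rintro ⟨z, hz⟩ h0
    have hzb : z ∈ barSub l Eb := Submodule.map_mono inf_le_left hz
    have hle : barSub l Ea ≤ barSub l Eb := Submodule.map_mono h
    rw [← Submodule.sup_orthogonal_inf_of_hasOrthogonalProjection hle, Submodule.mem_sup] at hzb
    obtain ⟨p, hp, q, hq, hpq⟩ := hzb
    have h1 : z ∈ (barSub l Eb ⊓ (barSub l Ea)ᗮ)ᗮ := by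
      exact Submodule.orthogonalProjectionOnto_eq_zero_iff.1 h0
    have h2 : ⟪q, z⟫_ℝ = 0 := h1 q ⟨hq.2, hq.1⟩
    have h3 : ⟪q, p⟫_ℝ = 0 := by rw [real_inner_comm]; exact hq.1 p hp
    rw [← hpq, inner_add_right, h3, zero_add, inner_self_eq_zero] at h2
    rw [h2, add_zero] at hpq
    obtain ⟨w, hw, rfl⟩ := hz
    obtain ⟨w', hw', rfl⟩ := hp
    have h4 : w' = w := (indOp l).injective hpq
    subst h4
    have h5 : w' = 0 := by
      have := hw.2 w' hw'
      rwa [inner_self_eq_zero] at this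
    refine Subtype.ext ?_
    simp [h5]
  obtain ⟨K, hK, hanti⟩ := LinearMap.exists_antilipschitzWith (prHat l Ea Eb).toLinearMap
    (LinearMap.ker_eq_bot.2 hinj)
  refine ⟨(K : ℝ)⁻¹, by positivity, fun x => ?_⟩
  have := hanti.le_mul_dist x 0
  rw [map_zero, dist_zero_right, dist_zero_right] at this
  rw [inv_mul_le_iff₀ (by positivity)]
  exact this

/-- The map `E'_b → Ē'_b`, `v + w ↦ pr̂(C_l w)` for `v ∈ E'_a`, `w ∈ E'_b ⊖ E'_a`, where `pr̂` is
the unitary of the polar decomposition of the projection `C_l(E'_b ⊖ E'_a) → Ē'_b ⊖ Ē'_a`. -/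
def linNormal (h : Ea ≤ Eb) (y : Eb) : barSub l Eb :=
  inclIso inf_le_left (polarIsometry (prHat l Ea Eb) (prHat_bounded_below h)
    ⟨indOp l (y - Ea.starProjection y), Submodule.mem_map_of_mem
      ⟨Eb.sub_mem y.2 (h (Submodule.starProjection_apply_mem _ _)),
        Submodule.sub_starProjection_mem_orthogonal _⟩⟩)

/-- The Bott map `β_{ba} : S𝔠_l(E'_a) → S𝔠_l(E'_b)`, where `S𝔠_l(E') = C₀(ℝ) ⊗̂ C₀(E', Cl(Ē'))`,
given by `f ⊗̂ u ↦ ((x, v + w) ↦ f(x e + pr̂(C_l w)) u(v))`. -/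
def linBott (h : Ea ≤ Eb) : BFun Ea (barSub l Ea) → BFun Eb (barSub l Eb) :=
  bottMap (inclIso (Submodule.map_mono h)) (fun y => Ea.orthogonalProjectionOnto y)
    (linNormal h) (by
      intro y u
      rw [real_inner_comm]
      exact (polarIsometry (prHat l Ea Eb) (prHat_bounded_below h) _).2.2 u u.2)

variable (l)

/-- The net `b ↦ β_{ba}(h)`, `b ≥ a`. -/
def linNet (E : FinSub H') (h : BFun E.1 (barSub l E.1)) :
    lp (fun p : Σ E : FinSub H', ℝ × E.1 => Cl (EPlus (barSub l p.1.1))) ∞ :=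
  famOf (X := fun E : FinSub H' => E.1) (V := fun E : FinSub H' => barSub l E.1) (fun E' => E ≤ E')
    (fun _ hE => linBott hE h) ‖h‖ fun _ _ => norm_bottMap_le _ _ _ _ _

/-- Bounded nets, over all finite-dimensional subspaces `E'_b`, of bounded functions
`ℝ × E'_b → Cl(ℝ e ⊕ Ē'_b)`, modulo those converging to `0`, with the norm `limsup_b ‖a_b‖`. -/
abbrev LinNets : Type _ :=
  AsymAlg (comap Sigma.fst atTop)
    (fun p : Σ E : FinSub H', ℝ × E.1 => Cl (EPlus (barSub l p.1.1)))

/-- The direct limit C*-algebra `S𝔠_l(H') = lim S𝔠_l(E'_a)`. -/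
abbrev LinAlg : Type _ :=
  cstarGen {a : LinNets l | ∃ (E : FinSub H') (h : BFun E.1 (barSub l E.1)),
    h ∈ SCliff E.1 (barSub l E.1) ∧ a = AsymAlg.mk _ _ (linNet l E h)}

/-- The map `l̄⁻¹ : l(E') → Ē'`. -/
def polarInv (E : Submodule ℝ H') : E.map (l : H' →ₗ[ℝ] H) →ₗᵢ[ℝ] barSub l E where
  toFun y := ⟨(polarUnitary l).symm y, by
    obtain ⟨_, v, hv, rfl⟩ := y
    exact ⟨v, hv, rfl⟩⟩
  map_add' _ _ := Subtype.ext (by simp)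
  map_smul' _ _ := Subtype.ext (by simp)
  norm_map' y := (polarUnitary l).symm.norm_map y

/-- The isomorphism `l^* : S𝔠(l(E')) → S𝔠_l(E')`, `l^*(u)(v') = l̄⁻¹(u(l(v')))`. -/
def linPull (E : Submodule ℝ H') :
    BFun (E.map (l : H' →ₗ[ℝ] H)) (E.map (l : H' →ₗ[ℝ] H)) → BFun E (barSub l E) :=
  pullBack (polarInv l E) (fun v => ⟨l v, Submodule.mem_map_of_mem v.2⟩)

end Linear

/-! ### The model case -/

section Model

variable (H' H : Type*) [NormedAddCommGroup H'] [InnerProductSpace ℝ H'] [CompleteSpace H']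
  [NormedAddCommGroup H] [InnerProductSpace ℝ H] [CompleteSpace H]

/-- The model case: `H'` and `H` are the Hilbert sums of finite-dimensional subspaces `E'_k` and
`E_k = l(E'_k)`, and `F = (F_0, F_1, …) : H' → H` for proper maps `F_k : E'_k → E_k`, with
asymptotically unitary linear part `l = (l_0, l_1, …)`. -/
structure ModelCase where
  /-- The linear part. -/
  l : H' ≃L[ℝ] H
  asymUnitary : AsymUnitary l
  /-- The map. -/
  F : H' → H
  continuous_F : Continuous F
  /-- The summands of `H'`. -/
  E' : ℕ → Submodule ℝ H'
  finite_dim : ∀ k, FiniteDimensional ℝ (E' k)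
  ortho' : ∀ j k, j ≠ k → E' j ⟂ E' k
  dense : Dense ((⨆ k, E' k : Submodule ℝ H') : Set H')
  ortho : ∀ j k, j ≠ k → (E' j).map (l : H' →ₗ[ℝ] H) ⟂ (E' k).map (l : H' →ₗ[ℝ] H)
  /-- The components. -/
  comp : ∀ k, E' k → (E' k).map (l : H' →ₗ[ℝ] H)
  proper : ∀ k, IsProperMap (comp k)
  diag : ∀ v k, ((E' k).map (l : H' →ₗ[ℝ] H)).orthogonalProjectionOnto (F v) =
    comp k ((E' k).orthogonalProjectionOnto v)

namespace ModelCase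

variable {H' H} (M : ModelCase H' H)

instance (k : ℕ) : FiniteDimensional ℝ (M.E' k) := M.finite_dim k

/-- `E'_t = ⊕_{k ∈ t} E'_k`. -/
def src (t : Finset ℕ) : Submodule ℝ H' := t.sup M.E'

instance (t : Finset ℕ) : FiniteDimensional ℝ (M.src t) :=
  Submodule.finiteDimensional_finset_sup t M.E'

/-- `E_t = ⊕_{k ∈ t} E_k = l(E'_t)`. -/
def tgt (t : Finset ℕ) : Submodule ℝ H := (M.src t).map (M.l : H' →ₗ[ℝ] H)

instance (t : Finset ℕ) : FiniteDimensional ℝ (M.tgt t) :=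
  inferInstanceAs (FiniteDimensional ℝ ((M.src t).map (M.l : H' →ₗ[ℝ] H)))

/-- `F_t = ⊕_{k ∈ t} F_k : E'_t → E_t`. -/
def part (t : Finset ℕ) (v : M.src t) : M.tgt t := (M.tgt t).orthogonalProjectionOnto (M.F v)

/-- The linear part `l_t : E'_t → E_t` of `F_t`. -/
def linPart (t : Finset ℕ) : M.src t ≃L[ℝ] M.tgt t := M.l.submoduleMap (M.src t)

/-- `F_t^* : S𝔠(E_t) → S𝔠(E'_t)`, `F_t^*(u)(v') = l̄_t⁻¹(u(F_t(v')))`. -/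
def pull (t : Finset ℕ) : BFun (M.tgt t) (M.tgt t) → BFun (M.src t) (M.src t) :=
  pullBack (polarUnitary (M.linPart t)).symm.toLinearIsometry (M.part t)

theorem src_mono {t₁ t₂ : Finset ℕ} (h : t₁ ⊆ t₂) : M.src t₁ ≤ M.src t₂ := Finset.sup_mono h

theorem src_ortho {t₁ t₂ : Finset ℕ} (h : Disjoint t₁ t₂) : M.src t₁ ⟂ M.src t₂ := by
  rw [Submodule.isOrtho_iff_le]
  refine Finset.sup_le fun j hj => ?_
  rw [← Submodule.isOrtho_iff_le, Submodule.isOrtho_comm, Submodule.isOrtho_iff_le]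
  refine Finset.sup_le fun k hk => ?_
  rw [← Submodule.isOrtho_iff_le]
  exact M.ortho' k j fun hkj => Finset.disjoint_left.1 h hj (hkj ▸ hk)

/-- The induced Clifford operator `C_{F_t} = l̄_t⁻¹ ∘ F_t : E'_t → E'_t`. -/
def indClifford (t : Finset ℕ) (v : M.src t) : M.src t :=
  (polarUnitary (M.linPart t)).symm (M.part t v)

/-- The induced Bott map for `i ≤ j`: with `E'_{≤ i} = E'_0 ⊕ ⋯ ⊕ E'_i` it is the map given by
`f ⊗̂ u ↦ ((x, v + w) ↦ f(x e + C_{(F_{i+1}, …, F_j)}(w)) u(v))`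
for `v ∈ E'_{≤ i}` and `w ∈ E'_{i+1} ⊕ ⋯ ⊕ E'_j`. -/
def indBott {i j : ℕ} (h : i ≤ j) :
    BFun (M.src (Finset.Iic i)) (M.src (Finset.Iic i)) →
      BFun (M.src (Finset.Iic j)) (M.src (Finset.Iic j)) :=
  bottMap (inclIso (M.src_mono (Finset.Iic_subset_Iic.2 h)))
    (fun y => (M.src (Finset.Iic i)).orthogonalProjectionOnto y)
    (fun y => inclIso (M.src_mono (fun k hk => Finset.mem_Iic.2 (Finset.mem_Ioc.1 hk).2))
      (M.indClifford (Finset.Ioc i j) ((M.src (Finset.Ioc i j)).orthogonalProjectionOnto y))) (by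
    intro y u
    refine (M.src_ortho ?_).inner_eq (Submodule.coe_mem (M.indClifford (Finset.Ioc i j) _)) u.2
    rw [Finset.disjoint_left]
    intro k hk hk'
    exact absurd (Finset.mem_Iic.1 hk') (not_le.2 (Finset.mem_Ioc.1 hk).1))

/-- The sequence `j ↦ β_{i,j}(a)`, `j ≥ i`. -/
def seq (i : ℕ) (a : BFun (M.src (Finset.Iic i)) (M.src (Finset.Iic i))) :
    lp (fun p : Σ j, ℝ × M.src (Finset.Iic j) => Cl (EPlus (M.src (Finset.Iic p.1)))) ∞ :=
  famOf (X := fun j => M.src (Finset.Iic j)) (V := fun j => M.src (Finset.Iic j)) (fun j => i ≤ j)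
    (fun _ h => M.indBott h a) ‖a‖ fun _ _ => norm_bottMap_le _ _ _ _ _

/-- Bounded sequences of bounded functions `ℝ × E'_{≤ j} → Cl(ℝ e ⊕ E'_{≤ j})` modulo null
sequences, with the norm `limsup_j ‖a_j‖`. -/
abbrev Seqs : Type _ :=
  AsymAlg (comap Sigma.fst atTop)
    (fun p : Σ j, ℝ × M.src (Finset.Iic j) => Cl (EPlus (M.src (Finset.Iic p.1))))

/-- The direct limit C*-algebra `S𝔠_F(H') = lim S𝔠_F(E'_0 ⊕ ⋯ ⊕ E'_i)`, where
`S𝔠_F(E'_0 ⊕ ⋯ ⊕ E'_i)` is the image of `S𝔠(E_0 ⊕ ⋯ ⊕ E_i)` under `(F_0, …, F_i)^*`. -/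
abbrev Alg : Type _ :=
  cstarGen {a : M.Seqs | ∃ i u, u ∈ SCliff (M.tgt (Finset.Iic i)) (M.tgt (Finset.Iic i)) ∧
    a = AsymAlg.mk _ _ (M.seq i (M.pull (Finset.Iic i) u))}

/-- The class of `(F_0, …, F_i)^*(u)`. -/
def cls (i : ℕ) (u : BFun (M.tgt (Finset.Iic i)) (M.tgt (Finset.Iic i)))
    (hu : u ∈ SCliff (M.tgt (Finset.Iic i)) (M.tgt (Finset.Iic i))) : M.Alg :=
  ⟨AsymAlg.mk _ _ (M.seq i (M.pull (Finset.Iic i) u)), subset_cstarGen _ ⟨i, u, hu, rfl⟩⟩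

end ModelCase

end Model

end

end InducedClifford

open InducedClifford

namespace InducedClifford

noncomputable section

/-! ### Continuity of the functor `Cl` -/

section CliffordMaps

universe w

variable {V W : Type*} [NormedAddCommGroup V] [InnerProductSpace ℝ V]
  [NormedAddCommGroup W] [InnerProductSpace ℝ W]

/-! All the algebras of the theorem are compared with one C*-algebra that depends only on `F`,
called the hub below. For a finite-dimensional E ⊆ H and u ∈ S𝔠(E), its generator `hubHom F E u` is
the class of the net that assigns to E' ⊇ E the function (x, v) ↦ β(u)(x, F v) on ℝ × F⁻¹(E'). Bott
maps are transitive (`bott_bott`), so u and β(u) have the same class.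

The central point is a formula for norms. An isometry into a finite-dimensional space induces a
norm-preserving map of Clifford algebras (`Cl.norm_map`). Hence ‖β(u)(x, y)‖ = ‖u(‖x e + (y − P y)‖,
P y)‖ with P the projection to E. This number, `profile`, involves neither the larger subspace nor
any of the unitaries l̄_i. The hub norm of u is the supremum of its profiles over x ∈ ℝ and y ∈
F(H'). The class of u has the same norm in each of the other algebras. For a finite approximation
this holds because profiles are uniformly continuous, F is continuous, the union of the W'_i is
dense and F_i → F uniformly on balls. In the model case it holds because F − F_{≤k} is a constant on
E'_{≤k} that tends to 0 with k.

A `BottSystem` records what is then needed: homomorphisms compatible with the Bott maps, the norm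
formula, and density of the classes in the hub. The pairs (image of u, hub class of u) form a
*-algebra whose two coordinates have equal norm, so its closure is the graph of an isomorphism
(`exists_starAlgEquiv`). Composing two such isomorphisms gives Φ. The bound on ‖Φ[u] − [v]‖ holds
because `hubHom` is contractive and both classes can be computed in the sum of the two subspaces.

Density is a perturbation argument. An element of S𝔠(E) is cut off to a ball and carried into
S𝔠(W_j) by an isometry E → W_j close to the inclusion. The error is controlled by
`SCliff.exists_bottFibre_sub_le`, the uniform continuity of the fibrewise Bott map. There the
direction of the normal vector n is discontinuous at n = 0; the grading compensates, since values at
0 are fixed by e ↦ −e and do not see this direction.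

For F = l it remains to relate the nets l^*(β(u)) to the generators of S𝔠_l(H'), whose Bott maps use
pr̂ C_l. For large E the subspaces C_l(E) and C_l(Eᗮ) are almost orthogonal because l is
asymptotically unitary (`AsymUnitary.exists_norm_proj_le`), so the two kinds of nets approximate
each other (`exists_linHom_sub_le`, `exists_linNet_sub_le`). -/

theorem CliffProd.norm_vec_le (v : V) : ‖CliffProd.vec v‖ ≤ ‖v‖ :=
  lp.norm_le_of_forall_le (norm_nonneg _) fun π => (π.norm_ι v).le

theorem CliffProd.vec_sub (v w : V) : CliffProd.vec (v - w) = CliffProd.vec v - CliffProd.vec w := by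
  refine Subtype.ext (funext fun π => ?_)
  change π.2.1 (CliffordAlgebra.ι (normForm V) (v - w)) =
    π.2.1 (CliffordAlgebra.ι (normForm V) v) - π.2.1 (CliffordAlgebra.ι (normForm V) w)
  rw [map_sub, map_sub]

theorem CliffProd.vec_neg (v : V) : CliffProd.vec (-v) = -CliffProd.vec v := by
  refine Subtype.ext (funext fun π => ?_)
  change π.2.1 (CliffordAlgebra.ι (normForm V) (-v)) =
    -π.2.1 (CliffordAlgebra.ι (normForm V) v)
  rw [map_neg, map_neg]

theorem CliffProd.vec_mul_self (v : V) :
    CliffProd.vec v * CliffProd.vec v = algebraMap ℂ (CliffProd V) ((‖v‖ : ℂ) ^ 2) := by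
  refine Subtype.ext (funext fun π => ?_)
  change π.2.1 (CliffordAlgebra.ι (normForm V) v) * π.2.1 (CliffordAlgebra.ι (normForm V) v) =
    algebraMap ℂ (OpC π.1) ((‖v‖ : ℂ) ^ 2)
  rw [← map_mul, CliffordAlgebra.ι_sq_scalar, AlgHom.commutes, ← Complex.ofReal_pow]
  rw [IsScalarTower.algebraMap_apply ℝ ℂ (OpC π.1)]
  simp [normForm]

theorem CliffProd.vec_mul_vec_of_inner_eq_zero {v w : V} (h : ⟪v, w⟫_ℝ = 0) :
    CliffProd.vec v * CliffProd.vec w = -(CliffProd.vec w * CliffProd.vec v) := by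
  refine Subtype.ext (funext fun π => ?_)
  change π.2.1 (CliffordAlgebra.ι (normForm V) v) * π.2.1 (CliffordAlgebra.ι (normForm V) w) =
    -(π.2.1 (CliffordAlgebra.ι (normForm V) w) * π.2.1 (CliffordAlgebra.ι (normForm V) v))
  have h0 : QuadraticMap.polar (normForm V) v w = 0 := by
    simp [normForm, QuadraticMap.polar, h, real_inner_comm, inner_add_right]
  rw [eq_neg_iff_add_eq_zero, ← map_mul π.2.1, ← map_mul π.2.1, ← map_add π.2.1,
    CliffordAlgebra.ι_mul_ι_add_swap, h0, map_zero, map_zero]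

theorem CliffProd.star_vec (v : V) : star (CliffProd.vec v) = CliffProd.vec v := by
  refine Subtype.ext (funext fun π => ?_)
  exact (π.2.2 v).star_eq

/-- The number ρ is chosen before the target W, and this uniformity is what is used later. The
estimate holds on vectors, survives the algebra operations because the induced maps are contractive,
and passes to the closure. -/
theorem CliffProd.exists_map_sub_map_le {a : CliffProd V} (ha : a ∈ cliffSubalgebra V) :
    ∀ ε > 0, ∃ ρ > 0, ∀ (W : Type w) [NormedAddCommGroup W] [InnerProductSpace ℝ W]
      (S T : V →ₗᵢ[ℝ] W), (∀ v, ‖S v - T v‖ ≤ ρ * ‖v‖) →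
        ‖CliffProd.map S a - CliffProd.map T a‖ ≤ ε := by
  have key : ∀ a ∈ StarAlgebra.adjoin ℂ (Set.range (CliffProd.vec (V := V))), ∀ ε > 0, ∃ ρ > 0,
      ∀ (W : Type w) [NormedAddCommGroup W] [InnerProductSpace ℝ W]
      (S T : V →ₗᵢ[ℝ] W), (∀ v, ‖S v - T v‖ ≤ ρ * ‖v‖) →
        ‖CliffProd.map S a - CliffProd.map T a‖ ≤ ε := by
    intro a ha
    induction ha using StarAlgebra.adjoin_induction with
    | mem x hx =>
      obtain ⟨v, rfl⟩ := hx
      intro ε hε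
      refine ⟨ε / (‖v‖ + 1), by positivity, fun W _ _ S T h => ?_⟩
      rw [CliffProd.map_vec, CliffProd.map_vec, ← CliffProd.vec_sub]
      refine (CliffProd.norm_vec_le _).trans ((h v).trans ?_)
      rw [div_mul_eq_mul_div, div_le_iff₀ (by positivity)]
      gcongr
      linarith
    | algebraMap r =>
      intro ε hε
      refine ⟨1, one_pos, fun W _ _ S T h => ?_⟩
      rw [AlgHomClass.commutes, AlgHomClass.commutes, sub_self, norm_zero]
      exact hε.le
    | add x y hx hy ihx ihy =>
      intro ε hε
      obtain ⟨ρ₁, h1, H1⟩ := ihx (ε / 2) (by positivity)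
      obtain ⟨ρ₂, h2, H2⟩ := ihy (ε / 2) (by positivity)
      refine ⟨min ρ₁ ρ₂, lt_min h1 h2, fun W _ _ S T h => ?_⟩
      have e1 := H1 W S T fun v => (h v).trans (by gcongr; exact min_le_left _ _)
      have e2 := H2 W S T fun v => (h v).trans (by gcongr; exact min_le_right _ _)
      rw [map_add, map_add, add_sub_add_comm]
      exact (norm_add_le _ _).trans (by linarith)
    | mul x y hx hy ihx ihy =>
      intro ε hε
      obtain ⟨ρ₁, h1, H1⟩ := ihx (ε / (2 * (‖y‖ + 1))) (by positivity)
      obtain ⟨ρ₂, h2, H2⟩ := ihy (ε / (2 * (‖x‖ + 1))) (by positivity)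
      refine ⟨min ρ₁ ρ₂, lt_min h1 h2, fun W _ _ S T h => ?_⟩
      have e1 := H1 W S T fun v => (h v).trans (by gcongr; exact min_le_left _ _)
      have e2 := H2 W S T fun v => (h v).trans (by gcongr; exact min_le_right _ _)
      have e3 := CliffProd.norm_map_le S y
      have e4 := CliffProd.norm_map_le T x
      have : CliffProd.map S (x * y) - CliffProd.map T (x * y) =
          (CliffProd.map S x - CliffProd.map T x) * CliffProd.map S y +
          CliffProd.map T x * (CliffProd.map S y - CliffProd.map T y) := by
        rw [map_mul, map_mul]; noncomm_ring
      rw [this]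
      have f1 : ε / (2 * (‖y‖ + 1)) * ‖y‖ ≤ ε / 2 := by
        rw [div_mul_eq_mul_div, div_le_div_iff₀ (by positivity) (by positivity)]
        nlinarith [norm_nonneg y]
      have f2 : ‖x‖ * (ε / (2 * (‖x‖ + 1))) ≤ ε / 2 := by
        rw [mul_div_assoc', div_le_div_iff₀ (by positivity) (by positivity)]
        nlinarith [norm_nonneg x]
      calc _ ≤ ‖CliffProd.map S x - CliffProd.map T x‖ * ‖CliffProd.map S y‖ +
          ‖CliffProd.map T x‖ * ‖CliffProd.map S y - CliffProd.map T y‖ :=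
            (norm_add_le _ _).trans (add_le_add (norm_mul_le _ _) (norm_mul_le _ _))
        _ ≤ ε / (2 * (‖y‖ + 1)) * ‖y‖ + ‖x‖ * (ε / (2 * (‖x‖ + 1))) := by gcongr
        _ ≤ ε := by linarith
    | star x hx ih =>
      intro ε hε
      obtain ⟨ρ, h1, H1⟩ := ih ε hε
      refine ⟨ρ, h1, fun W _ _ S T h => ?_⟩
      rw [map_star, map_star, ← star_sub, norm_star]
      exact H1 W S T h
  intro ε hε
  obtain ⟨b, hb, hab⟩ := Metric.mem_closure_iff.1 ha (ε / 3) (by positivity)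
  obtain ⟨ρ, h1, H1⟩ := key b hb (ε / 3) (by positivity)
  refine ⟨ρ, h1, fun W _ _ S T h => ?_⟩
  have e1 := H1 W S T h
  rw [dist_eq_norm] at hab
  have e2 : ‖CliffProd.map S (a - b)‖ ≤ ‖a - b‖ := CliffProd.norm_map_le S _
  have e3 : ‖CliffProd.map T (a - b)‖ ≤ ‖a - b‖ := CliffProd.norm_map_le T _
  have : CliffProd.map S a - CliffProd.map T a = CliffProd.map S (a - b) +
      (CliffProd.map S b - CliffProd.map T b) - CliffProd.map T (a - b) := by
    rw [map_sub, map_sub]; abel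
  rw [this]
  refine (norm_sub_le _ _).trans ((add_le_add_left (norm_add_le _ _) _).trans ?_)
  linarith

/-- The functor `Cl` is continuous, uniformly on compact sets. -/
theorem Cl.exists_map_sub_map_le {K : Set (Cl V)} (hK : IsCompact K) {ε : ℝ} (hε : 0 < ε) :
    ∃ ρ > 0, ∀ (W : Type w) [NormedAddCommGroup W] [InnerProductSpace ℝ W]
      (S T : V →ₗᵢ[ℝ] W), (∀ v, ‖S v - T v‖ ≤ ρ * ‖v‖) →
        ∀ a ∈ K, ‖Cl.map S a - Cl.map T a‖ ≤ ε := by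
  choose ρ hρ H using fun a : Cl V =>
    CliffProd.exists_map_sub_map_le.{w} a.2 (ε / 3) (by positivity)
  obtain ⟨t, -, ht, hKt⟩ := hK.finite_cover_balls (e := ε / 3) (by positivity)
  -- The least of the ρ's belonging to the finitely many centres of the cover.
  obtain ⟨δ, hδ, hδt⟩ : ∃ δ > 0, ∀ b ∈ t, δ ≤ ρ b := by
    refine Set.Finite.induction_on _ ht (motive := fun t _ => ∃ δ > 0, ∀ b ∈ t, δ ≤ ρ b) ⟨1, one_pos, by simp⟩ ?_
    rintro a s - - ⟨δ, hδ, hs⟩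
    refine ⟨min δ (ρ a), lt_min hδ (hρ a), ?_⟩
    rintro b (rfl | hb)
    · exact min_le_right _ _
    · exact (min_le_left _ _).trans (hs b hb)
  refine ⟨δ, hδ, fun W _ _ S T h a ha => ?_⟩
  obtain ⟨b, hb, hab⟩ := Set.mem_iUnion₂.1 (hKt ha)
  rw [Metric.mem_ball, dist_eq_norm] at hab
  have e1 : ‖Cl.map S b - Cl.map T b‖ ≤ ε / 3 :=
    H b W S T fun v => (h v).trans (by gcongr; exact hδt b hb)
  have e2 : ‖Cl.map S (a - b)‖ ≤ ‖a - b‖ := Cl.norm_map_le S _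
  have e3 : ‖Cl.map T (a - b)‖ ≤ ‖a - b‖ := Cl.norm_map_le T _
  have : Cl.map S a - Cl.map T a = Cl.map S (a - b) +
      (Cl.map S b - Cl.map T b) - Cl.map T (a - b) := by
    rw [map_sub, map_sub]; abel
  rw [this]
  refine (norm_sub_le _ _).trans ((add_le_add_left (norm_add_le _ _) _).trans ?_)
  linarith

/-! ### Elements fixed by the reflection -/

/-- The star algebra generated by `V` in the product algebra of `ℝ e ⊕ V`. -/
def evenAdjoin (V : Type*) [NormedAddCommGroup V] [InnerProductSpace ℝ V] :
    StarSubalgebra ℂ (CliffProd (EPlus V)) :=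
  StarAlgebra.adjoin ℂ (Set.range fun v : V => CliffProd.vec (EPlus.inr V v))

/-- The Clifford operator `e`. -/
def eVec (V : Type*) [NormedAddCommGroup V] [InnerProductSpace ℝ V] : CliffProd (EPlus V) :=
  CliffProd.vec (EPlus.mk 1 0)

theorem eVec_mul_self : eVec V * eVec V = 1 := by
  rw [eVec, CliffProd.vec_mul_self]
  simp [EPlus.mk]

theorem eVec_mul_eVec_mul (a : CliffProd (EPlus V)) : eVec V * (eVec V * a) = a := by
  rw [← mul_assoc, eVec_mul_self, one_mul]

theorem eVec_mul_inr (v : V) : eVec V * CliffProd.vec (EPlus.inr V v) =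
    -(CliffProd.vec (EPlus.inr V v) * eVec V) := by
  refine CliffProd.vec_mul_vec_of_inner_eq_zero ?_
  simp [EPlus.inr, EPlus.mk, WithLp.prod_inner_apply]

/-- Conjugation by e sends each v ∈ V to −v, since e² = 1 and e anticommutes with V. This is what
allows e to be moved to the left of a product. -/
theorem eVec_conj_mem {a : CliffProd (EPlus V)} (ha : a ∈ evenAdjoin V) :
    eVec V * a * eVec V ∈ evenAdjoin V := by
  induction ha using StarAlgebra.adjoin_induction with
  | mem x hx =>
    obtain ⟨v, rfl⟩ := hx
    rw [eVec_mul_inr, neg_mul, mul_assoc, eVec_mul_self, mul_one]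
    exact neg_mem (StarAlgebra.subset_adjoin ℂ _ ⟨v, rfl⟩)
  | algebraMap r =>
    rw [← Algebra.commutes, mul_assoc, eVec_mul_self, mul_one]
    exact algebraMap_mem _ r
  | add x y hx hy ihx ihy =>
    rw [mul_add, add_mul]
    exact add_mem ihx ihy
  | mul x y hx hy ihx ihy =>
    have : eVec V * (x * y) * eVec V = (eVec V * x * eVec V) * (eVec V * y * eVec V) := by
      simp only [mul_assoc, eVec_mul_eVec_mul]
    rw [this]
    exact mul_mem ihx ihy
  | star x hx ih =>
    have : eVec V * star x * eVec V = star (eVec V * x * eVec V) := by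
      simp only [star_mul, mul_assoc]
      rw [eVec, CliffProd.star_vec]
    rw [this]
    exact star_mem ih

/-- The decomposition Cl(ℝ e ⊕ V) = Cl(V) + e Cl(V), on the level of the dense generated algebra. -/
theorem exists_even_odd {a : CliffProd (EPlus V)}
    (ha : a ∈ StarAlgebra.adjoin ℂ (Set.range (CliffProd.vec (V := EPlus V)))) :
    ∃ b ∈ evenAdjoin V, ∃ c ∈ evenAdjoin V, a = b + eVec V * c := by
  induction ha using StarAlgebra.adjoin_induction with
  | mem x hx =>
    obtain ⟨p, rfl⟩ := hx
    refine ⟨CliffProd.vec (EPlus.inr V p.snd), StarAlgebra.subset_adjoin ℂ _ ⟨_, rfl⟩,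
      algebraMap ℂ _ (p.fst : ℂ), algebraMap_mem _ _, ?_⟩
    refine Subtype.ext (funext fun π => ?_)
    change π.2.1 (CliffordAlgebra.ι _ p) = π.2.1 (CliffordAlgebra.ι _ (EPlus.inr V p.snd)) +
      π.2.1 (CliffordAlgebra.ι _ (EPlus.mk 1 (0 : V))) * algebraMap ℂ (OpC π.1) (p.fst : ℂ)
    have h1 : algebraMap ℂ (OpC π.1) (p.fst : ℂ) = algebraMap ℝ (OpC π.1) p.fst := by
      rw [IsScalarTower.algebraMap_apply ℝ ℂ (OpC π.1)]; rfl
    have h2 : p = EPlus.inr V p.snd + p.fst • EPlus.mk 1 (0 : V) := by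
      refine WithLp.ofLp_injective 2 ?_
      simp [EPlus.inr, EPlus.mk]
      rfl
    rw [h1, ← Algebra.commutes, ← Algebra.smul_def, ← map_smul, ← map_smul, ← map_add, ← map_add,
      ← h2]
  | algebraMap r => exact ⟨_, algebraMap_mem _ r, 0, zero_mem _, by simp⟩
  | add x y hx hy ihx ihy =>
    obtain ⟨b, hb, c, hc, rfl⟩ := ihx
    obtain ⟨b', hb', c', hc', rfl⟩ := ihy
    exact ⟨b + b', add_mem hb hb', c + c', add_mem hc hc', by rw [mul_add]; abel⟩
  | mul x y hx hy ihx ihy =>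
    obtain ⟨b, hb, c, hc, rfl⟩ := ihx
    obtain ⟨b', hb', c', hc', rfl⟩ := ihy
    refine ⟨b * b' + eVec V * c * eVec V * c', add_mem (mul_mem hb hb')
      (mul_mem (eVec_conj_mem hc) hc'), eVec V * b * eVec V * c' + c * b',
      add_mem (mul_mem (eVec_conj_mem hb) hc') (mul_mem hc hb'), ?_⟩
    simp only [mul_add, add_mul, mul_assoc, eVec_mul_eVec_mul]
    abel
  | star x hx ih =>
    obtain ⟨b, hb, c, hc, rfl⟩ := ih
    refine ⟨star b, star_mem hb, eVec V * star c * eVec V, eVec_conj_mem (star_mem hc), ?_⟩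
    simp only [star_add, star_mul, mul_assoc, eVec_mul_eVec_mul]
    rw [eVec, CliffProd.star_vec]

theorem map_eq_map_of_mem_evenAdjoin {S T : EPlus V →ₗᵢ[ℝ] W}
    (h : ∀ v, S (EPlus.inr V v) = T (EPlus.inr V v)) {a : CliffProd (EPlus V)}
    (ha : a ∈ evenAdjoin V) : CliffProd.map S a = CliffProd.map T a := by
  have : evenAdjoin V ≤ StarAlgHom.equalizer (CliffProd.map S) (CliffProd.map T) := by
    refine StarAlgebra.adjoin_le ?_
    rintro _ ⟨v, rfl⟩
    change CliffProd.map S _ = CliffProd.map T _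
    rw [CliffProd.map_vec, CliffProd.map_vec, h]
  exact this ha

theorem EPlus.refl_inr (v : V) : EPlus.refl V (EPlus.inr V v) = EPlus.inr V v := by
  refine WithLp.ofLp_injective 2 ?_
  simp [EPlus.refl, EPlus.inr, EPlus.mk]

/-- Isometries that agree on `V` agree on the elements of `Cl(ℝ e ⊕ V)` fixed by `e ↦ -e`. -/
theorem Cl.map_eq_map_of_refl_eq {S T : EPlus V →ₗᵢ[ℝ] W}
    (h : ∀ v, S (EPlus.inr V v) = T (EPlus.inr V v)) {a : Cl (EPlus V)}
    (ha : Cl.map (EPlus.refl V) a = a) : Cl.map S a = Cl.map T a := by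
  refine eq_of_forall_dist_le fun ε hε => ?_
  obtain ⟨b, hb, hab⟩ := Metric.mem_closure_iff.1 a.2 (ε / 2) (by positivity)
  obtain ⟨c, hc, d, hd, rfl⟩ := exists_even_odd hb
  have hr : CliffProd.map (EPlus.refl V) a.1 = a.1 := congrArg Subtype.val ha
  have hc' : CliffProd.map (EPlus.refl V) c = c := by
    rw [map_eq_map_of_mem_evenAdjoin (S := EPlus.refl V) (T := LinearIsometry.id)
      (fun v => EPlus.refl_inr v) hc]
    have : evenAdjoin V ≤ StarAlgHom.equalizer (CliffProd.map (LinearIsometry.id (E := EPlus V)))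
        (StarAlgHom.id ℂ _) := by
      refine StarAlgebra.adjoin_le ?_
      rintro _ ⟨v, rfl⟩
      change CliffProd.map _ _ = CliffProd.vec (EPlus.inr V v)
      rw [CliffProd.map_vec]; rfl
    exact this hc
  have hd' : CliffProd.map (EPlus.refl V) d = d := by
    have : evenAdjoin V ≤ StarAlgHom.equalizer (CliffProd.map (EPlus.refl V))
        (StarAlgHom.id ℂ _) := by
      refine StarAlgebra.adjoin_le ?_
      rintro _ ⟨v, rfl⟩
      change CliffProd.map _ _ = CliffProd.vec (EPlus.inr V v)
      rw [CliffProd.map_vec, EPlus.refl_inr]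
    exact this hd
  have he : CliffProd.map (EPlus.refl V) (eVec V) = -eVec V := by
    rw [eVec, CliffProd.map_vec, ← CliffProd.vec_neg]
    congr 1
    refine WithLp.ofLp_injective 2 ?_
    simp [EPlus.refl, EPlus.mk]
  rw [dist_eq_norm] at hab
  -- The reflection fixes `a` and turns its approximation c + e d into c − e d. Averaging the two
  -- shows that `c` alone approximates `a`, and S and T agree on `c`.
  have h1 : ‖a.1 - (c - eVec V * d)‖ < ε / 2 := by
    refine lt_of_le_of_lt ?_ hab
    have := CliffProd.norm_map_le (EPlus.refl V) (a.1 - (c + eVec V * d))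
    rwa [map_sub, map_add, map_mul, hr, hc', hd', he, neg_mul, ← sub_eq_add_neg] at this
  have h2 : ‖a.1 - c‖ ≤ ε / 2 := by
    have : (2 : ℂ) • (a.1 - c) = (a.1 - (c + eVec V * d)) + (a.1 - (c - eVec V * d)) := by
      rw [two_smul]; abel
    have h3 := norm_add_le (a.1 - (c + eVec V * d)) (a.1 - (c - eVec V * d))
    rw [← this, norm_smul] at h3
    simp at h3
    linarith
  have h3 := map_eq_map_of_mem_evenAdjoin h hc
  rw [dist_eq_norm]
  change ‖CliffProd.map S a.1 - CliffProd.map T a.1‖ ≤ ε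
  have : CliffProd.map S a.1 - CliffProd.map T a.1 =
      CliffProd.map S (a.1 - c) - CliffProd.map T (a.1 - c) := by
    rw [map_sub, map_sub, h3]; abel
  rw [this]
  have e2 := CliffProd.norm_map_le S (a.1 - c)
  have e3 := CliffProd.norm_map_le T (a.1 - c)
  exact (norm_sub_le _ _).trans (by linarith)

end CliffordMaps

/-! ### The maps `Cl(V) → Cl(W)` are isometric -/

section ClNorm

variable {V W : Type*} [NormedAddCommGroup V] [InnerProductSpace ℝ V]
  [NormedAddCommGroup W] [InnerProductSpace ℝ W]

/-- The space `ℂⁿ⁺¹ ⊕ ℂⁿ⁺¹`. -/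
abbrev DoubleSpace (n : ℕ) : Type :=
  WithLp 2 (EuclideanSpace ℂ (Fin (n + 1)) × EuclideanSpace ℂ (Fin (n + 1)))

/-- The identification of `ℂⁿ⁺¹ ⊕ ℂⁿ⁺¹` with `ℂ²ⁿ⁺²`. -/
def doubleEquiv (n : ℕ) : DoubleSpace n ≃ₗᵢ[ℂ] EuclideanSpace ℂ (Fin ((2 * n + 1) + 1)) :=
  ((stdOrthonormalBasis ℂ (DoubleSpace n)).reindex (finCongr (by
    rw [(WithLp.linearEquiv 2 ℂ _).finrank_eq, Module.finrank_prod]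
    simp; ring))).repr

/-- The inclusion of the first summand. -/
def doubleInl (n : ℕ) :
    EuclideanSpace ℂ (Fin (n + 1)) →ₗᵢ[ℂ] EuclideanSpace ℂ (Fin ((2 * n + 1) + 1)) :=
  (doubleEquiv n).toLinearIsometry.comp
    ({ toFun := fun k => WithLp.toLp 2 (k, 0)
       map_add' := fun k k' => by simp [← WithLp.toLp_add]
       map_smul' := fun c k => by simp [← WithLp.toLp_smul]
       norm_map' := fun k => by simp } : EuclideanSpace ℂ (Fin (n + 1)) →ₗᵢ[ℂ] DoubleSpace n)

/-- An element of `OpC n` as an operator. -/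
def OpC.toCLM {n : ℕ} (A : OpC n) :
    EuclideanSpace ℂ (Fin (n + 1)) →L[ℂ] EuclideanSpace ℂ (Fin (n + 1)) := A

/-- The operator `(a, b) ↦ (A a + t b, t a - A b)`. -/
def doubleMap {n : ℕ} (A : EuclideanSpace ℂ (Fin (n + 1)) →L[ℂ] EuclideanSpace ℂ (Fin (n + 1)))
    (t : ℂ) : DoubleSpace n →ₗ[ℂ] DoubleSpace n where
  toFun x := WithLp.toLp 2 (A x.fst + t • x.snd, t • x.fst - A x.snd)
  map_add' x y := by
    refine WithLp.ofLp_injective 2 (Prod.ext ?_ ?_)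
    · simp only [WithLp.add_fst, WithLp.add_snd, map_add, smul_add, WithLp.ofLp_add, Prod.fst_add]
      abel
    · simp only [WithLp.add_fst, WithLp.add_snd, map_add, smul_add, WithLp.ofLp_add, Prod.snd_add]
      abel
  map_smul' c x := by
    refine WithLp.ofLp_injective 2 (Prod.ext ?_ ?_)
    · simp only [WithLp.smul_fst, WithLp.smul_snd, map_smul, smul_comm t c, WithLp.ofLp_smul,
        Prod.smul_fst, RingHom.id_apply, smul_add]
    · simp only [WithLp.smul_fst, WithLp.smul_snd, map_smul, smul_comm t c, WithLp.ofLp_smul,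
        Prod.smul_snd, RingHom.id_apply, smul_sub]

/-- The operator `(a, b) ↦ (A a + t b, t a - A b)` on `ℂ²ⁿ⁺²`. -/
def doubleOp {n : ℕ} (A : OpC n) (t : ℝ) : OpC (2 * n + 1) :=
  (LinearMap.toContinuousLinearMap
    ((doubleEquiv n).toLinearEquiv.toLinearMap ∘ₗ doubleMap A.toCLM t ∘ₗ
      (doubleEquiv n).symm.toLinearEquiv.toLinearMap) :
    EuclideanSpace ℂ (Fin ((2 * n + 1) + 1)) →L[ℂ] EuclideanSpace ℂ (Fin ((2 * n + 1) + 1)))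

theorem doubleOp_apply {n : ℕ} (A : OpC n) (t : ℝ) (x : DoubleSpace n) :
    (doubleOp A t).toCLM (doubleEquiv n x) =
      doubleEquiv n (WithLp.toLp 2 (A.toCLM x.fst + (t : ℂ) • x.snd,
          (t : ℂ) • x.fst - A.toCLM x.snd)) := by
  change doubleEquiv n (doubleMap A.toCLM t ((doubleEquiv n).symm (doubleEquiv n x))) = _
  rw [LinearIsometryEquiv.symm_apply_apply]
  rfl

theorem OpC.ext_double {n : ℕ} {A B : OpC (2 * n + 1)}
    (h : ∀ x, A.toCLM (doubleEquiv n x) = B.toCLM (doubleEquiv n x)) : A = B := by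
  refine ContinuousLinearMap.ext fun y => ?_
  obtain ⟨x, rfl⟩ := (doubleEquiv n).surjective y
  exact h x

theorem OpC.add_toCLM {n : ℕ} (A B : OpC n) : (A + B).toCLM = A.toCLM + B.toCLM := rfl

theorem OpC.mul_toCLM {n : ℕ} (A B : OpC n) (x) : (A * B).toCLM x = A.toCLM (B.toCLM x) := rfl

theorem OpC.algebraMap_toCLM {n : ℕ} (r : ℝ) (x) :
    (algebraMap ℝ (OpC n) r).toCLM x = (r : ℂ) • x := by
  rw [IsScalarTower.algebraMap_apply ℝ ℂ (OpC n)]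
  rfl

theorem OpC.smul_toCLM {n : ℕ} (r : ℝ) (A : OpC n) (x) :
    (r • A).toCLM x = (r : ℂ) • A.toCLM x := by
  rw [Algebra.smul_def, OpC.mul_toCLM, OpC.algebraMap_toCLM]

theorem OpC.isSelfAdjoint_iff {n : ℕ} (A : OpC n) :
    IsSelfAdjoint A ↔ ∀ x y, ⟪A.toCLM x, y⟫_ℂ = ⟪x, A.toCLM y⟫_ℂ :=
  ContinuousLinearMap.isSelfAdjoint_iff_isSymmetric

/-- The linear map `t e + v ↦ ((a, b) ↦ (π(v) a + t b, t a - π(v) b))`. -/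
def doubleLin (π : CliffRep V) : EPlus V →ₗ[ℝ] OpC (2 * π.1 + 1) where
  toFun p := doubleOp (π.2.1 (CliffordAlgebra.ι (normForm V) p.snd)) p.fst
  map_add' p q := by
    refine OpC.ext_double fun x => ?_
    rw [OpC.add_toCLM, add_apply, doubleOp_apply, doubleOp_apply, doubleOp_apply,
      ← map_add]
    congr 1
    refine WithLp.ofLp_injective 2 (Prod.ext ?_ ?_)
    · simp [OpC.add_toCLM, add_smul]; abel
    · simp [OpC.add_toCLM, add_smul]; abel
  map_smul' r p := by
    refine OpC.ext_double fun x => ?_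
    rw [RingHom.id_apply, OpC.smul_toCLM, doubleOp_apply, doubleOp_apply, ← map_smul]
    congr 1
    refine WithLp.ofLp_injective 2 (Prod.ext ?_ ?_)
    · simp [OpC.smul_toCLM, mul_smul]
    · simp [OpC.smul_toCLM, mul_smul, smul_sub]

/-- The block matrix with rows (π(v), t) and (t, −π(v)) has square π(v)² + t², because the
off-diagonal terms cancel. -/
theorem doubleLin_mul_self (π : CliffRep V) (p : EPlus V) :
    doubleLin π p * doubleLin π p = algebraMap ℝ _ (normForm (EPlus V) p) := by
  have h0 : ∀ x, (π.2.1 (CliffordAlgebra.ι (normForm V) p.snd)).toCLM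
      ((π.2.1 (CliffordAlgebra.ι (normForm V) p.snd)).toCLM x) = ((‖p.snd‖ ^ 2 : ℝ) : ℂ) • x := by
    intro x
    rw [← OpC.mul_toCLM, ← map_mul π.2.1, CliffordAlgebra.ι_sq_scalar, AlgHom.commutes,
      OpC.algebraMap_toCLM]
    simp [normForm]
  have h1 : normForm (EPlus V) p = p.fst ^ 2 + ‖p.snd‖ ^ 2 := by
    have := WithLp.prod_norm_sq_eq_of_L2 p
    simp only [Real.norm_eq_abs, sq_abs] at this
    rw [← this]
    simp [normForm]
  refine OpC.ext_double fun x => ?_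
  rw [OpC.mul_toCLM, OpC.algebraMap_toCLM]
  change (doubleOp _ _).toCLM ((doubleOp _ _).toCLM _) = _
  rw [doubleOp_apply, doubleOp_apply, ← map_smul, h1]
  congr 1
  refine WithLp.ofLp_injective 2 (Prod.ext ?_ ?_)
  · simp [h0, smul_sub, smul_smul, add_smul, sq, -Complex.coe_smul]
    abel
  · simp [h0, smul_smul, add_smul, sq, -Complex.coe_smul]

/-- The Clifford module `t e + v ↦ ((a, b) ↦ (π(v) a + t b, t a - π(v) b))`. -/
def CliffRep.double (π : CliffRep V) : CliffRep (EPlus V) :=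
  ⟨2 * π.1 + 1, CliffordAlgebra.lift _ ⟨doubleLin π, doubleLin_mul_self π⟩, fun p => by
    rw [CliffordAlgebra.lift_ι_apply, OpC.isSelfAdjoint_iff]
    have h0 := (OpC.isSelfAdjoint_iff _).1 (π.2.2 p.snd)
    intro x y
    obtain ⟨x, rfl⟩ := (doubleEquiv π.1).surjective x
    obtain ⟨y, rfl⟩ := (doubleEquiv π.1).surjective y
    change ⟪(doubleOp _ _).toCLM _, _⟫_ℂ = ⟪_, (doubleOp _ _).toCLM _⟫_ℂ
    rw [doubleOp_apply, doubleOp_apply, LinearIsometryEquiv.inner_map_map,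
      LinearIsometryEquiv.inner_map_map]
    have e1 : ∀ z : DoubleSpace π.1, z.ofLp.1 = z.fst := fun _ => rfl
    have e2 : ∀ z : DoubleSpace π.1, z.ofLp.2 = z.snd := fun _ => rfl
    simp only [WithLp.prod_inner_apply, e1, e2, inner_add_left, inner_add_right, inner_sub_left,
      inner_sub_right, inner_smul_left, inner_smul_right, Complex.conj_ofReal, h0]
    ring⟩

/-- The value of an element of the product algebra in a Clifford module. -/
def CliffProd.eval (π : CliffRep V) : CliffProd V →⋆ₐ[ℂ] OpC π.1 where
  toFun a := a.1 π
  map_one' := rfl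
  map_mul' _ _ := rfl
  map_zero' := rfl
  map_add' _ _ := rfl
  commutes' _ := rfl
  map_star' _ := rfl

theorem CliffRep.double_ι (π : CliffRep V) (p : EPlus V) :
    π.double.2.1 (CliffordAlgebra.ι (normForm (EPlus V)) p) =
      doubleOp (π.2.1 (CliffordAlgebra.ι (normForm V) p.snd)) p.fst :=
  CliffordAlgebra.lift_ι_apply (Q := normForm (EPlus V)) (doubleLin π) (doubleLin_mul_self π) p

/-- The first summand of the doubled module is invariant under V and is the module π itself. So
every module of V embeds into the restriction of a module of ℝ e ⊕ V. -/
theorem CliffRep.double_apply (π : CliffRep V) {a : CliffProd V}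
    (ha : a ∈ StarAlgebra.adjoin ℂ (Set.range (CliffProd.vec (V := V)))) :
    ∀ k, OpC.toCLM (CliffProd.eval π.double (CliffProd.map (EPlus.inr V) a)) (doubleInl π.1 k) =
        doubleInl π.1 (OpC.toCLM (CliffProd.eval π a) k) := by
  -- Invariance of a subspace does not pass to adjoints, so the induction carries `a` and `star a`
  -- together.
  suffices h : ∀ φ : CliffProd V →⋆ₐ[ℂ] OpC (2 * π.1 + 1),
      φ = (CliffProd.eval π.double).comp (CliffProd.map (EPlus.inr V)) →
      (∀ k, (φ a).toCLM (doubleInl π.1 k) =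
        doubleInl π.1 (OpC.toCLM (CliffProd.eval π a) k)) ∧
      (∀ k, (φ (star a)).toCLM (doubleInl π.1 k) =
        doubleInl π.1 (OpC.toCLM (CliffProd.eval π (star a)) k)) from (h _ rfl).1
  intro φ hφ
  induction ha using StarAlgebra.adjoin_induction with
  | mem x hx =>
    obtain ⟨v, rfl⟩ := hx
    rw [CliffProd.star_vec, and_self]
    intro k
    have h1 : φ (CliffProd.vec v) = doubleOp (π.2.1 (CliffordAlgebra.ι (normForm V) v)) 0 := by
      rw [hφ]
      change CliffProd.eval π.double (CliffProd.map (EPlus.inr V) (CliffProd.vec v)) = _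
      rw [CliffProd.map_vec]
      exact π.double_ι _
    rw [h1]
    change (doubleOp _ _).toCLM (doubleEquiv π.1 (WithLp.toLp 2 (k, 0))) =
      doubleEquiv π.1 (WithLp.toLp 2 (OpC.toCLM (π.2.1 (CliffordAlgebra.ι (normForm V) v)) k, 0))
    rw [doubleOp_apply]
    congr 1
    refine WithLp.ofLp_injective 2 (Prod.ext ?_ ?_)
    · simp
    · simp
  | algebraMap r =>
    rw [← algebraMap_star_comm, AlgHomClass.commutes, AlgHomClass.commutes, AlgHomClass.commutes,
      AlgHomClass.commutes]
    exact ⟨fun k => ((doubleInl π.1).map_smul r k).symm,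
      fun k => ((doubleInl π.1).map_smul (star r) k).symm⟩
  | add x y hx hy ihx ihy =>
    simp only [star_add, map_add, OpC.add_toCLM, add_apply]
    simp only [ihx.1, ihx.2, ihy.1, ihy.2, implies_true, and_self]
  | mul x y hx hy ihx ihy =>
    simp only [star_mul, map_mul, OpC.mul_toCLM]
    simp only [ihx.1, ihx.2, ihy.1, ihy.2, implies_true, and_self]
  | star x hx ih =>
    rw [star_star]
    exact ⟨ih.2, ih.1⟩

/-- The norm is a supremum over modules, and each module of V sits inside its double, so no norm is
lost. -/
theorem Cl.norm_map_inr (a : Cl V) : ‖Cl.map (EPlus.inr V) a‖ = ‖a‖ := by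
  refine le_antisymm (Cl.norm_map_le _ _) ?_
  have h1 : IsClosed {a : CliffProd V | ‖a‖ ≤ ‖CliffProd.map (EPlus.inr V) a‖} :=
    isClosed_le continuous_norm (CliffProd.continuous_map _).norm
  refine closure_minimal ?_ h1 a.2
  intro a ha
  refine lp.norm_le_of_forall_le (norm_nonneg _) fun π => ?_
  refine ContinuousLinearMap.opNorm_le_bound _ (norm_nonneg _) fun k => ?_
  change ‖OpC.toCLM (CliffProd.eval π a) k‖ ≤ _
  rw [← (doubleInl π.1).norm_map, ← π.double_apply ha]
  refine (ContinuousLinearMap.le_opNorm _ _).trans ?_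
  refine (congrArg _ ((doubleInl π.1).norm_map k)).trans_le ?_
  refine mul_le_mul_of_nonneg_right ?_ (norm_nonneg _)
  exact lp.norm_apply_le_norm (E := fun π : CliffRep (EPlus V) => OpC π.1) (by simp)
    (CliffProd.map (EPlus.inr V) a) π.double

theorem Cl.map_id (a : Cl V) : Cl.map LinearIsometry.id a = a := by
  have : cliffSubalgebra V ≤ StarAlgHom.equalizer (CliffProd.map (LinearIsometry.id (E := V)))
      (StarAlgHom.id ℂ _) := by
    refine StarSubalgebra.topologicalClosure_minimal (StarAlgebra.adjoin_le ?_) ?_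
    · rintro _ ⟨v, rfl⟩
      change CliffProd.map _ _ = CliffProd.vec v
      rw [CliffProd.map_vec]; rfl
    · exact isClosed_eq (CliffProd.continuous_map _) continuous_id
  exact Subtype.ext (this a.2)

theorem Cl.norm_map_equiv (T : V ≃ₗᵢ[ℝ] W) (a : Cl V) : ‖Cl.map T.toLinearIsometry a‖ = ‖a‖ := by
  refine le_antisymm (Cl.norm_map_le _ _) ?_
  have h : Cl.map T.symm.toLinearIsometry (Cl.map T.toLinearIsometry a) = a := by
    rw [Cl.map_map]
    convert! Cl.map_id a
    ext v
    simp
  calc ‖a‖ = ‖Cl.map T.symm.toLinearIsometry (Cl.map T.toLinearIsometry a)‖ := by rw [h]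
    _ ≤ _ := Cl.norm_map_le _ _

/-- The isometry `t e + v ↦ t f + T v` for a unit vector `f` orthogonal to the image of `T`. -/
def extendIsometry (T : V →ₗᵢ[ℝ] W) (f : W) (hf : ‖f‖ = 1) (hT : ∀ v, ⟪f, T v⟫_ℝ = 0) :
    EPlus V →ₗᵢ[ℝ] W where
  toFun p := p.fst • f + T p.snd
  map_add' p q := by simp [add_smul]; abel
  map_smul' r p := by simp [mul_smul]
  norm_map' p := by
    refine (pow_left_inj₀ (norm_nonneg _) (norm_nonneg _) two_ne_zero).1 ?_
    change ‖p.fst • f + T p.snd‖ ^ 2 = ‖p‖ ^ 2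
    rw [norm_add_sq_real, inner_smul_left, hT, norm_smul, hf, LinearIsometry.norm_map,
      WithLp.prod_norm_sq_eq_of_L2]
    simp

/-- The maps `Cl(V) → Cl(W)` are isometric. -/
theorem Cl.norm_map [FiniteDimensional ℝ W] (T : V →ₗᵢ[ℝ] W) (a : Cl V) :
    ‖Cl.map T a‖ = ‖a‖ := by
  have : FiniteDimensional ℝ V := FiniteDimensional.of_injective T.toLinearMap T.injective
  obtain ⟨k, hk⟩ := Nat.exists_eq_add_of_le (LinearMap.finrank_le_finrank_of_injective
    (f := T.toLinearMap) T.injective)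
  -- Induction on the codimension of the range: a unit vector orthogonal to the range extends T to ℝ
  -- e ⊕ V, which lowers the codimension by one. The inclusion of V into ℝ e ⊕ V is already known to
  -- preserve norms.
  induction k generalizing V with
  | zero =>
    rw [add_zero] at hk
    exact Cl.norm_map_equiv (T.toLinearIsometryEquiv hk.symm) a
  | succ k ih =>
    have hne : LinearMap.range T.toLinearMap ≠ ⊤ := by
      intro h
      have := LinearMap.finrank_range_of_inj (f := T.toLinearMap) T.injective
      rw [h, finrank_top] at this
      omega
    have hne' : (LinearMap.range T.toLinearMap)ᗮ ≠ ⊥ := by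
      rwa [Ne, Submodule.orthogonal_eq_bot_iff]
    obtain ⟨g, hg, hg0⟩ := Submodule.exists_mem_ne_zero_of_ne_bot hne'
    have hf : ‖‖g‖⁻¹ • g‖ = 1 := by
      rw [norm_smul, norm_inv, norm_norm, inv_mul_cancel₀ (norm_ne_zero_iff.2 hg0)]
    have hT : ∀ v, ⟪‖g‖⁻¹ • g, T v⟫_ℝ = 0 := fun v => by
      rw [inner_smul_left, real_inner_comm, hg (T v) ⟨v, rfl⟩, mul_zero]
    have h1 : T = (extendIsometry T _ hf hT).comp (EPlus.inr V) := by
      ext v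
      change T v = (0 : ℝ) • _ + T v
      rw [zero_smul, zero_add]
    have : FiniteDimensional ℝ (EPlus V) := inferInstance
    rw [h1, ← Cl.map_map, ih (extendIsometry T _ hf hT) _ this ?_, Cl.norm_map_inr]
    rw [hk, (WithLp.linearEquiv 2 ℝ (ℝ × V)).finrank_eq, Module.finrank_prod, Module.finrank_self]
    ring

end ClNorm

/-! ### The fibrewise Bott map -/

section Fibre

universe w

variable {U V W X Y : Type*} [NormedAddCommGroup U] [InnerProductSpace ℝ U]
  [NormedAddCommGroup V] [InnerProductSpace ℝ V] [NormedAddCommGroup W] [InnerProductSpace ℝ W]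

set_option linter.unusedSectionVars false

theorem EPlus.norm_mk (x : ℝ) (v : V) : ‖EPlus.mk x v‖ = √(x ^ 2 + ‖v‖ ^ 2) := by
  rw [EPlus.mk, WithLp.prod_norm_eq_of_L2]
  simp

theorem EPlus.norm_mk_congr (x : ℝ) {v : V} {w : W} (h : ‖v‖ = ‖w‖) :
    ‖EPlus.mk x v‖ = ‖EPlus.mk x w‖ := by
  rw [EPlus.norm_mk, EPlus.norm_mk, h]

theorem EPlus.norm_mk_le (x : ℝ) (v : V) : ‖EPlus.mk x v‖ ≤ |x| + ‖v‖ := by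
  rw [EPlus.norm_mk, Real.sqrt_le_left (by positivity)]
  nlinarith [abs_nonneg x, norm_nonneg v, sq_abs x, mul_nonneg (abs_nonneg x) (norm_nonneg v)]

theorem EPlus.abs_le_norm_mk (x : ℝ) (v : V) : |x| ≤ ‖EPlus.mk x v‖ := by
  rw [EPlus.norm_mk]
  exact Real.abs_le_sqrt (by nlinarith [norm_nonneg v])

theorem EPlus.norm_le_norm_mk (x : ℝ) (v : V) : ‖v‖ ≤ ‖EPlus.mk x v‖ := by
  rw [EPlus.norm_mk]
  exact Real.le_sqrt_of_sq_le (by nlinarith [sq_nonneg x])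

theorem EPlus.mk_sub_mk (x y : ℝ) (v w : V) :
    EPlus.mk x v - EPlus.mk y w = EPlus.mk (x - y) (v - w) := rfl

theorem EPlus.norm_inr (v : V) : ‖EPlus.inr V v‖ = ‖v‖ := (EPlus.inr V).norm_map v

theorem EPlus.abs_norm_mk_sub_le (x : ℝ) (v w : V) :
    |‖EPlus.mk x v‖ - ‖EPlus.mk x w‖| ≤ ‖v - w‖ := by
  refine (abs_norm_sub_norm_le _ _).trans_eq ?_
  rw [EPlus.mk_sub_mk, sub_self]
  exact EPlus.norm_inr _

/-- Only n₁ has to be nonzero, because ‖n₂‖ • dir n₂ = n₂ holds also for n₂ = 0. -/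
theorem EPlus.norm_dir_sub_dir_le {n₁ n₂ : EPlus V} (h₁ : n₁ ≠ 0) :
    ‖EPlus.dir n₁ - EPlus.dir n₂‖ ≤ 2 * ‖n₁ - n₂‖ / ‖n₁‖ := by
  have h0 : 0 < ‖n₁‖ := norm_pos_iff.2 h₁
  rw [le_div_iff₀ h0, mul_comm _ ‖n₁‖, ← norm_smul_of_nonneg h0.le, smul_sub, EPlus.norm_smul_dir]
  have h1 : n₁ - ‖n₁‖ • EPlus.dir n₂ = (n₁ - n₂) + (‖n₂‖ - ‖n₁‖) • EPlus.dir n₂ := by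
    rw [sub_smul, EPlus.norm_smul_dir]; abel
  rw [h1]
  refine (norm_add_le _ _).trans ?_
  rw [norm_smul, EPlus.norm_dir, mul_one, Real.norm_eq_abs]
  have := abs_norm_sub_norm_le n₂ n₁
  rw [norm_sub_rev] at this
  linarith

theorem bottFibre_congr {ι₁ ι₂ : U →ₗᵢ[ℝ] V} {n₁ n₂ : EPlus V} {h₁ h₂ : ℝ → Cl (EPlus U)}
    {hn₁ : ∀ u, ⟪n₁.snd, ι₁ u⟫_ℝ = 0} {hn₂ : ∀ u, ⟪n₂.snd, ι₂ u⟫_ℝ = 0}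
    (hι : ι₁ = ι₂) (hn : n₁ = n₂) (hh : h₁ = h₂) :
    bottFibre ι₁ n₁ hn₁ h₁ = bottFibre ι₂ n₂ hn₂ h₂ := by
  subst hι hn hh
  rfl

/-- Only the length of n affects the norm; this is why `profile` below needs no larger space. -/
theorem norm_bottFibre [FiniteDimensional ℝ V] (ι : U →ₗᵢ[ℝ] V) (n : EPlus V)
    (hn : ∀ u, ⟪n.snd, ι u⟫_ℝ = 0) (h : ℝ → Cl (EPlus U)) :
    ‖bottFibre ι n hn h‖ = ‖h ‖n‖‖ := by
  have : FiniteDimensional ℝ (EPlus V) := inferInstance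
  exact Cl.norm_map _ _

theorem inner_add_comp_eq_zero {ι₂ : V →ₗᵢ[ℝ] W} {ι₁ : U →ₗᵢ[ℝ] V} {N : W} {M : V}
    (hN : ∀ v, ⟪N, ι₂ v⟫_ℝ = 0) (hM : ∀ u, ⟪M, ι₁ u⟫_ℝ = 0) (u : U) :
    ⟪N + ι₂ M, ι₂.comp ι₁ u⟫_ℝ = 0 := by
  rw [inner_add_left]
  change ⟪N, ι₂ (ι₁ u)⟫_ℝ + ⟪ι₂ M, ι₂ (ι₁ u)⟫_ℝ = 0
  rw [hN, LinearIsometry.inner_map_map, hM, add_zero]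

theorem bottIsometry_apply (ι : U →ₗᵢ[ℝ] V) (n : EPlus V) (hn : ∀ u, ⟪n.snd, ι u⟫_ℝ = 0)
    (p : EPlus U) :
    bottIsometry ι n hn p = p.fst • EPlus.dir n + EPlus.inr V (ι p.snd) := rfl

theorem bottIsometry_inr (ι : U →ₗᵢ[ℝ] V) (n : EPlus V) (hn : ∀ u, ⟪n.snd, ι u⟫_ℝ = 0) (u : U) :
    bottIsometry ι n hn (EPlus.inr U u) = EPlus.inr V (ι u) := by
  change (0 : ℝ) • EPlus.dir n + EPlus.inr V (ι u) = _
  rw [zero_smul, zero_add]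

theorem EPlus.dir_zero : EPlus.dir (0 : EPlus V) = EPlus.mk 1 0 := if_pos rfl

theorem EPlus.dir_of_ne {n : EPlus V} (h : n ≠ 0) : EPlus.dir n = ‖n‖⁻¹ • n := if_neg h

theorem EPlus.mk_add_inr (x : ℝ) (v w : V) :
    EPlus.mk x v + EPlus.inr V w = EPlus.mk x (v + w) := by
  refine WithLp.ofLp_injective 2 ?_
  simp [EPlus.mk, EPlus.inr]

/-- The hypothesis `h₁` expresses that the outer map evaluates its argument at ‖n₂‖. The composite
then carries n₁ to n₃. If n₁ = 0 then n₂ and n₃ vanish too and all directions are e by convention.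
-/
theorem bottIsometry_comp (ι₂ : V →ₗᵢ[ℝ] W) (ι₁ : U →ₗᵢ[ℝ] V) {n₂ n₃ : EPlus W} {n₁ : EPlus V}
    (hn₂ : ∀ v, ⟪n₂.snd, ι₂ v⟫_ℝ = 0) (hn₁ : ∀ u, ⟪n₁.snd, ι₁ u⟫_ℝ = 0)
    (hn₃ : ∀ u, ⟪n₃.snd, ι₂.comp ι₁ u⟫_ℝ = 0) (h₁ : n₁.fst = ‖n₂‖)
    (h₃ : n₃ = n₂ + EPlus.inr W (ι₂ n₁.snd)) (hnorm : ‖n₁‖ = ‖n₃‖) :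
    (bottIsometry ι₂ n₂ hn₂).comp (bottIsometry ι₁ n₁ hn₁) =
      bottIsometry (ι₂.comp ι₁) n₃ hn₃ := by
  have hdir : bottIsometry ι₂ n₂ hn₂ (EPlus.dir n₁) = EPlus.dir n₃ := by
    by_cases h0 : n₁ = 0
    · have h1 : n₃ = 0 := by rw [← norm_eq_zero, ← hnorm, h0, norm_zero]
      have h2 : n₂ = 0 := by
        rw [← norm_eq_zero, ← h₁, h0]; rfl
      rw [h0, h1, EPlus.dir_zero, EPlus.dir_zero, bottIsometry_apply]
      simp [EPlus.mk, h2, EPlus.dir_zero]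
    · have h1 : n₃ ≠ 0 := by
        rw [← norm_ne_zero_iff, ← hnorm, norm_ne_zero_iff]; exact h0
      rw [EPlus.dir_of_ne h0, EPlus.dir_of_ne h1, map_smul, bottIsometry_apply, h₁,
        EPlus.norm_smul_dir, hnorm, ← h₃]
  refine LinearIsometry.ext fun p => ?_
  change bottIsometry ι₂ n₂ hn₂ (bottIsometry ι₁ n₁ hn₁ p) = bottIsometry _ n₃ hn₃ p
  rw [bottIsometry_apply ι₁, bottIsometry_apply (ι₂.comp ι₁), map_add, map_smul, hdir,
    bottIsometry_inr]
  rfl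

/-- Transitivity of Bott maps in a single fibre. It rests on Pythagoras: ‖x e + N‖ e + M and x e + N
+ ι₂ M have the same length, since N is orthogonal to the range of ι₂. -/
theorem bottFibre_bottFibre (ι₂ : V →ₗᵢ[ℝ] W) (ι₁ : U →ₗᵢ[ℝ] V) (x : ℝ) (N : W) (M : V)
    (hN : ∀ v, ⟪N, ι₂ v⟫_ℝ = 0) (hM : ∀ u, ⟪M, ι₁ u⟫_ℝ = 0) (h : ℝ → Cl (EPlus U)) :
    bottFibre ι₂ (EPlus.mk x N) hN (fun t => bottFibre ι₁ (EPlus.mk t M) hM h) =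
      bottFibre (ι₂.comp ι₁) (EPlus.mk x (N + ι₂ M)) (inner_add_comp_eq_zero hN hM) h := by
  have hN0 : ⟪N, ι₂ M⟫_ℝ = 0 := hN M
  have hnorm : ‖EPlus.mk ‖EPlus.mk x N‖ M‖ = ‖EPlus.mk x (N + ι₂ M)‖ := by
    rw [EPlus.norm_mk, EPlus.norm_mk, EPlus.norm_mk, Real.sq_sqrt (by positivity),
      norm_add_sq_real, hN0, LinearIsometry.norm_map]
    congr 1
    ring
  unfold bottFibre
  dsimp only
  rw [Cl.map_map, hnorm]
  congr 2
  exact bottIsometry_comp ι₂ ι₁ _ _ _ rfl (EPlus.mk_add_inr x N (ι₂ M)).symm hnorm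

theorem EPlus.map_mk (T : V →ₗᵢ[ℝ] W) (x : ℝ) (v : V) :
    EPlus.map T (EPlus.mk x v) = EPlus.mk x (T v) := rfl

theorem map_bottFibre (T : V →ₗᵢ[ℝ] W) (ι : U →ₗᵢ[ℝ] V) (x : ℝ) (N : V)
    (hN : ∀ u, ⟪N, ι u⟫_ℝ = 0) (h : ℝ → Cl (EPlus U)) :
    Cl.map (EPlus.map T) (bottFibre ι (EPlus.mk x N) hN h) =
      bottFibre (T.comp ι) (EPlus.mk x (T N))
        (fun u => (T.inner_map_map N (ι u)).trans (hN u)) h := by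
  have hnorm : ‖EPlus.mk x N‖ = ‖EPlus.mk x (T N)‖ := EPlus.norm_mk_congr _ (T.norm_map N).symm
  have hdir : EPlus.map T (EPlus.dir (EPlus.mk x N)) = EPlus.dir (EPlus.mk x (T N)) := by
    by_cases h0 : EPlus.mk x N = 0
    · have h1 : EPlus.mk x (T N) = 0 := by rw [← norm_eq_zero, ← hnorm, h0, norm_zero]
      rw [h0, h1, EPlus.dir_zero, EPlus.map_mk, map_zero, EPlus.dir_zero]
    · have h1 : EPlus.mk x (T N) ≠ 0 := by
        rw [← norm_ne_zero_iff, ← hnorm, norm_ne_zero_iff]; exact h0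
      rw [EPlus.dir_of_ne h0, EPlus.dir_of_ne h1, map_smul, EPlus.map_mk, hnorm]
  unfold bottFibre
  rw [Cl.map_map, hnorm]
  congr 2
  refine LinearIsometry.ext fun p => ?_
  change EPlus.map T (p.fst • EPlus.dir (EPlus.mk x N) + EPlus.inr V (ι p.snd)) =
    p.fst • EPlus.dir (EPlus.mk x (T N)) + EPlus.inr W (T (ι p.snd))
  rw [map_add, map_smul, hdir]
  rfl

theorem bottFibre_map (ι : V →ₗᵢ[ℝ] W) (T : U →ₗᵢ[ℝ] V) (n : EPlus W)
    (hn : ∀ v, ⟪n.snd, ι v⟫_ℝ = 0) (h : ℝ → Cl (EPlus U)) :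
    bottFibre ι n hn (fun t => Cl.map (EPlus.map T) (h t)) =
      bottFibre (ι.comp T) n (fun u => hn (T u)) h := by
  unfold bottFibre
  rw [Cl.map_map]
  rfl

end Fibre

/-! ### Functions vanishing at infinity -/

section VanishAtInfinity

universe w

set_option linter.unusedSectionVars false

variable {U V W X Y : Type*} [NormedAddCommGroup U] [InnerProductSpace ℝ U]
  [NormedAddCommGroup V] [InnerProductSpace ℝ V] [NormedAddCommGroup W] [InnerProductSpace ℝ W]
  [NormedAddCommGroup X] [ProperSpace X] [NormedAddCommGroup Y] [ProperSpace Y]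

theorem tendsto_cocompact_zero_iff {P E : Type*} [NormedAddCommGroup P] [ProperSpace P]
    [NormedAddCommGroup E] {f : P → E} : Tendsto f (cocompact P) (𝓝 0) ↔
      ∀ ε > 0, ∃ R, ∀ p, R ≤ ‖p‖ → ‖f p‖ ≤ ε := by
  rw [← Metric.cobounded_eq_cocompact, ← comap_norm_atTop, tendsto_zero_iff_norm_tendsto_zero]
  constructor
  · intro h ε hε
    have := h.eventually (eventually_le_nhds hε)
    rw [eventually_comap] at this
    obtain ⟨R, hR⟩ := eventually_atTop.1 this
    exact ⟨R, fun p hp => hR _ hp p rfl⟩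
  · intro h
    rw [Metric.tendsto_nhds]
    intro ε hε
    obtain ⟨R, hR⟩ := h (ε / 2) (by positivity)
    rw [eventually_comap]
    filter_upwards [eventually_ge_atTop R] with b hb p hp
    rw [Real.dist_0_eq_abs, abs_norm]
    exact (hR p (hb.trans_eq hp.symm)).trans_lt (by linarith)

theorem SCliff.exists_norm_le {h : BFun X U} (hh : h ∈ SCliff X U) {ε : ℝ} (hε : 0 < ε) :
    ∃ R, ∀ t w, R ≤ |t| ∨ R ≤ ‖w‖ → ‖h (t, w)‖ ≤ ε := by
  obtain ⟨R, hR⟩ := tendsto_cocompact_zero_iff.1 hh.2.1 ε hε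
  refine ⟨R, fun t w htw => hR (t, w) ?_⟩
  rw [Prod.norm_def, Real.norm_eq_abs]
  exact le_max_iff.2 htw

theorem SCliff.exists_norm_sub_le {h : BFun X U} (hh : h ∈ SCliff X U) {ε : ℝ} (hε : 0 < ε) :
    ∃ δ > 0, ∀ t t' w w', |t - t'| ≤ δ → ‖w - w'‖ ≤ δ → ‖h (t, w) - h (t', w')‖ ≤ ε := by
  have h1 := hh.1.uniformContinuous_of_tendsto_cocompact hh.2.1
  obtain ⟨δ, hδ, H⟩ := Metric.uniformContinuous_iff.1 h1 ε hε
  refine ⟨δ / 2, by positivity, fun t t' w w' ht hw => ?_⟩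
  rw [← dist_eq_norm]
  refine (H ?_).le
  rw [Prod.dist_eq, Real.dist_eq, dist_eq_norm]
  exact max_lt (by linarith) (by linarith)


/-- The fibrewise Bott map is uniformly continuous in all its arguments. -/
theorem SCliff.exists_bottFibre_sub_le {h : BFun X U} (hh : h ∈ SCliff X U) {ε : ℝ} (hε : 0 < ε) :
    ∃ δ > 0, ∀ (V : Type w) [NormedAddCommGroup V] [InnerProductSpace ℝ V] (ι₁ ι₂ : U →ₗᵢ[ℝ] V)
      (n₁ n₂ : EPlus V) (hn₁ : ∀ u, ⟪n₁.snd, ι₁ u⟫_ℝ = 0) (hn₂ : ∀ u, ⟪n₂.snd, ι₂ u⟫_ℝ = 0)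
      (w₁ w₂ : X), (∀ u, ‖ι₁ u - ι₂ u‖ ≤ δ * ‖u‖) → ‖n₁ - n₂‖ ≤ δ * (1 + ‖n₁‖ + ‖w₁‖) →
      ‖w₁ - w₂‖ ≤ δ * (1 + ‖n₁‖ + ‖w₁‖) →
      ‖bottFibre ι₁ n₁ hn₁ (fun t => h (t, w₁)) - bottFibre ι₂ n₂ hn₂ (fun t => h (t, w₂))‖ ≤ ε := by
  obtain ⟨R, hR⟩ := SCliff.exists_norm_le hh (show 0 < ε / 2 by positivity)
  obtain ⟨η, hη, hu⟩ := SCliff.exists_norm_sub_le hh (show 0 < ε / 6 by positivity)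
  -- The perturbed norms differ from the original ones by at most m / 4 each, so ‖n₂‖, ‖w₂‖ < R
  -- would force m < 4 R + 2.
  set M : ℝ := max (4 * R + 2) 1 with hM
  have hM1 : 1 ≤ M := le_max_right _ _
  have hK : IsCompact ((fun p => h p) '' (Set.Icc (0 : ℝ) M ×ˢ Metric.closedBall (0 : X) M)) :=
    (isCompact_Icc.prod (isCompact_closedBall 0 M)).image hh.1
  obtain ⟨ρ, hρ, H⟩ := Cl.exists_map_sub_map_le.{w} hK (show 0 < ε / 6 by positivity)
  -- In this order: 1/4 for points far out, η/M for uniform continuity of `h`, ρ/2 for the distance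
  -- of ι₁ and ι₂, and ρη/(4M) so that the directions differ by at most 2δM/η ≤ ρ/2.
  refine ⟨min (min (1 / 4) (η / M)) (min (ρ / 2) (ρ * η / (4 * M))), by positivity, ?_⟩
  intro V _ _ ι₁ ι₂ n₁ n₂ hn₁ hn₂ w₁ w₂ hι hn hw
  set δ : ℝ := min (min (1 / 4) (η / M)) (min (ρ / 2) (ρ * η / (4 * M))) with hδ
  have hδ0 : 0 < δ := by positivity
  have hδ1 : δ ≤ 1 / 4 := (min_le_left _ _).trans (min_le_left _ _)
  have hδ2 : δ * M ≤ η :=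
    (le_div_iff₀ (by positivity)).1 ((min_le_left _ _).trans (min_le_right _ _))
  have hδ3 : δ ≤ ρ / 2 := (min_le_right _ _).trans (min_le_left _ _)
  have hδ4 : δ * (4 * M) ≤ ρ * η :=
    (le_div_iff₀ (by positivity)).1 ((min_le_right _ _).trans (min_le_right _ _))
  set m : ℝ := 1 + ‖n₁‖ + ‖w₁‖ with hm
  have hn0 := norm_nonneg n₁
  have hw0 := norm_nonneg w₁
  -- Far from the origin both values are small by themselves. This is why errors proportional to 1 +
  -- ‖n₁‖ + ‖w₁‖ can be admitted.
  by_cases hmM : M ≤ m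
  · have hRm : 4 * R + 2 ≤ m := (le_max_left _ _).trans hmM
    have e1 : ‖h (‖n₁‖, w₁)‖ ≤ ε / 2 := by
      refine hR _ _ ?_
      rw [abs_norm]
      by_contra! hc
      linarith
    have e2 : ‖h (‖n₂‖, w₂)‖ ≤ ε / 2 := by
      refine hR _ _ ?_
      rw [abs_norm]
      by_contra! hc
      have h1 := norm_sub_norm_le n₁ n₂
      have h2 := norm_sub_norm_le w₁ w₂
      have h3 : δ * m ≤ 1 / 4 * m := by gcongr
      linarith
    refine (norm_sub_le _ _).trans ?_
    have f1 : ‖bottFibre ι₁ n₁ hn₁ (fun t => h (t, w₁))‖ ≤ ‖h (‖n₁‖, w₁)‖ := Cl.norm_map_le _ _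
    have f2 : ‖bottFibre ι₂ n₂ hn₂ (fun t => h (t, w₂))‖ ≤ ‖h (‖n₂‖, w₂)‖ := Cl.norm_map_le _ _
    linarith
  push Not at hmM
  have hnη : ‖n₁ - n₂‖ ≤ δ * M := hn.trans (by gcongr)
  have hwη : ‖w₁ - w₂‖ ≤ δ * M := hw.trans (by gcongr)
  have e1 : ‖bottFibre ι₂ n₂ hn₂ (fun t => h (t, w₂)) -
      Cl.map (bottIsometry ι₂ n₂ hn₂) (h (‖n₁‖, w₁))‖ ≤ ε / 6 := by
    unfold bottFibre
    rw [← map_sub]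
    refine (Cl.norm_map_le _ _).trans (hu _ _ _ _ ?_ ?_)
    · rw [abs_sub_comm]
      exact (abs_norm_sub_norm_le _ _).trans (hnη.trans hδ2)
    · rw [norm_sub_rev]
      exact hwη.trans hδ2
  have hmem : ∀ t, 0 ≤ t → t ≤ M →
      h (t, w₁) ∈ (fun p => h p) '' (Set.Icc (0 : ℝ) M ×ˢ Metric.closedBall (0 : X) M) := by
    intro t h0 h1
    refine ⟨(t, w₁), ⟨⟨h0, h1⟩, ?_⟩, rfl⟩
    rw [mem_closedBall_zero_iff]
    linarith
  have e2 : ‖Cl.map (bottIsometry ι₁ n₁ hn₁) (h (‖n₁‖, w₁)) -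
      Cl.map (bottIsometry ι₂ n₂ hn₂) (h (‖n₁‖, w₁))‖ ≤ ε / 2 := by
    -- Away from 0 the directions of n₁ and n₂ are close. Near 0 they need not be; there h(‖n₁‖, ·)
    -- is replaced by h(0, ·), which is fixed by e ↦ −e, so the image of e plays no role.
    by_cases hn1 : η ≤ ‖n₁‖
    · suffices hclose : ∀ p, ‖bottIsometry ι₁ n₁ hn₁ p - bottIsometry ι₂ n₂ hn₂ p‖ ≤ ρ * ‖p‖ by
        exact (H (EPlus V) (bottIsometry ι₁ n₁ hn₁) (bottIsometry ι₂ n₂ hn₂) hclose _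
          (hmem _ hn0 (by linarith))).trans (by linarith)
      intro p
      have h1 : n₁ ≠ 0 := by
        rw [← norm_pos_iff]; linarith
      rw [bottIsometry_apply, bottIsometry_apply, add_sub_add_comm, ← smul_sub, ← map_sub]
      refine (norm_add_le _ _).trans ?_
      rw [norm_smul, EPlus.norm_inr]
      have h2 : ‖EPlus.dir n₁ - EPlus.dir n₂‖ ≤ ρ / 2 := by
        refine (EPlus.norm_dir_sub_dir_le h1).trans ?_
        rw [div_le_iff₀ (norm_pos_iff.2 h1)]
        have : ρ / 2 * η ≤ ρ / 2 * ‖n₁‖ := by gcongr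
        linarith
      have h3 : ‖p.fst‖ ≤ ‖p‖ := WithLp.norm_fst_le _ p
      have h4 : ‖p.snd‖ ≤ ‖p‖ := WithLp.norm_snd_le _ p
      calc ‖p.fst‖ * ‖EPlus.dir n₁ - EPlus.dir n₂‖ + ‖ι₁ p.snd - ι₂ p.snd‖
          ≤ ‖p‖ * (ρ / 2) + ρ / 2 * ‖p‖ := by
            refine add_le_add (by gcongr) ((hι _).trans ?_)
            gcongr
        _ = _ := by ring
    · push Not at hn1
      have h1 : Cl.map (EPlus.refl U) (h (0, w₁)) = h (0, w₁) := by
        have := hh.2.2 0 w₁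
        rw [neg_zero] at this
        exact this.symm
      have h2 : ‖h (‖n₁‖, w₁) - h (0, w₁)‖ ≤ ε / 6 := by
        refine hu _ _ _ _ ?_ (by rw [sub_self, norm_zero]; exact hη.le)
        rw [sub_zero, abs_norm]
        exact hn1.le
      have h3 : Cl.map (bottIsometry ι₁ n₁ hn₁) (h (0, w₁)) = Cl.map (EPlus.map ι₁) (h (0, w₁)) :=
        Cl.map_eq_map_of_refl_eq (fun u => by rw [bottIsometry_inr]; rfl) h1
      have h4 : Cl.map (bottIsometry ι₂ n₂ hn₂) (h (0, w₁)) = Cl.map (EPlus.map ι₂) (h (0, w₁)) :=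
        Cl.map_eq_map_of_refl_eq (fun u => by rw [bottIsometry_inr]; rfl) h1
      have h5 : ‖Cl.map (EPlus.map ι₁) (h (0, w₁)) - Cl.map (EPlus.map ι₂) (h (0, w₁))‖ ≤ ε / 6 := by
        refine H (EPlus V) (EPlus.map ι₁) (EPlus.map ι₂) (fun p => ?_) _ (hmem 0 le_rfl (by linarith))
        have : EPlus.map ι₁ p - EPlus.map ι₂ p = EPlus.inr V (ι₁ p.snd - ι₂ p.snd) := by
          change EPlus.mk p.fst (ι₁ p.snd) - EPlus.mk p.fst (ι₂ p.snd) = _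
          rw [EPlus.mk_sub_mk, sub_self]; rfl
        rw [this, EPlus.norm_inr]
        have h4 : ‖p.snd‖ ≤ ‖p‖ := WithLp.norm_snd_le _ p
        refine (hι _).trans ?_
        have : δ ≤ ρ := by linarith
        gcongr
      rw [← h3, ← h4] at h5
      have f1 := (Cl.norm_map_le (bottIsometry ι₁ n₁ hn₁) (h (‖n₁‖, w₁) - h (0, w₁))).trans h2
      have f2 := (Cl.norm_map_le (bottIsometry ι₂ n₂ hn₂) (h (‖n₁‖, w₁) - h (0, w₁))).trans h2
      rw [map_sub] at f1 f2
      have := norm_sub_le_norm_sub_add_norm_sub (Cl.map (bottIsometry ι₁ n₁ hn₁) (h (‖n₁‖, w₁)))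
        (Cl.map (bottIsometry ι₁ n₁ hn₁) (h (0, w₁)))
        (Cl.map (bottIsometry ι₂ n₂ hn₂) (h (‖n₁‖, w₁)))
      have := norm_sub_le_norm_sub_add_norm_sub (Cl.map (bottIsometry ι₁ n₁ hn₁) (h (0, w₁)))
        (Cl.map (bottIsometry ι₂ n₂ hn₂) (h (0, w₁)))
        (Cl.map (bottIsometry ι₂ n₂ hn₂) (h (‖n₁‖, w₁)))
      rw [norm_sub_rev (Cl.map (bottIsometry ι₂ n₂ hn₂) (h (0, w₁)))] at this
      linarith
  have := norm_sub_le_norm_sub_add_norm_sub (bottFibre ι₁ n₁ hn₁ (fun t => h (t, w₁)))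
    (Cl.map (bottIsometry ι₂ n₂ hn₂) (h (‖n₁‖, w₁))) (bottFibre ι₂ n₂ hn₂ (fun t => h (t, w₂)))
  rw [norm_sub_rev (Cl.map (bottIsometry ι₂ n₂ hn₂) (h (‖n₁‖, w₁)))] at this
  have e3 : ‖bottFibre ι₁ n₁ hn₁ (fun t => h (t, w₁)) -
    Cl.map (bottIsometry ι₂ n₂ hn₂) (h (‖n₁‖, w₁))‖ ≤ ε / 2 := e2
  linarith

theorem EPlus.refl_mk (x : ℝ) (v : V) : EPlus.refl V (EPlus.mk x v) = EPlus.mk (-x) v := rfl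

/-- For n ≠ 0 the direction is reflected together with n. At n = 0 it stays e by convention, and
there the symmetry of h 0 is needed. -/
theorem bottFibre_neg (ι : U →ₗᵢ[ℝ] V) (x : ℝ) (N : V) (hN : ∀ u, ⟪N, ι u⟫_ℝ = 0)
    {h : ℝ → Cl (EPlus U)} (h0 : Cl.map (EPlus.refl U) (h 0) = h 0) :
    bottFibre ι (EPlus.mk (-x) N) hN h =
      Cl.map (EPlus.refl V) (bottFibre ι (EPlus.mk x N) hN h) := by
  have hnorm : ‖EPlus.mk (-x) N‖ = ‖EPlus.mk x N‖ := by
    rw [EPlus.norm_mk, EPlus.norm_mk, neg_sq]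
  unfold bottFibre
  rw [Cl.map_map, hnorm]
  by_cases hx : EPlus.mk x N = 0
  · have hx0 : ‖EPlus.mk x N‖ = 0 := by rw [hx, norm_zero]
    rw [hx0]
    refine Cl.map_eq_map_of_refl_eq (fun u => ?_) h0
    refine (bottIsometry_inr _ _ _ _).trans ?_
    rw [← EPlus.refl_inr]
    exact congrArg (EPlus.refl V) (bottIsometry_inr _ _ _ _).symm
  · have hx' : EPlus.mk (-x) N ≠ 0 := by
      rw [← norm_ne_zero_iff, hnorm, norm_ne_zero_iff]; exact hx
    congr 2
    refine LinearIsometry.ext fun p => ?_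
    change p.fst • EPlus.dir (EPlus.mk (-x) N) + EPlus.inr V (ι p.snd) =
      EPlus.refl V (p.fst • EPlus.dir (EPlus.mk x N) + EPlus.inr V (ι p.snd))
    rw [map_add, map_smul, EPlus.refl_inr, EPlus.dir_of_ne hx, EPlus.dir_of_ne hx', map_smul,
      EPlus.refl_mk, hnorm]

theorem bottMap_apply (ι : U →ₗᵢ[ℝ] V) (pr : Y → X) (N : Y → V) (hN : ∀ y u, ⟪N y, ι u⟫_ℝ = 0)
    (h : BFun X U) (x : ℝ) (y : Y) : bottMap ι pr N hN h (x, y) =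
      bottFibre ι (EPlus.mk x (N y)) (hN y) (fun t => h (t, pr y)) := rfl

theorem pullBack_apply (T : U →ₗᵢ[ℝ] V) (G : Y → X) (h : BFun X U) (x : ℝ) (y : Y) :
    pullBack T G h (x, y) = Cl.map (EPlus.map T) (h (x, G y)) := rfl

/-- The bound `hK` makes y ↦ (N y, pr y) proper, which gives the decay at infinity. Continuity,
including the points where x e + N y = 0, comes from the uniform estimate. -/
theorem SCliff.bottMap_mem {h : BFun X U} (hh : h ∈ SCliff X U) (ι : U →ₗᵢ[ℝ] V) {pr : Y → X}
    {N : Y → V} (hN : ∀ y u, ⟪N y, ι u⟫_ℝ = 0) (hpr : Continuous pr) (hNc : Continuous N)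
    {K : ℝ} (hK : ∀ y, ‖y‖ ≤ K * (‖N y‖ + ‖pr y‖)) : bottMap ι pr N hN h ∈ SCliff Y V := by
  have hmk : Continuous fun p : ℝ × Y => EPlus.mk p.1 (N p.2) :=
    (WithLp.prod_continuous_toLp 2 ℝ V).comp
      (continuous_fst.prodMk (hNc.comp continuous_snd))
  refine ⟨?_, ?_, fun x v => ?_⟩
  · rw [Metric.continuous_iff']
    intro p ε hε
    obtain ⟨δ, hδ, H⟩ := SCliff.exists_bottFibre_sub_le hh (show 0 < ε / 2 by positivity)
    have h1 : ∀ᶠ q in 𝓝 p, dist (EPlus.mk q.1 (N q.2)) (EPlus.mk p.1 (N p.2)) < δ :=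
      (Metric.continuous_iff'.1 hmk) p δ hδ
    have h2 : ∀ᶠ q in 𝓝 p, dist (pr q.2) (pr p.2) < δ :=
      (Metric.continuous_iff'.1 (hpr.comp continuous_snd)) p δ hδ
    filter_upwards [h1, h2] with q hq1 hq2
    rw [dist_eq_norm] at hq1 hq2 ⊢
    refine (H V ι ι (EPlus.mk q.1 (N q.2)) (EPlus.mk p.1 (N p.2)) (hN q.2)
      (hN p.2) (pr q.2) (pr p.2) (fun u => ?_) ?_ ?_).trans_lt
      (by linarith)
    · rw [sub_self, norm_zero]; positivity
    · refine hq1.le.trans (le_mul_of_one_le_right hδ.le ?_)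
      have := norm_nonneg (EPlus.mk q.1 (N q.2))
      have := norm_nonneg (pr q.2)
      linarith
    · refine hq2.le.trans (le_mul_of_one_le_right hδ.le ?_)
      have := norm_nonneg (EPlus.mk q.1 (N q.2))
      have := norm_nonneg (pr q.2)
      linarith
  · rw [tendsto_cocompact_zero_iff]
    intro ε hε
    obtain ⟨R, hR⟩ := SCliff.exists_norm_le hh hε
    refine ⟨max R (2 * |K| * R), ?_⟩
    rintro ⟨x, y⟩ hp
    refine (Cl.norm_map_le _ _).trans (hR _ _ ?_)
    rw [abs_norm]
    by_contra! hc
    have h1 := (EPlus.abs_le_norm_mk x (N y)).trans_lt hc.1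
    have h2 := (EPlus.norm_le_norm_mk x (N y)).trans_lt hc.1
    have h3 : ‖y‖ ≤ |K| * (‖N y‖ + ‖pr y‖) :=
      (hK y).trans (by gcongr; exact le_abs_self K)
    have h4 : |K| * (‖N y‖ + ‖pr y‖) ≤ |K| * (2 * R) := by
      gcongr
      have := hc.2
      dsimp only at this
      linarith
    rw [Prod.norm_def, Real.norm_eq_abs, le_max_iff] at hp
    have hp1 := (le_max_left R (2 * |K| * R))
    have hp2 := (le_max_right R (2 * |K| * R))
    rcases hp with hp | hp
    · exact absurd (hp1.trans hp) (not_le.2 h1)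
    · rcases eq_or_lt_of_le (abs_nonneg K) with hK0 | hK0
      · rw [← hK0] at h3
        have : ‖y‖ ≤ 0 := by simpa using h3
        have := norm_nonneg (N y)
        have := hp1.trans hp
        dsimp only at this
        linarith
      · have h5 : ‖N y‖ + ‖pr y‖ < 2 * R := by
          have := hc.2
          dsimp only at this
          linarith
        have h6 : |K| * (‖N y‖ + ‖pr y‖) < |K| * (2 * R) := by gcongr
        have := hp2.trans hp
        dsimp only at this
        linarith
  · rw [bottMap_apply, bottMap_apply]
    refine bottFibre_neg ι x (N v) (hN v) ?_
    have := hh.2.2 0 (pr v)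
    rw [neg_zero] at this
    exact this.symm

theorem SCliff.pullBack_mem {h : BFun X U} (hh : h ∈ SCliff X U) (T : U →ₗᵢ[ℝ] V) {G : Y → X}
    (hG : Continuous G) (hGp : ∀ R, ∃ R', ∀ y, ‖G y‖ < R → ‖y‖ < R') :
    pullBack T G h ∈ SCliff Y V := by
  refine ⟨?_, ?_, fun x v => ?_⟩
  · exact (Cl.continuous_map _).comp (hh.1.comp
      (continuous_fst.prodMk (hG.comp continuous_snd)))
  · rw [tendsto_cocompact_zero_iff]
    intro ε hε
    obtain ⟨R, hR⟩ := SCliff.exists_norm_le hh hε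
    obtain ⟨R', hR'⟩ := hGp R
    refine ⟨max R R', ?_⟩
    rintro ⟨x, y⟩ hp
    refine (Cl.norm_map_le _ _).trans (hR _ _ ?_)
    by_contra! hc
    rw [Prod.norm_def, Real.norm_eq_abs] at hp
    have := hR' y hc.2
    have h1 := hc.1
    dsimp only at h1 hp
    rcases le_max_iff.1 hp with hp | hp
    · exact absurd ((le_max_left _ _).trans hp) (not_le.2 h1)
    · exact absurd ((le_max_right _ _).trans hp) (not_le.2 this)
  · rw [pullBack_apply, pullBack_apply, hh.2.2, Cl.map_map, Cl.map_map]
    rfl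

end VanishAtInfinity

/-! ### Isomorphisms of generated C*-algebras -/

section Iso

/-- On the closure of R the map is isometric, so the image of this closure is complete and therefore
closed. Being a *-algebra that contains `s`, it contains the algebra generated by `s`. -/
theorem exists_mem_topologicalClosure_of_mem_cstarGen {C A : Type*} [NonUnitalCStarAlgebra C]
    [NonUnitalCStarAlgebra A] (R : NonUnitalStarSubalgebra ℂ C) (π : C →⋆ₙₐ[ℂ] A)
    (hc : Continuous π) (hπ : ∀ p ∈ R, ‖π p‖ = ‖p‖) {s : Set A}
    (hs : s ⊆ closure (π '' (R : Set C))) :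
    ∀ a ∈ cstarGen s, ∃ p ∈ R.topologicalClosure, π p = a := by
  have h1 : ∀ p ∈ R.topologicalClosure, ‖π p‖ = ‖p‖ := fun p hp =>
    closure_minimal (s := (R : Set C)) (t := {p | ‖π p‖ = ‖p‖}) hπ
      (isClosed_eq hc.norm continuous_norm) hp
  have h2 : IsClosed (π '' (R.topologicalClosure : Set C)) := by
    have : Isometry fun p : R.topologicalClosure => π p := by
      refine Isometry.of_dist_eq fun p q => ?_
      rw [dist_eq_norm, ← map_sub, h1 _ (sub_mem p.2 q.2), Subtype.dist_eq, dist_eq_norm]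
    have hcomp : CompleteSpace R.topologicalClosure :=
      (NonUnitalStarSubalgebra.isClosed_topologicalClosure R).completeSpace_coe
    have := this.isClosedEmbedding.isClosed_range
    rwa [Set.image_eq_range]
  intro a ha
  have h3 : cstarGen s ≤ R.topologicalClosure.map π := by
    refine NonUnitalStarSubalgebra.topologicalClosure_minimal _
      (NonUnitalStarAlgebra.adjoin_le ?_) h2
    refine hs.trans (closure_minimal ?_ h2)
    exact Set.image_mono subset_closure
  exact h3 ha

/-- An isometric correspondence between dense subalgebras extends to an isomorphism. -/
theorem exists_starAlgEquiv {A B : Type*} [NonUnitalCStarAlgebra A] [NonUnitalCStarAlgebra B]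
    {s : Set A} {t : Set B} (R : NonUnitalStarSubalgebra ℂ (A × B))
    (hR : ∀ p ∈ R, ‖p.1‖ = ‖p.2‖)
    (hs : s ⊆ closure (Prod.fst '' (R : Set (A × B)))) (hs' : ∀ p ∈ R, p.1 ∈ cstarGen s)
    (ht : t ⊆ closure (Prod.snd '' (R : Set (A × B)))) (ht' : ∀ p ∈ R, p.2 ∈ cstarGen t) :
    ∃ Φ : cstarGen s ≃⋆ₐ[ℂ] cstarGen t, ∀ a b, (a, b) ∈ R → ∀ ha : a ∈ cstarGen s,
      (Φ ⟨a, ha⟩ : B) = b := by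
  -- The equality of norms passes to the closure of R. It makes both coordinate projections
  -- isometric there, so the closure is the graph of a bijection: each coordinate is attained, and
  -- one coordinate determines the other.
  have hRc : ∀ p ∈ R.topologicalClosure, ‖p.1‖ = ‖p.2‖ := fun p hp =>
    closure_minimal (s := (R : Set (A × B))) (t := {p : A × B | ‖p.1‖ = ‖p.2‖}) hR
      (isClosed_eq continuous_fst.norm continuous_snd.norm) hp
  have hcl : ∀ p ∈ R.topologicalClosure, p.1 ∈ cstarGen s ∧ p.2 ∈ cstarGen t := by
    have h1 := NonUnitalStarSubalgebra.isClosed_topologicalClosure (NonUnitalStarAlgebra.adjoin ℂ s)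
    have h2 := NonUnitalStarSubalgebra.isClosed_topologicalClosure (NonUnitalStarAlgebra.adjoin ℂ t)
    intro p hp
    exact closure_minimal (s := (R : Set (A × B)))
      (t := {p : A × B | p.1 ∈ cstarGen s ∧ p.2 ∈ cstarGen t})
      (fun p hp => ⟨hs' p hp, ht' p hp⟩)
      ((h1.preimage continuous_fst).inter (h2.preimage continuous_snd)) hp
  have hf : ∀ a : cstarGen s, ∃ b : cstarGen t, ((a : A), (b : B)) ∈ R.topologicalClosure := by
    intro a
    obtain ⟨p, hp, hpa⟩ := exists_mem_topologicalClosure_of_mem_cstarGen R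
      (NonUnitalStarAlgHom.fst ℂ A B) continuous_fst (fun p hp => by
        change ‖p.1‖ = ‖p‖
        rw [Prod.norm_def, ← hR p hp, max_self]) hs a a.2
    refine ⟨⟨p.2, (hcl p hp).2⟩, ?_⟩
    rw [← hpa]
    exact hp
  have hg : ∀ b : cstarGen t, ∃ a : cstarGen s, ((a : A), (b : B)) ∈ R.topologicalClosure := by
    intro b
    obtain ⟨p, hp, hpb⟩ := exists_mem_topologicalClosure_of_mem_cstarGen R
      (NonUnitalStarAlgHom.snd ℂ A B) continuous_snd (fun p hp => by
        change ‖p.2‖ = ‖p‖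
        rw [Prod.norm_def, ← hR p hp, max_self]) ht b b.2
    refine ⟨⟨p.1, (hcl p hp).1⟩, ?_⟩
    rw [← hpb]
    exact hp
  have huniq : ∀ (a : cstarGen s) (b b' : cstarGen t), ((a : A), (b : B)) ∈ R.topologicalClosure →
      ((a : A), (b' : B)) ∈ R.topologicalClosure → b = b' := by
    intro a b b' h h'
    have := hRc _ (sub_mem h h')
    simp only [Prod.mk_sub_mk, sub_self, norm_zero] at this
    exact Subtype.ext (sub_eq_zero.1 (norm_eq_zero.1 this.symm))
  have huniq' : ∀ (a a' : cstarGen s) (b : cstarGen t), ((a : A), (b : B)) ∈ R.topologicalClosure →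
      ((a' : A), (b : B)) ∈ R.topologicalClosure → a = a' := by
    intro a a' b h h'
    have := hRc _ (sub_mem h h')
    simp only [Prod.mk_sub_mk, sub_self, norm_zero] at this
    exact Subtype.ext (sub_eq_zero.1 (norm_eq_zero.1 this))
  choose f hf using hf
  choose g hg using hg
  let e : cstarGen s ≃ cstarGen t := ⟨f, g, fun a => huniq' _ _ (f a) (hg _) (hf a),
    fun b => huniq (g b) _ _ (hf _) (hg b)⟩
  refine ⟨⟨⟨⟨e, fun a a' => huniq (a * a') _ _ (hf _) (mul_mem (hf a) (hf a')),
    fun a a' => huniq (a + a') _ _ (hf _) (add_mem (hf a) (hf a'))⟩,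
    fun a => huniq (star a) _ _ (hf _) (star_mem (hf a))⟩,
    fun c a => huniq (c • a) _ _ (hf _)
      (SMulMemClass.smul_mem c (hf a))⟩, fun a b hab ha => ?_⟩
  have h1 : (a, b) ∈ R.topologicalClosure := R.le_topologicalClosure hab
  exact congrArg Subtype.val (huniq ⟨a, ha⟩ _ ⟨b, (hcl _ h1).2⟩ (hf _) h1)

end Iso

/-! ### The maps as homomorphisms -/

section Homs

variable {U V W X Y : Type*} [NormedAddCommGroup U] [InnerProductSpace ℝ U]
  [NormedAddCommGroup V] [InnerProductSpace ℝ V] [NormedAddCommGroup W] [InnerProductSpace ℝ W]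

/-- The homomorphism of the fibrewise Bott map. -/
def bottFibreHom (ι : U →ₗᵢ[ℝ] V) (x : ℝ) (N : V) (hN : ∀ u, ⟪N, ι u⟫_ℝ = 0) :
    Cl (EPlus U) →⋆ₐ[ℂ] Cl (EPlus V) :=
  Cl.map (bottIsometry ι (EPlus.mk x N) hN)

/-- `bottMap` as a homomorphism. -/
def bottMapHom (ι : U →ₗᵢ[ℝ] V) (pr : Y → X) (N : Y → V) (hN : ∀ y u, ⟪N y, ι u⟫_ℝ = 0) :
    BFun X U →⋆ₙₐ[ℂ] BFun Y V where
  toFun := bottMap ι pr N hN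
  map_smul' c _ := Subtype.ext (funext fun p => map_smul (bottFibreHom ι p.1 (N p.2) (hN p.2)) c _)
  map_zero' := Subtype.ext (funext fun p => map_zero (bottFibreHom ι p.1 (N p.2) (hN p.2)))
  map_add' _ _ := Subtype.ext (funext fun p => map_add (bottFibreHom ι p.1 (N p.2) (hN p.2)) _ _)
  map_mul' _ _ := Subtype.ext (funext fun p => map_mul (bottFibreHom ι p.1 (N p.2) (hN p.2)) _ _)
  map_star' _ := Subtype.ext (funext fun p => map_star (bottFibreHom ι p.1 (N p.2) (hN p.2)) _)

/-- `pullBack` as a homomorphism. -/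
def pullBackHom (T : U →ₗᵢ[ℝ] V) (G : Y → X) :
    BFun X U →⋆ₙₐ[ℂ] BFun Y V where
  toFun := pullBack T G
  map_smul' c _ := Subtype.ext (funext fun _ => map_smul (Cl.map (EPlus.map T)) c _)
  map_zero' := Subtype.ext (funext fun _ => map_zero (Cl.map (EPlus.map T)))
  map_add' _ _ := Subtype.ext (funext fun _ => map_add (Cl.map (EPlus.map T)) _ _)
  map_mul' _ _ := Subtype.ext (funext fun _ => map_mul (Cl.map (EPlus.map T)) _ _)
  map_star' _ := Subtype.ext (funext fun _ => map_star (Cl.map (EPlus.map T)) _)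

/-- The value of a bounded family at a point. -/
def lpEval {P : Type*} (B : P → Type*) [∀ p, NonUnitalCStarAlgebra (B p)] (p : P) :
    lp B ∞ →⋆ₙₐ[ℂ] B p where
  toFun a := a p
  map_smul' _ _ := rfl
  map_zero' := rfl
  map_add' _ _ := rfl
  map_mul' _ _ := rfl
  map_star' _ := rfl

/-- The class of a bounded family as a homomorphism. -/
def AsymAlg.mkHom {P : Type*} (F : Filter P) (B : P → Type*) [∀ p, NonUnitalCStarAlgebra (B p)] :
    lp B ∞ →⋆ₙₐ[ℂ] AsymAlg F B where
  toFun := AsymAlg.mk F B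
  map_smul' _ _ := rfl
  map_zero' := rfl
  map_add' _ _ := rfl
  map_mul' _ _ := rfl
  map_star' _ := rfl

section Fam

variable {I : Type*} {X V : I → Type*} [∀ i, NormedAddCommGroup (V i)]
  [∀ i, InnerProductSpace ℝ (V i)]

theorem famOf_apply {S : I → Prop} {h : ∀ i, S i → BFun (X i) (V i)} {C : ℝ}
    (hC : ∀ i hi, ‖h i hi‖ ≤ C) {i : I} (hi : S i) (p : ℝ × X i) :
    famOf S h C hC ⟨i, p⟩ = h i hi p := dif_pos hi

theorem famOf_apply_of_not {S : I → Prop} {h : ∀ i, S i → BFun (X i) (V i)} {C : ℝ}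
    (hC : ∀ i hi, ‖h i hi‖ ≤ C) {i : I} (hi : ¬ S i) (p : ℝ × X i) :
    famOf S h C hC ⟨i, p⟩ = 0 := dif_neg hi

/-- `famOf` as a homomorphism. -/
def famHom {A : Type*} [NonUnitalNormedRing A] [NormedSpace ℂ A] [StarRing A] (S : I → Prop)
    (φ : ∀ i, S i → A →⋆ₙₐ[ℂ] BFun (X i) (V i)) (hφ : ∀ i hi a, ‖φ i hi a‖ ≤ ‖a‖) :
    A →⋆ₙₐ[ℂ] lp (fun p : Σ i, ℝ × X i => Cl (EPlus (V p.1))) ∞ :=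
  let T (a : A) := famOf S (fun i hi => φ i hi a) ‖a‖ fun i hi => hφ i hi a
  -- At each point the family is an evaluation of φ i or zero. Both are homomorphisms, so the
  -- identities are checked pointwise.
  have key : ∀ p, ∃ e : A →⋆ₙₐ[ℂ] Cl (EPlus (V p.1)), ∀ a, T a p = e a := by
    rintro ⟨i, p⟩
    by_cases hi : S i
    · exact ⟨(lpEval _ p).comp (φ i hi), fun a => famOf_apply _ hi p⟩
    · exact ⟨0, fun a => famOf_apply_of_not _ hi p⟩
  { toFun := T
    map_smul' := fun c a => Subtype.ext (funext fun p => by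
      obtain ⟨e, he⟩ := key p
      exact (he _).trans ((map_smul e c a).trans (congrArg (c • ·) (he a).symm)))
    map_zero' := Subtype.ext (funext fun p => by
      obtain ⟨e, he⟩ := key p
      exact (he _).trans (map_zero e))
    map_add' := fun a b => Subtype.ext (funext fun p => by
      obtain ⟨e, he⟩ := key p
      exact (he _).trans ((map_add e a b).trans (congrArg₂ (· + ·) (he a).symm (he b).symm)))
    map_mul' := fun a b => Subtype.ext (funext fun p => by
      obtain ⟨e, he⟩ := key p
      exact (he _).trans ((map_mul e a b).trans (congrArg₂ (· * ·) (he a).symm (he b).symm)))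
    map_star' := fun a => Subtype.ext (funext fun p => by
      obtain ⟨e, he⟩ := key p
      exact (he _).trans ((map_star e a).trans (congrArg star (he a).symm))) }

end Fam

end Homs

/-! ### Standard Bott maps -/

section Bott

set_option linter.unusedSectionVars false

variable {H : Type*} [NormedAddCommGroup H] [InnerProductSpace ℝ H]

variable {E E₁ E₂ E₃ : Submodule ℝ H} [FiniteDimensional ℝ E] [FiniteDimensional ℝ E₁]
  [FiniteDimensional ℝ E₂] [FiniteDimensional ℝ E₃]

theorem orthogonalProjectionOnto_coe_of_le (h : E₁ ≤ E₂) (y : H) :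
    E₁.orthogonalProjectionOnto (E₂.orthogonalProjectionOnto y : H) =
      E₁.orthogonalProjectionOnto y :=
  Submodule.orthogonalProjectionOnto_starProjection_of_le h y

theorem sub_orthogonalProjectionOnto_inner (y : H) (u : E) :
    ⟪y - E.orthogonalProjectionOnto y, (u : H)⟫_ℝ = 0 := by
  rw [real_inner_comm]
  exact Submodule.sub_starProjection_mem_orthogonal (K := E) y u u.2

theorem bott_apply (h : E₁ ≤ E₂) (u : BFun E₁ E₁) (x : ℝ) (y : E₂) :
    bott h u (x, y) = bottFibre (inclIso h)
      (EPlus.mk x (y - inclIso h (E₁.orthogonalProjectionOnto (y : H))))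
      (fun v => sub_orthogonalProjectionOnto_inner (y : H) v)
      (fun t => u (t, E₁.orthogonalProjectionOnto (y : H))) := rfl

/-- With P₁, P₂ the projections to E₁, E₂, this is P₁ P₂ = P₁ together with (y − P₂ y) + (P₂ y − P₁
y) = y − P₁ y. -/
theorem bott_bott (h₁₂ : E₁ ≤ E₂) (h₂₃ : E₂ ≤ E₃) (u : BFun E₁ E₁) :
    bott h₂₃ (bott h₁₂ u) = bott (h₁₂.trans h₂₃) u := by
  refine Subtype.ext (funext fun ⟨x, y⟩ => ?_)
  have h0 := orthogonalProjectionOnto_coe_of_le h₁₂ (y : H)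
  refine (bottFibre_bottFibre (inclIso h₂₃) (inclIso h₁₂) x
    (y - inclIso h₂₃ (E₂.orthogonalProjectionOnto (y : H)))
    (E₂.orthogonalProjectionOnto (y : H) - inclIso h₁₂
      (E₁.orthogonalProjectionOnto (E₂.orthogonalProjectionOnto (y : H) : H)))
    (fun v => sub_orthogonalProjectionOnto_inner (y : H) v)
    (fun v => sub_orthogonalProjectionOnto_inner (E₂.orthogonalProjectionOnto (y : H) : H) v)
    _).trans ?_
  refine (bottFibre_congr (hn₂ := fun v => sub_orthogonalProjectionOnto_inner (y : H) v)
    ?_ ?_ ?_).trans (bott_apply _ _ _ _).symm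
  · rfl
  · congr 1
    rw [h0, map_sub]
    refine Subtype.ext ?_
    change ((y : H) - E₂.orthogonalProjectionOnto (y : H)) +
      (E₂.orthogonalProjectionOnto (y : H) - E₁.orthogonalProjectionOnto (y : H)) = _
    rw [sub_add_sub_cancel]
    rfl
  · exact funext fun t => congrArg (fun z => u (t, z)) h0

/-- The standard Bott map as a homomorphism. -/
def bottHom (h : E₁ ≤ E₂) : BFun E₁ E₁ →⋆ₙₐ[ℂ] BFun E₂ E₂ :=
  bottMapHom (inclIso h) (fun y => E₁.orthogonalProjectionOnto (y : H))
    (fun y => y - inclIso h (E₁.orthogonalProjectionOnto (y : H)))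
    (fun y v => sub_orthogonalProjectionOnto_inner (y : H) v)

theorem bottHom_apply (h : E₁ ≤ E₂) (u : BFun E₁ E₁) : bottHom h u = bott h u := rfl

theorem norm_bott_le (h : E₁ ≤ E₂) (u : BFun E₁ E₁) : ‖bott h u‖ ≤ ‖u‖ := norm_bottMap_le _ _ _ _ _

theorem SCliff.bott_mem (h : E₁ ≤ E₂) {u : BFun E₁ E₁} (hu : u ∈ SCliff E₁ E₁) :
    bott h u ∈ SCliff E₂ E₂ := by
  have hc : Continuous fun y : E₂ => E₁.orthogonalProjectionOnto (y : H) :=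
    E₁.orthogonalProjectionOnto.continuous.comp continuous_subtype_val
  refine SCliff.bottMap_mem (K := 1) hu (inclIso h) _ hc
    (continuous_id.sub ((inclIso h).continuous.comp hc)) fun y => ?_
  rw [one_mul]
  have : ‖y‖ ≤ ‖y - inclIso h (E₁.orthogonalProjectionOnto (y : H))‖ +
      ‖inclIso h (E₁.orthogonalProjectionOnto (y : H))‖ := by
    simpa using norm_add_le (y - inclIso h (E₁.orthogonalProjectionOnto (y : H)))
      (inclIso h (E₁.orthogonalProjectionOnto (y : H)))
  rwa [LinearIsometry.norm_map (inclIso h)] at this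

/-- The norm of the value of the standard Bott map at a point `y` of a larger space. -/
def profile (E : Submodule ℝ H) [FiniteDimensional ℝ E] (u : BFun E E) (x : ℝ) (y : H) : ℝ :=
  ‖u (‖EPlus.mk x (y - E.orthogonalProjectionOnto y : H)‖, E.orthogonalProjectionOnto y)‖

theorem profile_le (u : BFun E E) (x : ℝ) (y : H) : profile E u x y ≤ ‖u‖ :=
  lp.norm_apply_le_norm (by simp) u _

/-- The right-hand side does not involve E₂, so norms computed over different larger subspaces can
be compared. -/
theorem norm_bott_apply (h : E₁ ≤ E₂) (u : BFun E₁ E₁) (x : ℝ) (y : E₂) :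
    ‖bott h u (x, y)‖ = profile E₁ u x y := by
  exact norm_bottFibre (inclIso h) _ _ _

/-- Both arguments of u move by at most 2‖y − y'‖, and u is uniformly continuous. As δ depends on
neither x nor y, F may be replaced by its approximations inside a profile. -/
theorem SCliff.exists_profile_sub_le {u : BFun E E} (hu : u ∈ SCliff E E) {ε : ℝ} (hε : 0 < ε) :
    ∃ δ > 0, ∀ x y y', ‖y - y'‖ ≤ δ → profile E u x y ≤ profile E u x y' + ε := by
  obtain ⟨δ, hδ, Hu⟩ := SCliff.exists_norm_sub_le hu hε
  refine ⟨δ / 2, by positivity, fun x y y' hy => ?_⟩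
  have h1 : ‖E.orthogonalProjectionOnto y - E.orthogonalProjectionOnto y'‖ ≤ ‖y - y'‖ := by
    rw [← map_sub]
    exact Submodule.norm_orthogonalProjectionOnto_apply_le _ _
  have h2 := Hu ‖EPlus.mk x (y - E.orthogonalProjectionOnto y : H)‖
    ‖EPlus.mk x (y' - E.orthogonalProjectionOnto y' : H)‖ (E.orthogonalProjectionOnto y)
    (E.orthogonalProjectionOnto y') ?_ (by linarith)
  · have := norm_le_norm_add_norm_sub'
      (u (‖EPlus.mk x (y - E.orthogonalProjectionOnto y : H)‖, E.orthogonalProjectionOnto y))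
      (u (‖EPlus.mk x (y' - E.orthogonalProjectionOnto y' : H)‖, E.orthogonalProjectionOnto y'))
    unfold profile
    linarith
  · refine (EPlus.abs_norm_mk_sub_le _ _ _).trans ?_
    have : (y - E.orthogonalProjectionOnto y : H) - (y' - E.orthogonalProjectionOnto y') =
      (y - y') - ((E.orthogonalProjectionOnto y - E.orthogonalProjectionOnto y' : E) : H) := by
      rw [Submodule.coe_sub]; abel
    rw [this]
    refine (norm_sub_le _ _).trans ?_
    change ‖y - y'‖ + ‖(E.orthogonalProjectionOnto y - E.orthogonalProjectionOnto y' : E)‖ ≤ δ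
    linarith

end Bott

/-! ### The C*-algebra of all finite-dimensional subspaces of the target -/

section Hub

variable {H' H : Type*} [NormedAddCommGroup H] [InnerProductSpace ℝ H]

theorem AsymAlg.mk_eq_mk_of_eventually {P : Type*} {F : Filter P} {B : P → Type*}
    [∀ p, NonUnitalCStarAlgebra (B p)] {a b : lp B ∞} (h : ∀ᶠ p in F, a p = b p) :
    AsymAlg.mk F B a = AsymAlg.mk F B b := by
  have h1 : AsymAlg.mkHom F B (a - b) = 0 := by
    rw [← norm_le_zero_iff]
    refine (AsymAlg.norm_mk_le_iff _ le_rfl).2 fun ε hε => ?_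
    filter_upwards [h] with p hp
    have : (a - b) p = 0 := sub_eq_zero.2 hp
    rw [this, norm_zero]
    linarith
  rw [map_sub, sub_eq_zero] at h1
  exact h1

instance : IsDirectedOrder (FinSub H) where
  directed E₁ E₂ := ⟨⟨E₁.1 ⊔ E₂.1, inferInstance⟩, Subtype.coe_le_coe.1 le_sup_left,
    Subtype.coe_le_coe.1 le_sup_right⟩

instance : Nonempty (FinSub H) := ⟨⟨⊥, inferInstance⟩⟩

/-- Bounded nets of functions on `ℝ × F⁻¹(E)`, `E ⊆ H` finite-dimensional, modulo null nets. -/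
abbrev HubNets (F : H' → H) : Type _ :=
  AsymAlg (comap Sigma.fst atTop)
    (fun p : Σ E : FinSub H, ℝ × {v : H' // F v ∈ E.1} => Cl (EPlus p.1.1))

/-- The restriction of `F` to the preimage of `E`. -/
def hubPoint (F : H' → H) (E : Submodule ℝ H) (v : {v : H' // F v ∈ E}) : E := ⟨F v, v.2⟩

/-- The net `E' ↦ ((x, v) ↦ β(u)(x, F v))`. -/
def hubFam (F : H' → H) (E : Submodule ℝ H) [FiniteDimensional ℝ E] (u : BFun E E) :
    lp (fun p : Σ E : FinSub H, ℝ × {v : H' // F v ∈ E.1} => Cl (EPlus p.1.1)) ∞ :=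
  famOf (X := fun E' : FinSub H => {v : H' // F v ∈ E'.1})
    (V := fun E' : FinSub H => E'.1) (fun E' => E ≤ E'.1)
    (fun E' h => pullBack LinearIsometry.id (hubPoint F E'.1) (bott h u)) ‖u‖
    (fun _ h => (norm_pullBack_le _ _ _).trans (norm_bott_le h u))

theorem hubFam_apply (F : H' → H) {E : Submodule ℝ H} [FiniteDimensional ℝ E] (u : BFun E E)
    (E' : FinSub H) (h : E ≤ E'.1) (x : ℝ) (v : {v : H' // F v ∈ E'.1}) :
    hubFam F E u ⟨E', x, v⟩ =
      pullBack LinearIsometry.id (hubPoint F E'.1) (bott h u) (x, v) := dif_pos h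

/-- The homomorphism that sends `u` to the class of the net `E' ↦ ((x, v) ↦ β(u)(x, F v))`. -/
def hubHom (F : H' → H) (E : Submodule ℝ H) [FiniteDimensional ℝ E] :
    BFun E E →⋆ₙₐ[ℂ] HubNets F :=
  (AsymAlg.mkHom (comap Sigma.fst atTop)
    (fun p : Σ E : FinSub H, ℝ × {v : H' // F v ∈ E.1} => Cl (EPlus p.1.1))).comp
  (famHom (X := fun E' : FinSub H => {v : H' // F v ∈ E'.1})
    (V := fun E' : FinSub H => E'.1) (fun E' => E ≤ E'.1)
    (fun E' h => (pullBackHom LinearIsometry.id (hubPoint F E'.1)).comp (bottHom h))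
    (fun _ h u => (norm_pullBack_le _ _ _).trans (norm_bott_le h u)))

theorem hubHom_apply (F : H' → H) (E : Submodule ℝ H) [FiniteDimensional ℝ E] (u : BFun E E) :
    hubHom F E u = AsymAlg.mk _ _ (hubFam F E u) := rfl

variable {E E₁ E₂ : Submodule ℝ H} [FiniteDimensional ℝ E] [FiniteDimensional ℝ E₁]
  [FiniteDimensional ℝ E₂]

/-- The member of the net at E' has norm the supremum of the profiles over F⁻¹(E'), and every v lies
in F⁻¹(E') for large E'. So the limit superior is a supremum over all of H'. -/
theorem norm_hubHom_le_iff (F : H' → H) (u : BFun E E) {c : ℝ} (hc : 0 ≤ c) :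
    ‖hubHom F E u‖ ≤ c ↔ ∀ x v, profile E u x (F v) ≤ c := by
  rw [hubHom_apply]
  refine (AsymAlg.norm_mk_le_iff (hubFam F E u) hc).trans ?_
  have key : ∀ (E' : FinSub H) (h : E ≤ E'.1) (x : ℝ) (v : {v : H' // F v ∈ E'.1}),
      ‖hubFam F E u ⟨E', x, v⟩‖ = profile E u x (F v) := by
    intro E' h x v
    rw [hubFam_apply F u E' h]
    refine (Cl.norm_map _ _).trans ?_
    exact norm_bott_apply h u x (hubPoint F E'.1 v)
  constructor
  · intro hu x v
    refine le_of_forall_pos_le_add fun ε hε => ?_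
    have := hu ε hε
    rw [eventually_comap, eventually_atTop] at this
    obtain ⟨E₀, hE₀⟩ := this
    -- The line through F v is added so that v becomes a point of the net.
    let E' : FinSub H := ⟨E₀.1 ⊔ (E ⊔ Submodule.span ℝ {F v}), inferInstance⟩
    have h1 : F v ∈ E'.1 := (le_sup_right.trans le_sup_right : _ ≤ E'.1)
      (Submodule.mem_span_singleton_self _)
    have h2 : E ≤ E'.1 := le_sup_left.trans le_sup_right
    have h3 := hE₀ E' (Subtype.coe_le_coe.1 le_sup_left) ⟨E', x, ⟨v, h1⟩⟩ rfl
    rw [← key E' h2 x ⟨v, h1⟩]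
    exact h3
  · intro hu ε hε
    rw [eventually_comap, eventually_atTop]
    refine ⟨⟨E, inferInstance⟩, ?_⟩
    rintro _ hE' ⟨E', x, v⟩ rfl
    exact ((key E' hE' x v).trans_le (hu x v)).trans (by linarith)

theorem norm_hubHom_le (F : H' → H) (u : BFun E E) : ‖hubHom F E u‖ ≤ ‖u‖ :=
  (norm_hubHom_le_iff F u (norm_nonneg _)).2 fun _ _ => profile_le _ _ _

theorem hubHom_bott (F : H' → H) (h : E₁ ≤ E₂) (u : BFun E₁ E₁) :
    hubHom F E₂ (bott h u) = hubHom F E₁ u := by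
  refine AsymAlg.mk_eq_mk_of_eventually ?_
  rw [eventually_comap, eventually_atTop]
  refine ⟨⟨E₂, inferInstance⟩, ?_⟩
  rintro _ hE' ⟨E', x, v⟩ rfl
  have h2 : E₂ ≤ E'.1 := hE'
  change hubFam F E₂ (bott h u) ⟨E', x, v⟩ = hubFam F E₁ u ⟨E', x, v⟩
  rw [hubFam_apply F _ E' h2, hubFam_apply F _ E' (h.trans h2), bott_bott]

end Hub

/-! ### Directed systems of homomorphisms and their comparison through the hub. -/

section HubEquiv

set_option linter.unusedSectionVars false

variable {H' H : Type*} [NormedAddCommGroup H] [InnerProductSpace ℝ H]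

/-- The C*-algebra generated by the classes of the elements of the algebras `S𝔠(E)`. -/
abbrev HubAlg (F : H' → H) : Type _ :=
  cstarGen {a : HubNets F | ∃ (E : FinSub H) (u : BFun E.1 E.1), u ∈ SCliff E.1 E.1 ∧
    hubHom F E.1 u = a}

theorem hubHom_mem (F : H' → H) {E : Submodule ℝ H} [FiniteDimensional ℝ E] {u : BFun E E}
    (hu : u ∈ SCliff E E) : hubHom F E u ∈ cstarGen {a : HubNets F | ∃ (E : FinSub H)
      (u : BFun E.1 E.1), u ∈ SCliff E.1 E.1 ∧ hubHom F E.1 u = a} :=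
  subset_cstarGen _ ⟨⟨E, inferInstance⟩, u, hu, rfl⟩

/-- The source of the bounds on ‖Φ[u] − [v]‖: both classes are represented over E₁ ⊔ E₂, where the
homomorphism is contractive. -/
theorem norm_hubHom_sub_hubHom_le (F : H' → H) {E₁ E₂ : Submodule ℝ H} [FiniteDimensional ℝ E₁]
    [FiniteDimensional ℝ E₂] (u : BFun E₁ E₁) (v : BFun E₂ E₂) :
    ‖hubHom F E₁ u - hubHom F E₂ v‖ ≤
      ‖bott (le_sup_left : E₁ ≤ E₁ ⊔ E₂) u - bott (le_sup_right : E₂ ≤ E₁ ⊔ E₂) v‖ := by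
  rw [← hubHom_bott F (le_sup_left : E₁ ≤ E₁ ⊔ E₂) u,
    ← hubHom_bott F (le_sup_right : E₂ ≤ E₁ ⊔ E₂) v, ← map_sub]
  exact norm_hubHom_le F _

/-- A directed family of homomorphisms, defined on subalgebras of the algebras `S𝔠(E_i)`,
compatible with the Bott maps. -/
structure BottSystem (F : H' → H) (A : Type*) [NonUnitalCStarAlgebra A] (ι : Type*)
    [Preorder ι] where
  /-- The subspaces. -/
  E : ι → Submodule ℝ H
  finite_dim : ∀ i, FiniteDimensional ℝ (E i)
  mono : Monotone E
  /-- The domains. -/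
  S : ∀ i, NonUnitalStarSubalgebra ℂ (BFun (E i) (E i))
  S_le : ∀ i, S i ≤ SCliff (E i) (E i)
  bott_mem : ∀ i j (h : i ≤ j), ∀ u ∈ S i, bott (mono h) u ∈ S j
  /-- The homomorphisms. -/
  hom : ∀ i, BFun (E i) (E i) →⋆ₙₐ[ℂ] A
  hom_bott : ∀ i j (h : i ≤ j), ∀ u ∈ S i, hom j (bott (mono h) u) = hom i u
  -- The norm of `hom i u` is the supremum of the profiles over F(H'), as in the hub.
  norm_le_iff : ∀ i, ∀ u ∈ S i, ∀ c, 0 ≤ c → (‖hom i u‖ ≤ c ↔ ∀ x v, profile (E i) u x (F v) ≤ c)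
  -- Density is required in the hub, whose classes do not depend on A; it makes the second
  -- projection of the graph dense.
  dense : ∀ (E₀ : Submodule ℝ H) [FiniteDimensional ℝ E₀], ∀ u ∈ SCliff E₀ E₀, ∀ ε > 0,
    ∃ i, ∃ v ∈ S i, ‖hubHom F E₀ u - hubHom F (E i) v‖ ≤ ε

namespace BottSystem

variable {F : H' → H} {A : Type*} [NonUnitalCStarAlgebra A] {ι : Type*} [Preorder ι]

variable (𝒮 : BottSystem F A ι)

instance (i : ι) : FiniteDimensional ℝ (𝒮.E i) := 𝒮.finite_dim i

theorem norm_hom (i : ι) (u) (hu : u ∈ 𝒮.S i) : ‖𝒮.hom i u‖ = ‖hubHom F (𝒮.E i) u‖ := by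
  refine le_antisymm ?_ ?_
  · exact (𝒮.norm_le_iff i u hu _ (norm_nonneg _)).2
      ((norm_hubHom_le_iff F u (norm_nonneg _)).1 le_rfl)
  · exact (norm_hubHom_le_iff F u (norm_nonneg _)).2
      ((𝒮.norm_le_iff i u hu _ (norm_nonneg _)).1 le_rfl)

theorem exists_common [IsDirectedOrder ι] {p q : A × HubNets F}
    (hp : ∃ i, ∃ u ∈ 𝒮.S i, (𝒮.hom i u, hubHom F (𝒮.E i) u) = p)
    (hq : ∃ i, ∃ u ∈ 𝒮.S i, (𝒮.hom i u, hubHom F (𝒮.E i) u) = q) :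
    ∃ i, ∃ u ∈ 𝒮.S i, ∃ v ∈ 𝒮.S i, (𝒮.hom i u, hubHom F (𝒮.E i) u) = p ∧
      (𝒮.hom i v, hubHom F (𝒮.E i) v) = q := by
  obtain ⟨i, u, hu, rfl⟩ := hp
  obtain ⟨j, v, hv, rfl⟩ := hq
  obtain ⟨k, hik, hjk⟩ := exists_ge_ge i j
  refine ⟨k, bott (𝒮.mono hik) u, 𝒮.bott_mem i k hik u hu, bott (𝒮.mono hjk) v,
    𝒮.bott_mem j k hjk v hv, ?_, ?_⟩
  · rw [𝒮.hom_bott i k hik u hu, hubHom_bott]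
  · rw [𝒮.hom_bott j k hjk v hv, hubHom_bott]

/-- The graph of the isomorphism between the algebra of a Bott system and the algebra of all
finite-dimensional subspaces. -/
def graph [IsDirectedOrder ι] [Nonempty ι] : NonUnitalStarSubalgebra ℂ (A × HubNets F) where
  carrier := {p | ∃ i, ∃ u ∈ 𝒮.S i, (𝒮.hom i u, hubHom F (𝒮.E i) u) = p}
  zero_mem' := by
    inhabit ι
    exact ⟨default, 0, zero_mem _, by rw [map_zero, map_zero]; rfl⟩
  add_mem' := by
    intro p q hp hq
    obtain ⟨i, u, hu, v, hv, rfl, rfl⟩ := 𝒮.exists_common hp hq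
    exact ⟨i, u + v, add_mem hu hv, by rw [map_add, map_add]; rfl⟩
  mul_mem' := by
    intro p q hp hq
    obtain ⟨i, u, hu, v, hv, rfl, rfl⟩ := 𝒮.exists_common hp hq
    exact ⟨i, u * v, mul_mem hu hv, by rw [map_mul, map_mul]; rfl⟩
  smul_mem' := by
    rintro c _ ⟨i, u, hu, rfl⟩
    exact ⟨i, c • u, SMulMemClass.smul_mem c hu, by rw [map_smul, map_smul]; rfl⟩
  star_mem' := by
    rintro _ ⟨i, u, hu, rfl⟩
    exact ⟨i, star u, star_mem hu, by rw [map_star, map_star]; rfl⟩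

/-- Both coordinates of the graph have the supremum of the same profiles as norm. The first
coordinates are dense by `hs'`, the second by the density field of the system. -/
theorem exists_equiv [IsDirectedOrder ι] [Nonempty ι] (s : Set A)
    (hs : ∀ i, ∀ u ∈ 𝒮.S i, 𝒮.hom i u ∈ cstarGen s)
    (hs' : s ⊆ closure {a | ∃ i, ∃ u ∈ 𝒮.S i, 𝒮.hom i u = a}) :
    ∃ Φ : cstarGen s ≃⋆ₐ[ℂ] HubAlg F, ∀ i u (hu : u ∈ 𝒮.S i),
      (Φ ⟨𝒮.hom i u, hs i u hu⟩ : HubNets F) = hubHom F (𝒮.E i) u := by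
  have h1 : ∀ p ∈ 𝒮.graph, ‖p.1‖ = ‖p.2‖ := by
    rintro _ ⟨i, u, hu, rfl⟩
    exact 𝒮.norm_hom i u hu
  have h2 : s ⊆ closure (Prod.fst '' (𝒮.graph : Set (A × HubNets F))) := by
    refine hs'.trans (closure_mono ?_)
    rintro _ ⟨i, u, hu, rfl⟩
    exact ⟨_, ⟨i, u, hu, rfl⟩, rfl⟩
  have h3 : ∀ p ∈ 𝒮.graph, p.1 ∈ cstarGen s := by
    rintro _ ⟨i, u, hu, rfl⟩
    exact hs i u hu
  have h4 : {a : HubNets F | ∃ (E : FinSub H) (u : BFun E.1 E.1), u ∈ SCliff E.1 E.1 ∧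
      hubHom F E.1 u = a} ⊆ closure (Prod.snd '' (𝒮.graph : Set (A × HubNets F))) := by
    rintro _ ⟨E, u, hu, rfl⟩
    refine Metric.mem_closure_iff.2 fun ε hε => ?_
    obtain ⟨i, v, hv, h⟩ := 𝒮.dense E.1 u hu (ε / 2) (by positivity)
    refine ⟨_, ⟨_, ⟨i, v, hv, rfl⟩, rfl⟩, ?_⟩
    rw [dist_eq_norm]
    exact h.trans_lt (by linarith)
  obtain ⟨Φ, hΦ⟩ := exists_starAlgEquiv 𝒮.graph h1 h2 h3 h4 (by
    rintro _ ⟨i, u, hu, rfl⟩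
    exact hubHom_mem F (𝒮.S_le i hu))
  exact ⟨Φ, fun i u hu => hΦ _ _ ⟨i, u, hu, rfl⟩ _⟩

/-- Injective *-homomorphisms of C*-algebras are isometric, so the difference may be measured after
applying Φ₂. -/
theorem norm_trans_symm_sub {A B C : Type*} [NonUnitalCStarAlgebra A] [NonUnitalCStarAlgebra B]
    [NonUnitalCStarAlgebra C] (Φ₁ : A ≃⋆ₐ[ℂ] C) (Φ₂ : B ≃⋆ₐ[ℂ] C) (a : A) (b : B) :
    ‖(Φ₁.trans Φ₂.symm) a - b‖ = ‖Φ₁ a - Φ₂ b‖ := by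
  rw [← NonUnitalStarAlgHom.norm_map (Φ₂ : B →⋆ₙₐ[ℂ] C) Φ₂.injective ((Φ₁.trans Φ₂.symm) a - b),
    map_sub]
  congr 2
  exact Φ₂.apply_symm_apply (Φ₁ a)

/-- Both algebras are identified with the hub, where the classes of u and v can be compared
directly. -/
theorem exists_equiv_of_system {A₁ A₂ ι₁ ι₂ : Type*} [NonUnitalCStarAlgebra A₁]
    [NonUnitalCStarAlgebra A₂] [Preorder ι₁] [Preorder ι₂] [IsDirectedOrder ι₁]
    [IsDirectedOrder ι₂] [Nonempty ι₁] [Nonempty ι₂] (𝒮₁ : BottSystem F A₁ ι₁)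
    (𝒮₂ : BottSystem F A₂ ι₂) (s₁ : Set A₁) (s₂ : Set A₂)
    (h₁ : ∀ i, ∀ u ∈ 𝒮₁.S i, 𝒮₁.hom i u ∈ cstarGen s₁)
    (h₁' : s₁ ⊆ closure {a | ∃ i, ∃ u ∈ 𝒮₁.S i, 𝒮₁.hom i u = a})
    (h₂ : ∀ i, ∀ u ∈ 𝒮₂.S i, 𝒮₂.hom i u ∈ cstarGen s₂)
    (h₂' : s₂ ⊆ closure {a | ∃ i, ∃ u ∈ 𝒮₂.S i, 𝒮₂.hom i u = a}) :
    ∃ Φ : cstarGen s₁ ≃⋆ₐ[ℂ] cstarGen s₂, ∀ i u (hu : u ∈ 𝒮₁.S i) j v (hv : v ∈ 𝒮₂.S j),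
      ‖Φ ⟨𝒮₁.hom i u, h₁ i u hu⟩ - ⟨𝒮₂.hom j v, h₂ j v hv⟩‖ ≤
        ‖bott (le_sup_left : 𝒮₁.E i ≤ 𝒮₁.E i ⊔ 𝒮₂.E j) u -
          bott (le_sup_right : 𝒮₂.E j ≤ 𝒮₁.E i ⊔ 𝒮₂.E j) v‖ := by
  obtain ⟨Φ₁, hΦ₁⟩ := 𝒮₁.exists_equiv s₁ h₁ h₁'
  obtain ⟨Φ₂, hΦ₂⟩ := 𝒮₂.exists_equiv s₂ h₂ h₂'
  refine ⟨Φ₁.trans Φ₂.symm, fun i u hu j v hv => ?_⟩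
  have h5 := norm_hubHom_sub_hubHom_le F u v
  rw [← hΦ₁ i u hu, ← hΦ₂ j v hv] at h5
  exact (norm_trans_symm_sub Φ₁ Φ₂ _ _).trans_le h5

/-- The exact version for elements with equal hub classes; in the linear case the same u is used on
both sides. -/
theorem exists_equiv_of_system_eq {A₁ A₂ ι₁ ι₂ : Type*} [NonUnitalCStarAlgebra A₁]
    [NonUnitalCStarAlgebra A₂] [Preorder ι₁] [Preorder ι₂] [IsDirectedOrder ι₁]
    [IsDirectedOrder ι₂] [Nonempty ι₁] [Nonempty ι₂] (𝒮₁ : BottSystem F A₁ ι₁)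
    (𝒮₂ : BottSystem F A₂ ι₂) (s₁ : Set A₁) (s₂ : Set A₂)
    (h₁ : ∀ i, ∀ u ∈ 𝒮₁.S i, 𝒮₁.hom i u ∈ cstarGen s₁)
    (h₁' : s₁ ⊆ closure {a | ∃ i, ∃ u ∈ 𝒮₁.S i, 𝒮₁.hom i u = a})
    (h₂ : ∀ i, ∀ u ∈ 𝒮₂.S i, 𝒮₂.hom i u ∈ cstarGen s₂)
    (h₂' : s₂ ⊆ closure {a | ∃ i, ∃ u ∈ 𝒮₂.S i, 𝒮₂.hom i u = a}) :
    ∃ Φ : cstarGen s₁ ≃⋆ₐ[ℂ] cstarGen s₂, ∀ i u (hu : u ∈ 𝒮₁.S i) j v (_ : v ∈ 𝒮₂.S j),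
      hubHom F (𝒮₁.E i) u = hubHom F (𝒮₂.E j) v →
        (Φ ⟨𝒮₁.hom i u, h₁ i u hu⟩ : A₂) = 𝒮₂.hom j v := by
  obtain ⟨Φ₁, hΦ₁⟩ := 𝒮₁.exists_equiv s₁ h₁ h₁'
  obtain ⟨Φ₂, hΦ₂⟩ := 𝒮₂.exists_equiv s₂ h₂ h₂'
  refine ⟨Φ₁.trans Φ₂.symm, fun i u hu j v hv h => ?_⟩
  have h3 : Φ₁ ⟨𝒮₁.hom i u, h₁ i u hu⟩ = Φ₂ ⟨𝒮₂.hom j v, h₂ j v hv⟩ :=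
    Subtype.ext ((hΦ₁ i u hu).trans (h.trans (hΦ₂ j v hv).symm))
  have h4 : Φ₂.symm (Φ₁ ⟨𝒮₁.hom i u, h₁ i u hu⟩) = ⟨𝒮₂.hom j v, h₂ j v hv⟩ := by
    rw [h3]
    exact Φ₂.symm_apply_apply _
  exact congrArg Subtype.val h4

end BottSystem

end HubEquiv

/-! ### Polar decompositions of operators that are almost isometric -/

section PolarNear

set_option linter.unusedSectionVars false

variable {X Y : Type*} [NormedAddCommGroup X] [InnerProductSpace ℝ X] [CompleteSpace X]
  [NormedAddCommGroup Y] [InnerProductSpace ℝ Y] [CompleteSpace Y]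

theorem absOp_isPositive (A : X →L[ℝ] Y) (hA : ∃ c > 0, ∀ x, c * ‖x‖ ≤ ‖A x‖) :
    (absOp A hA : X →L[ℝ] X).IsPositive := (exists_absOp A hA).choose_spec.1

theorem absOp_absOp (A : X →L[ℝ] Y) (hA : ∃ c > 0, ∀ x, c * ‖x‖ ≤ ‖A x‖) (x : X) :
    absOp A hA (absOp A hA x) = A.adjoint (A x) := (exists_absOp A hA).choose_spec.2 x

theorem polarIsometry_absOp (A : X →L[ℝ] Y) (hA : ∃ c > 0, ∀ x, c * ‖x‖ ≤ ‖A x‖) (x : X) :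
    polarIsometry A hA (absOp A hA x) = A x := by
  change A ((absOp A hA).symm (absOp A hA x)) = A x
  rw [ContinuousLinearEquiv.symm_apply_apply]

/-- The cross term 2⟪P y, y⟫ in ‖P y + y‖² is nonnegative. -/
theorem norm_le_norm_add_of_isPositive {P : X →L[ℝ] X} (hP : P.IsPositive) (y : X) :
    ‖y‖ ≤ ‖P y + y‖ := by
  have h1 : 0 ≤ ⟪P y, y⟫_ℝ := hP.inner_nonneg_left y
  refine le_of_sq_le_sq ?_ (norm_nonneg _)
  rw [norm_add_sq_real]
  nlinarith [sq_nonneg ‖P y‖]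

/-- With P = √(A* A) one has (P + 1)(1 − P) = 1 − A* A, and P + 1 does not decrease norms. -/
theorem norm_sub_absOp_le (A : X →L[ℝ] Y) (hA : ∃ c > 0, ∀ x, c * ‖x‖ ≤ ‖A x‖) (x : X) :
    ‖x - absOp A hA x‖ ≤ ‖x - A.adjoint (A x)‖ := by
  refine (norm_le_norm_add_of_isPositive (absOp_isPositive A hA) _).trans_eq ?_
  rw [← absOp_absOp A hA]
  congr 1
  change absOp A hA (x - absOp A hA x) + _ = _
  rw [map_sub]
  abel

/-- An operator that is almost isometric is close to the isometry of its polar decomposition. -/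
theorem norm_polarIsometry_sub_le (A : X →L[ℝ] Y) (hA : ∃ c > 0, ∀ x, c * ‖x‖ ≤ ‖A x‖) (x : X) :
    ‖polarIsometry A hA x - A x‖ ≤ ‖x - A.adjoint (A x)‖ := by
  refine le_of_eq_of_le ?_ (norm_sub_absOp_le A hA x)
  rw [← polarIsometry_absOp A hA x, ← map_sub, LinearIsometry.norm_map]

end PolarNear

/-! ### Cut-offs, almost inclusions of subspaces, and density of the classes in the hub. -/

section Density

set_option linter.unusedSectionVars false

/-- Functions supported in a ball of `ℝ ⊕ X`. -/
def BallSupp {X V : Type*} [NormedAddCommGroup X] [InnerProductSpace ℝ X] [NormedAddCommGroup V]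
    [InnerProductSpace ℝ V] (R : ℝ) (h : BFun X V) : Prop :=
  ∀ (x : ℝ) (v : X), R ≤ ‖EPlus.mk x v‖ → h (x, v) = 0

section

variable {U V W : Type*} [NormedAddCommGroup U] [InnerProductSpace ℝ U]
  [NormedAddCommGroup V] [InnerProductSpace ℝ V]  [NormedAddCommGroup W] [InnerProductSpace ℝ W]

theorem BallSupp.suppIn {h : BFun U V} {R s : ℝ} (hh : BallSupp R h) (hs : R ≤ s) : SuppIn s h :=
  fun x v hv => hh x v (hv.elim
    (fun h => hs.trans (h.trans (EPlus.abs_le_norm_mk x v)))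
    (fun h => hs.trans (h.trans (EPlus.norm_le_norm_mk x v))))

theorem EPlus.norm_mk_norm_mk (ι : U →ₗᵢ[ℝ] V) (x : ℝ) (N : V) (u : U) (hN : ⟪N, ι u⟫_ℝ = 0) :
    ‖EPlus.mk ‖EPlus.mk x N‖ u‖ = ‖EPlus.mk x (N + ι u)‖ := by
  rw [EPlus.norm_mk, EPlus.norm_mk, EPlus.norm_mk, Real.sq_sqrt (by positivity),
    norm_add_sq_real, hN, LinearIsometry.norm_map]
  congr 1
  ring

/-- Balls of ℝ e ⊕ U, unlike the products (−s, s) × D_s, behave well under Bott maps, because ‖x e +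
N y‖ e + pr y has the same length as x e + y. This is how compatible sequences are produced. -/
theorem BallSupp.bottMap {h : BFun U U} {R : ℝ} (hh : BallSupp R h) (ι : U →ₗᵢ[ℝ] V) (pr : V → U)
    (N : V → V) (hN : ∀ y u, ⟪N y, ι u⟫_ℝ = 0) (hy : ∀ y, N y + ι (pr y) = y) :
    BallSupp R (bottMap ι pr N hN h) := by
  intro x y hR
  have h0 : h (‖EPlus.mk x (N y)‖, pr y) = 0 := by
    refine hh _ _ ?_
    rwa [EPlus.norm_mk_norm_mk ι x (N y) (pr y) (hN y _), hy]
  exact (congrArg (Cl.map (bottIsometry ι (EPlus.mk x (N y)) (hN y))) h0).trans (map_zero _)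

/-- Every element of the algebra `S𝔠(E)` is a limit of elements supported in balls. -/
theorem SCliff.exists_ballSupp [FiniteDimensional ℝ U] {h : BFun U V} (hh : h ∈ SCliff U V) {ε : ℝ}
    (hε : 0 < ε) : ∃ R, ∃ h' ∈ SCliff U V, BallSupp R h' ∧ ‖h - h'‖ ≤ ε := by
  obtain ⟨R, hR⟩ := SCliff.exists_norm_le hh hε
  -- The cut-off depends only on the length of x e + v; it is even in x and so respects the grading.
  -- It equals 1 for length at most 2R, and beyond that |x| ≥ R or ‖v‖ ≥ R, where `h` is small.
  let χ : ℝ × U → ℝ := fun p => max 0 (min 1 (2 * R + 1 - ‖EPlus.mk p.1 p.2‖))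
  have hχ0 : ∀ p, 0 ≤ χ p := fun p => le_max_left _ _
  have hχ1 : ∀ p, χ p ≤ 1 := fun p => max_le zero_le_one (min_le_left _ _)
  have hχc : Continuous χ := by
    have : Continuous fun p : ℝ × U => EPlus.mk p.1 p.2 := WithLp.prod_continuous_toLp 2 ℝ U
    fun_prop
  have hle : ∀ p, ‖(χ p : ℂ) • h p‖ ≤ ‖h p‖ := fun p => by
    rw [norm_smul, Complex.norm_real, Real.norm_of_nonneg (hχ0 p)]
    exact mul_le_of_le_one_left (norm_nonneg _) (hχ1 p)
  let h' : BFun U V := ⟨fun p => (χ p : ℂ) • h p, memℓp_infty ⟨‖h‖, by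
    rintro _ ⟨p, rfl⟩
    exact (hle p).trans (lp.norm_apply_le_norm (by simp) h _)⟩⟩
  have hh' : ∀ p, h' p = (χ p : ℂ) • h p := fun p => rfl
  refine ⟨2 * R + 1, h', ⟨?_, ?_, fun x v => ?_⟩, fun x v hxv => ?_, ?_⟩
  · exact (Complex.continuous_ofReal.comp hχc).smul hh.1
  · exact squeeze_zero_norm hle (tendsto_zero_iff_norm_tendsto_zero.1 hh.2.1)
  · have : χ (-x, v) = χ (x, v) := by
      simp only [χ, EPlus.norm_mk, neg_sq]
    rw [hh', hh', this, hh.2.2, map_smul]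
  · have : χ (x, v) = 0 := by
      refine max_eq_left ((min_le_right _ _).trans ?_)
      change 2 * R + 1 - ‖EPlus.mk x v‖ ≤ 0
      linarith
    rw [hh', this, Complex.ofReal_zero, zero_smul]
  · refine lp.norm_le_of_forall_le hε.le fun p => ?_
    have h1 : (h - h') p = ((1 - χ p : ℝ) : ℂ) • h p := by
      change h p - (χ p : ℂ) • h p = _
      rw [Complex.ofReal_sub, sub_smul, Complex.ofReal_one, one_smul]
    rw [h1, norm_smul, Complex.norm_real, Real.norm_of_nonneg (by linarith [hχ1 p])]
    by_cases hp : 2 * R ≤ ‖EPlus.mk p.1 p.2‖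
    · have h2 : ‖h (p.1, p.2)‖ ≤ ε := by
        refine hR _ _ ?_
        by_contra! hc
        have := EPlus.norm_mk_le p.1 p.2
        linarith [hc.1, hc.2]
      calc _ ≤ 1 * ‖h p‖ := by gcongr; linarith [hχ0 p]
        _ ≤ ε := by rw [one_mul]; exact h2
    · have : χ p = 1 := by
        have h2 : 1 ≤ 2 * R + 1 - ‖EPlus.mk p.1 p.2‖ := by linarith [not_le.1 hp]
        change max 0 (min 1 (2 * R + 1 - ‖EPlus.mk p.1 p.2‖)) = 1
        rw [min_eq_left h2, max_eq_right zero_le_one]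
      rw [this, sub_self, zero_mul]
      exact hε.le

end

variable {H : Type*} [NormedAddCommGroup H] [InnerProductSpace ℝ H]

variable {E W : Submodule ℝ H} [FiniteDimensional ℝ E] [FiniteDimensional ℝ W]

theorem BallSupp.bott {E₁ E₂ : Submodule ℝ H} [FiniteDimensional ℝ E₁] (h : E₁ ≤ E₂)
    {u : BFun E₁ E₁} {R : ℝ} (hu : BallSupp R u) : BallSupp R (bott h u) :=
  hu.bottMap (inclIso h) _ _ _ fun _ => sub_add_cancel _ _

theorem sub_adjoint_inner (J : E →ₗᵢ[ℝ] W) (y : W) (u : E) :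
    ⟪y - J (J.toContinuousLinearMap.adjoint y), J u⟫_ℝ = 0 := by
  have h1 : ⟪y, J u⟫_ℝ = ⟪J.toContinuousLinearMap.adjoint y, u⟫_ℝ :=
    (ContinuousLinearMap.adjoint_inner_left J.toContinuousLinearMap u y).symm
  rw [inner_sub_left, LinearIsometry.inner_map_map, h1, sub_self]

/-- The map `S𝔠(E) → S𝔠(W)` given by an isometry `E → W`. -/
def transport (J : E →ₗᵢ[ℝ] W) : BFun E E → BFun W W :=
  bottMap J (fun y => J.toContinuousLinearMap.adjoint y)
    (fun y => y - J (J.toContinuousLinearMap.adjoint y)) (sub_adjoint_inner J)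

theorem transport_mem (J : E →ₗᵢ[ℝ] W) {u : BFun E E} (hu : u ∈ SCliff E E) :
    transport J u ∈ SCliff W W := by
  have hc : Continuous fun y : W => J.toContinuousLinearMap.adjoint y :=
    ContinuousLinearMap.continuous _
  refine SCliff.bottMap_mem (K := 1) hu J _ hc (continuous_id.sub (J.continuous.comp hc))
    fun y => ?_
  rw [one_mul]
  have := norm_add_le (y - J (J.toContinuousLinearMap.adjoint y))
    (J (J.toContinuousLinearMap.adjoint y))
  rwa [sub_add_cancel, LinearIsometry.norm_map] at this

theorem BallSupp.transport (J : E →ₗᵢ[ℝ] W) {u : BFun E E} {R : ℝ} (hu : BallSupp R u) :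
    BallSupp R (transport J u) :=
  hu.bottMap J _ _ (sub_adjoint_inner J) fun _ => sub_add_cancel _ _

/-- The vector `P_E z - J^* P_W z` is small for isometries `J : E → W` close to the inclusion. -/
theorem norm_proj_sub_adjoint_le (J : E →ₗᵢ[ℝ] W) {δ : ℝ} (hδ : 0 ≤ δ)
    (hJ : ∀ e : E, ‖(J e : H) - e‖ ≤ δ * ‖e‖) (z : H) :
    ‖E.orthogonalProjectionOnto z -
      J.toContinuousLinearMap.adjoint (W.orthogonalProjectionOnto z)‖ ≤ δ * ‖z‖ := by
  set a := E.orthogonalProjectionOnto z -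
    J.toContinuousLinearMap.adjoint (W.orthogonalProjectionOnto z) with ha
  have h1 : ⟪a, a⟫_ℝ = ⟪z, (a : H) - J a⟫_ℝ := by
    change ⟪E.orthogonalProjectionOnto z -
      J.toContinuousLinearMap.adjoint (W.orthogonalProjectionOnto z), a⟫_ℝ = _
    rw [inner_sub_left, inner_sub_right (z : H), ContinuousLinearMap.adjoint_inner_left]
    congr 1
    · exact Submodule.inner_orthogonalProjectionOnto_eq_of_mem_right a z
    · exact Submodule.inner_orthogonalProjectionOnto_eq_of_mem_right (J a) z
  rw [real_inner_self_eq_norm_sq] at h1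
  have h2 : ⟪z, (a : H) - J a⟫_ℝ ≤ ‖z‖ * (δ * ‖a‖) := by
    refine (real_inner_le_norm _ _).trans ?_
    rw [norm_sub_rev]
    gcongr
    exact hJ a
  by_cases h0 : ‖a‖ = 0
  · rw [h0]; positivity
  · have : 0 < ‖a‖ := lt_of_le_of_ne (norm_nonneg _) (Ne.symm h0)
    nlinarith

/-- An isometry `E → W` close to the inclusion changes the classes of elements of `S𝔠(E)` only
little. -/
theorem exists_transport_sub_le {u : BFun E E} (hu : u ∈ SCliff E E) {ε : ℝ} (hε : 0 < ε) :
    ∃ δ > 0, ∀ (W : Submodule ℝ H) [FiniteDimensional ℝ W] (J : E →ₗᵢ[ℝ] W),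
      (∀ e : E, ‖(J e : H) - e‖ ≤ δ * ‖e‖) →
        ‖bott (le_sup_left : E ≤ E ⊔ W) u -
          bott (le_sup_right : W ≤ E ⊔ W) (transport J u)‖ ≤ ε := by
  obtain ⟨δ, hδ, key⟩ := SCliff.exists_bottFibre_sub_le hu hε
  refine ⟨δ / 2, by positivity, fun W _ J hJ => lp.norm_le_of_forall_le hε.le ?_⟩
  rintro ⟨x, z⟩
  change ‖bott (le_sup_left : E ≤ E ⊔ W) u (x, z) - bott (le_sup_right : W ≤ E ⊔ W)
    (transport J u) (x, z)‖ ≤ ε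
  set ι₁ := inclIso (le_sup_left : E ≤ E ⊔ W)
  set ι₂ := inclIso (le_sup_right : W ≤ E ⊔ W)
  set p := E.orthogonalProjectionOnto (z : H) with hp
  set q := W.orthogonalProjectionOnto (z : H)
  set q' := J.toContinuousLinearMap.adjoint q
  -- By transitivity, the Bott map after the transport is one fibrewise Bott map, with isometry ι₂ J
  -- and argument J^* P_W z. It differs from that of u by a small perturbation.
  have h2 := bottFibre_bottFibre ι₂ J x (z - ι₂ q) (q - J q')
    (fun v => sub_orthogonalProjectionOnto_inner (z : H) v) (sub_adjoint_inner J q)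
    (fun t => u (t, q'))
  have hpq : ‖p - q'‖ ≤ δ / 2 * ‖(z : H)‖ := norm_proj_sub_adjoint_le J (by positivity) hJ z
  -- The errors are proportional to ‖z‖; this bound brings them into the form admitted by the
  -- uniform estimate.
  have hz : ‖(z : H)‖ ≤ ‖EPlus.mk x (z - ι₁ p)‖ + ‖p‖ := by
    have h3 := norm_add_le (z - ι₁ p) (ι₁ p)
    rw [sub_add_cancel, LinearIsometry.norm_map] at h3
    exact h3.trans (add_le_add_left (EPlus.norm_le_norm_mk _ _) _)
  have hι : ∀ e : E, ‖ι₁ e - ι₂.comp J e‖ ≤ δ / 2 * ‖e‖ := fun e => by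
    rw [norm_sub_rev]
    exact hJ e
  have h1 := key _ ι₁ (ι₂.comp J) (EPlus.mk x (z - ι₁ p))
    (EPlus.mk x ((z - ι₂ q) + ι₂ (q - J q')))
    (fun v => sub_orthogonalProjectionOnto_inner (z : H) v)
    (inner_add_comp_eq_zero (fun v => sub_orthogonalProjectionOnto_inner (z : H) v)
      (sub_adjoint_inner J q)) p q' (fun e => (hι e).trans (by gcongr; linarith)) ?_ ?_
  · rw [← h2] at h1
    exact h1
  · rw [EPlus.mk_sub_mk, sub_self]
    refine (EPlus.norm_inr _).trans_le ?_
    have h3 : z - ι₁ p - (z - ι₂ q + ι₂ (q - J q')) =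
        -(ι₁ p - ι₂.comp J p) - ι₂ (J (p - q')) := by
      change _ = -(ι₁ p - ι₂ (J p)) - ι₂ (J (p - q'))
      simp only [map_sub]
      abel
    rw [h3]
    refine (norm_sub_le _ _).trans ?_
    rw [norm_neg, LinearIsometry.norm_map, LinearIsometry.norm_map]
    have := hι p
    have h4 := norm_nonneg (EPlus.mk x (z - ι₁ p))
    have h5 : δ / 2 * ‖(z : H)‖ ≤ δ / 2 * (‖EPlus.mk x (z - ι₁ p)‖ + ‖p‖) := by gcongr
    nlinarith [norm_nonneg p]
  · have h4 := norm_nonneg (EPlus.mk x (z - ι₁ p))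
    have h5 : δ / 2 * ‖(z : H)‖ ≤ δ / 2 * (‖EPlus.mk x (z - ι₁ p)‖ + ‖p‖) := by gcongr
    nlinarith [norm_nonneg p]

/-- If the projection to `W` is close to the identity on `E`, there is an isometry `E → W` close
to the inclusion. -/
theorem exists_isometry_near {η : ℝ} (hη : η ≤ 1 / 2)
    (h : ∀ e : E, ‖W.starProjection (e : H) - e‖ ≤ η * ‖e‖) :
    ∃ J : E →ₗᵢ[ℝ] W, ∀ e : E, ‖(J e : H) - e‖ ≤ 2 * η * ‖e‖ := by
  let A : E →L[ℝ] W := W.orthogonalProjectionOnto ∘L E.subtypeL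
  have hA : ∃ c > 0, ∀ x, c * ‖x‖ ≤ ‖A x‖ := by
    refine ⟨1 / 2, by norm_num, fun e => ?_⟩
    have h1 := h e
    have h2 := norm_sub_norm_le (e : H) (W.starProjection (e : H))
    rw [norm_sub_rev] at h2
    have h3 : ‖A e‖ = ‖W.starProjection (e : H)‖ := rfl
    have h4 : ‖e‖ = ‖(e : H)‖ := rfl
    have h5 : η * ‖e‖ ≤ 1 / 2 * ‖e‖ := by gcongr
    rw [h3]
    linarith
  refine ⟨polarIsometry A hA, fun e => ?_⟩
  have hadj : ∀ y : W, A.adjoint y = E.orthogonalProjectionOnto (y : H) := fun y => by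
    refine ext_inner_left ℝ fun v => ?_
    rw [ContinuousLinearMap.adjoint_inner_right]
    change ⟪W.orthogonalProjectionOnto (v : H), y⟫_ℝ = _
    rw [Submodule.inner_orthogonalProjectionOnto_eq_of_mem_right,
      Submodule.inner_orthogonalProjectionOnto_eq_of_mem_left]
  have h1 := norm_polarIsometry_sub_le A hA e
  -- Here A* A = P_E P_W on E, so A is almost isometric and its polar isometry lies within η of A.
  -- The factor 2 comes from A itself being within η of the inclusion.
  have h2 : e - A.adjoint (A e) = -E.orthogonalProjectionOnto (W.starProjection (e : H) - e) := by
    rw [map_sub, Submodule.orthogonalProjectionOnto_mem_subspace_eq_self, neg_sub, hadj]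
    rfl
  rw [h2, norm_neg] at h1
  have h3 := h1.trans ((Submodule.norm_orthogonalProjectionOnto_apply_le E _).trans (h e))
  have h4 : ((polarIsometry A hA e : W) : H) - e =
      ((polarIsometry A hA e - A e : W) : H) + (W.starProjection (e : H) - e) := by
    rw [Submodule.coe_sub]
    change _ = _ - W.starProjection (e : H) + _
    abel
  rw [h4]
  refine (norm_add_le _ _).trans ?_
  have := h e
  have h5 : ‖((polarIsometry A hA e - A e : W) : H)‖ ≤ η * ‖e‖ := h3
  linarith

/-- The values on a finite orthonormal basis control the operator norm, so pointwise convergence is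
uniform on the unit ball of E. -/
theorem eventually_norm_le_of_tendsto {ι G : Type*} [NormedAddCommGroup G] [NormedSpace ℝ G]
    {f : Filter ι} (A : ι → E →L[ℝ] G) (hA : ∀ e, Tendsto (fun i => A i e) f (𝓝 0)) {η : ℝ}
    (hη : 0 < η) : ∀ᶠ i in f, ∀ e, ‖A i e‖ ≤ η * ‖e‖ := by
  let b := stdOrthonormalBasis ℝ E
  have h1 : Tendsto (fun i => ∑ k, ‖A i (b k)‖) f (𝓝 0) := by
    have : Tendsto (fun i => ∑ k, ‖A i (b k)‖) f (𝓝 (∑ k, 0)) :=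
      tendsto_finsetSum _ fun k _ => tendsto_zero_iff_norm_tendsto_zero.1 (hA (b k))
    simpa using this
  filter_upwards [h1.eventually (ge_mem_nhds hη)] with i hi e
  conv_lhs => rw [← b.sum_repr e]
  rw [map_sum]
  refine (norm_sum_le _ _).trans ?_
  calc ∑ k, ‖A i (b.repr e k • b k)‖ ≤ ∑ k, ‖e‖ * ‖A i (b k)‖ := by
        refine Finset.sum_le_sum fun k _ => ?_
        rw [map_smul, norm_smul]
        gcongr
        rw [← b.repr.norm_map e]
        exact PiLp.norm_apply_le _ _
    _ = (∑ k, ‖A i (b k)‖) * ‖e‖ := by rw [← Finset.mul_sum, mul_comm]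
    _ ≤ η * ‖e‖ := by gcongr

/-- The cut-off is made first, so the radius R does not depend on j. In a finite approximation j can
then be taken with s_j ≥ R, which makes the transported element compatible. -/
theorem exists_dense_approx [CompleteSpace H] {H' : Type*} (F : H' → H) (W : ℕ → Submodule ℝ H)
    [∀ i, FiniteDimensional ℝ (W i)] (hW : Monotone W) (hd : Dense (⋃ i, (W i : Set H)))
    {u : BFun E E} (hu : u ∈ SCliff E E) {ε : ℝ} (hε : 0 < ε) :
    ∃ R, ∀ᶠ j in atTop, ∃ v ∈ SCliff (W j) (W j), BallSupp R v ∧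
      ‖hubHom F E u - hubHom F (W j) v‖ ≤ ε := by
  obtain ⟨R, u', hu', hR, huu⟩ := SCliff.exists_ballSupp hu (half_pos hε)
  obtain ⟨δ, hδ, key⟩ := exists_transport_sub_le hu' (half_pos hε)
  refine ⟨R, ?_⟩
  have hd' : (⊤ : Submodule ℝ H) ≤ (⨆ i, W i).topologicalClosure := by
    intro x _
    have h1 : ((⋃ i, (W i : Set H))) ⊆ ((⨆ i, W i : Submodule ℝ H) : Set H) :=
      Set.iUnion_subset fun i => le_iSup W i
    exact closure_mono h1 (hd x)
  have h1 := eventually_norm_le_of_tendsto (E := E) (f := atTop)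
    (fun j => (W j).starProjection ∘L E.subtypeL - E.subtypeL) (fun e => by
      have := (Submodule.starProjection_tendsto_self W hW (e : H) hd').sub_const (e : H)
      rw [sub_self] at this
      exact this) (η := min (δ / 2) (1 / 2)) (by positivity)
  filter_upwards [h1] with j hj
  obtain ⟨J, hJ⟩ := exists_isometry_near (E := E) (W := W j) (min_le_right _ _) hj
  refine ⟨transport J u', transport_mem J hu', hR.transport J, ?_⟩
  have h2 : ‖hubHom F E u - hubHom F E u'‖ ≤ ε / 2 := by
    rw [← map_sub]
    exact (norm_hubHom_le F _).trans huu
  have h3 := (norm_hubHom_sub_hubHom_le F u' (transport J u')).trans (key (W j) J fun e =>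
    (hJ e).trans (by gcongr; linarith [min_le_left (δ / 2) (1 / 2)]))
  refine (norm_sub_le_norm_sub_add_norm_sub _ (hubHom F E u') _).trans ?_
  linarith

end Density

/-! ### Support conditions under the algebra operations. -/

section Supp

variable {X V : Type*} [NormedAddCommGroup X] [NormedAddCommGroup V] [InnerProductSpace ℝ V]

theorem SuppIn.zero (s : ℝ) : SuppIn s (0 : BFun X V) := fun _ _ _ => rfl

theorem SuppIn.add {s : ℝ} {g h : BFun X V} (hg : SuppIn s g) (hh : SuppIn s h) :
    SuppIn s (g + h) := fun x v hv => by
  change g (x, v) + h (x, v) = 0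
  rw [hg x v hv, hh x v hv, add_zero]

theorem SuppIn.mul {s : ℝ} {g h : BFun X V} (hg : SuppIn s g) :
    SuppIn s (g * h) := fun x v hv => by
  change g (x, v) * h (x, v) = 0
  rw [hg x v hv, zero_mul]

theorem SuppIn.smul {s : ℝ} (c : ℂ) {h : BFun X V} (hh : SuppIn s h) :
    SuppIn s (c • h) := fun x v hv => by
  change c • h (x, v) = 0
  rw [hh x v hv, smul_zero]

theorem SuppIn.star {s : ℝ} {h : BFun X V} (hh : SuppIn s h) :
    SuppIn s (star h) := fun x v hv => by
  change Star.star (h (x, v)) = 0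
  rw [hh x v hv, star_zero]

end Supp

/-! ### Compatible sequences of a finite approximation as a Bott system. -/

namespace FinApprox

variable {H' H : Type*} [NormedAddCommGroup H'] [InnerProductSpace ℝ H'] [CompleteSpace H']
  [NormedAddCommGroup H] [InnerProductSpace ℝ H] [CompleteSpace H]

variable {F : H' → H} {l : H' ≃L[ℝ] H} (D : FinApprox F l)

/-- The elements that define compatible sequences. -/
def compatible (i : ℕ) : NonUnitalStarSubalgebra ℂ (BFun (D.W i) (D.W i)) where
  carrier := {u | D.Compatible i u}
  zero_mem' := ⟨zero_mem _, SuppIn.zero _, fun k h => by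
    rw [← bottHom_apply, map_zero]
    exact SuppIn.zero _⟩
  add_mem' := by
    rintro u v ⟨hu, hu', hu''⟩ ⟨hv, hv', hv''⟩
    refine ⟨add_mem hu hv, hu'.add hv', fun k h => ?_⟩
    rw [← bottHom_apply, map_add]
    exact (hu'' k h).add (hv'' k h)
  mul_mem' := by
    rintro u v ⟨hu, hu', hu''⟩ ⟨hv, hv', hv''⟩
    refine ⟨mul_mem hu hv, hu'.mul, fun k h => ?_⟩
    rw [← bottHom_apply, map_mul]
    exact (hu'' k h).mul
  smul_mem' := by
    rintro c u ⟨hu, hu', hu''⟩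
    refine ⟨SMulMemClass.smul_mem c hu, hu'.smul c, fun k h => ?_⟩
    rw [← bottHom_apply, map_smul]
    exact (hu'' k h).smul c
  star_mem' := by
    rintro u ⟨hu, hu', hu''⟩
    refine ⟨star_mem hu, hu'.star, fun k h => ?_⟩
    rw [← bottHom_apply, map_star]
    exact (hu'' k h).star

theorem Compatible.bott {i j : ℕ} (h : i ≤ j) {u : BFun (D.W i) (D.W i)} (hu : D.Compatible i u) :
    D.Compatible j (bott (D.mono h) u) :=
  ⟨SCliff.bott_mem _ hu.1, hu.2.2 j h, fun k hk => by
    rw [bott_bott]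
    exact hu.2.2 k (h.trans hk)⟩

/-- Bott maps preserve ball supports, and the radii s_k increase. -/
theorem Compatible.of_ballSupp {i : ℕ} {u : BFun (D.W i) (D.W i)} (hu : u ∈ SCliff (D.W i) (D.W i))
    {R : ℝ} (hR : BallSupp R u) (hs : R ≤ D.s i) : D.Compatible i u :=
  ⟨hu, hR.suppIn hs, fun _ h => (hR.bott _).suppIn (hs.trans (D.s_mono.monotone h))⟩

/-- The homomorphism `u ↦ [u]`. -/
def seqHom (i : ℕ) : BFun (D.W i) (D.W i) →⋆ₙₐ[ℂ] D.Seqs :=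
  (AsymAlg.mkHom D.filter (fun p : Σ i, ℝ × D.W' i => Cl (EPlus (D.W' p.1)))).comp
  (famHom (X := fun i => D.W' i) (V := fun i => D.W' i) (fun k => i ≤ k)
    (fun k h => (pullBackHom (polarUnitary (D.lin k)).symm.toLinearIsometry (D.map k)).comp
      (bottHom (D.mono h)))
    (fun _ h u => (norm_pullBack_le _ _ _).trans (norm_bott_le (D.mono h) u)))

theorem seqHom_apply (i : ℕ) (u : BFun (D.W i) (D.W i)) :
    D.seqHom i u = AsymAlg.mk _ _ (D.seq i u) := rfl

theorem seq_apply {i k : ℕ} (h : i ≤ k) (u : BFun (D.W i) (D.W i)) (x : ℝ) (v : D.W' k) :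
    D.seq i u ⟨k, x, v⟩ = D.pull k (bott (D.mono h) u) (x, v) := dif_pos h

theorem norm_seq_apply {i k : ℕ} (h : i ≤ k) (u : BFun (D.W i) (D.W i)) (x : ℝ) (v : D.W' k) :
    ‖D.seq i u ⟨k, x, v⟩‖ = profile (D.W i) u x (D.map k v) := by
  rw [D.seq_apply h]
  exact (Cl.norm_map _ _).trans (norm_bott_apply (D.mono h) u x (D.map k v))

theorem seqHom_bott {i j : ℕ} (h : i ≤ j) (u : BFun (D.W i) (D.W i)) :
    D.seqHom j (InducedClifford.bott (D.mono h) u) = D.seqHom i u := by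
  rw [seqHom_apply, seqHom_apply]
  refine AsymAlg.mk_eq_mk_of_eventually ?_
  rw [eventually_filter]
  intro k
  filter_upwards [eventually_ge_atTop j] with m hm x v _ _
  rw [D.seq_apply hm, D.seq_apply (h.trans hm), bott_bott]

/-- The k-th member of [u] has norm profile(F_k v) at v. Since F_k → F uniformly on each ball and
profiles are uniformly continuous, only the values profile(F v) on the union of the balls D'_{r_j}
matter. This union is dense, and F is continuous. -/
theorem norm_seqHom_le_iff (hF : Continuous F) (i : ℕ) {u : BFun (D.W i) (D.W i)}
    (hu : u ∈ SCliff (D.W i) (D.W i)) {c : ℝ} (hc : 0 ≤ c) :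
    ‖D.seqHom i u‖ ≤ c ↔ ∀ x v, profile (D.W i) u x (F v) ≤ c := by
  rw [seqHom_apply, D.norm_mk_le_iff _ hc]
  constructor
  · intro h x v
    refine le_of_forall_pos_le_add fun ε hε => ?_
    obtain ⟨δ, hδ, hp⟩ := SCliff.exists_profile_sub_le hu (show 0 < ε / 3 by positivity)
    have h1 : ∀ᶠ v' in 𝓝 v, ‖F v - F v'‖ ≤ δ := by
      filter_upwards [(Metric.continuous_iff'.1 hF) v δ hδ] with v' hv'
      rw [← dist_eq_norm, dist_comm]
      exact hv'.le
    -- The point v is moved into some W'_j, with j so large that also ‖v'‖ < r_j, and F(v') is then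
    -- replaced by F_k(v'). The three errors of ε/3 come from F(v), from F_k(v') and from the norm
    -- bound.
    obtain ⟨v', hv', hvF⟩ := D.dense.inter_nhds_nonempty h1
    obtain ⟨j₀, hj₀⟩ := Set.mem_iUnion.1 hv'
    obtain ⟨j, hj, hjr⟩ := ((eventually_ge_atTop j₀).and
      (D.r_tendsto.eventually (eventually_gt_atTop ‖v'‖))).exists
    have hvj : v' ∈ D.W' j := D.mono' hj hj₀
    obtain ⟨k, hk, hk', hki, hkj⟩ := ((h (ε / 3) (by positivity) j).and
      ((D.map_tendsto j δ hδ).and ((eventually_ge_atTop i).and (eventually_ge_atTop j)))).exists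
    have h2 := hk x (inclIso (D.mono' hkj) ⟨v', hvj⟩) hvj hjr
    rw [D.norm_seq_apply hki] at h2
    have h3 := hp x _ _ (hk' hkj ⟨v', hvj⟩ hjr)
    have h4 := hp x _ _ hvF
    linarith
  · intro h ε hε j
    obtain ⟨δ, hδ, hp⟩ := SCliff.exists_profile_sub_le hu hε
    filter_upwards [D.map_tendsto j δ hδ, eventually_ge_atTop i, eventually_ge_atTop j] with
      k hk hki hkj x v hv hr
    rw [D.norm_seq_apply hki]
    have h1 := hk hkj ⟨v, hv⟩ hr
    rw [norm_sub_rev] at h1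
    exact (hp x _ _ h1).trans (by gcongr; exact h x v)

/-- The image under l of the dense union of the W'_j is dense, and each l v' with v' ∈ W'_j is a
limit of vectors l_k v' ∈ W_k. -/
theorem dense_target : Dense (⋃ i, (D.W i : Set H)) := by
  intro y
  rw [Metric.mem_closure_iff]
  intro ε hε
  obtain ⟨v, hv⟩ := l.surjective y
  have h1 : ∀ᶠ v' in 𝓝 v, dist (l v') (l v) < ε / 2 :=
    (Metric.continuous_iff'.1 l.continuous) v _ (half_pos hε)
  obtain ⟨v', hv', hvl⟩ := D.dense.inter_nhds_nonempty h1
  obtain ⟨j, hj⟩ := Set.mem_iUnion.1 hv'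
  obtain ⟨k, hk, hkj⟩ := ((D.lin_tendsto j (ε / (2 * (‖v'‖ + 1))) (by positivity)).and
    (eventually_ge_atTop j)).exists
  refine ⟨_, Set.mem_iUnion.2 ⟨k, (D.lin k (inclIso (D.mono' hkj) ⟨v', hj⟩)).2⟩, ?_⟩
  have h2 := hk hkj ⟨v', hj⟩
  have h3 : ε / (2 * (‖v'‖ + 1)) * ‖v'‖ < ε / 2 := by
    have : ε / (2 * (‖v'‖ + 1)) * ‖v'‖ = ε / 2 * (‖v'‖ / (‖v'‖ + 1)) := by
      field_simp
    rw [this]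
    have h4 : ‖v'‖ / (‖v'‖ + 1) < 1 := by
      rw [div_lt_one (by positivity)]
      linarith
    nlinarith
  rw [← hv, dist_comm]
  refine (dist_triangle_left _ _ (l v')).trans_lt ?_
  rw [dist_eq_norm (l v')]
  have h5 : ‖l v' - D.lin k (inclIso (D.mono' hkj) ⟨v', hj⟩)‖ < ε / 2 := h2.trans_lt h3
  have h6 : dist (l v') (l v) < ε / 2 := hvl
  linarith

/-- The directed family of the compatible sequences of a finite approximation. -/
def system (hF : Continuous F) : BottSystem F D.Seqs ℕ where
  E := D.W
  finite_dim i := inferInstance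
  mono := D.mono
  S := D.compatible
  S_le _ _ hu := hu.1
  bott_mem _ _ h _ hu := Compatible.bott D h hu
  hom := D.seqHom
  hom_bott _ _ h u _ := D.seqHom_bott h u
  norm_le_iff i _ hu _ hc := D.norm_seqHom_le_iff hF i hu.1 hc
  dense E₀ _ u hu ε hε := by
    obtain ⟨R, hR⟩ := exists_dense_approx F D.W D.mono D.dense_target hu hε
    obtain ⟨j, ⟨v, hv, hvR, hle⟩, hj⟩ := (hR.and (D.s_tendsto.eventually (eventually_ge_atTop R))).exists
    exact ⟨j, v, Compatible.of_ballSupp D hv hvR hj, hle⟩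

theorem system_hom_mem (hF : Continuous F) (i : ℕ) (u) (hu : u ∈ (D.system hF).S i) :
    (D.system hF).hom i u ∈
      cstarGen {a : D.Seqs | ∃ i₀ u, D.Compatible i₀ u ∧ a = AsymAlg.mk _ _ (D.seq i₀ u)} :=
  subset_cstarGen _ ⟨i, u, hu, rfl⟩

theorem subset_closure_system (hF : Continuous F) :
    {a : D.Seqs | ∃ i₀ u, D.Compatible i₀ u ∧ a = AsymAlg.mk _ _ (D.seq i₀ u)} ⊆
      closure {a | ∃ i, ∃ u ∈ (D.system hF).S i, (D.system hF).hom i u = a} := by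
  refine Set.Subset.trans ?_ subset_closure
  rintro _ ⟨i, u, hu, rfl⟩
  exact ⟨i, u, hu, rfl⟩

end FinApprox

/-! ### Uniqueness of positive square roots on finite-dimensional invariant subspaces -/

section Sqrt

set_option linter.unusedSectionVars false

variable {X S : Type*} [NormedAddCommGroup X] [InnerProductSpace ℝ X] [CompleteSpace X]
  [NormedAddCommGroup S] [InnerProductSpace ℝ S] [FiniteDimensional ℝ S] [CompleteSpace S]

/-- On an eigenvector b of Q with eigenvalue μ > 0 one has (P + μ)(P − μ) ι b = 0, and P + μ is
injective because P is positive. The eigenvectors of Q span S. -/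
theorem sqrt_comp_eq {P : X →L[ℝ] X} (hP : P.IsPositive) {Q : S ≃L[ℝ] S}
    (hQ : (Q : S →L[ℝ] S).IsPositive) (ι : S →ₗ[ℝ] X) (h : ∀ x, P (P (ι x)) = ι (Q (Q x))) (x : S) :
    P (ι x) = ι (Q x) := by
  have hsymm : (Q : S →L[ℝ] S).toLinearMap.IsSymmetric := hQ.isSymmetric
  let b := hsymm.eigenvectorBasis rfl
  have key : P.toLinearMap ∘ₗ ι = ι ∘ₗ (Q : S →L[ℝ] S).toLinearMap := by
    refine b.toBasis.ext fun k => ?_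
    rw [OrthonormalBasis.coe_toBasis]
    set μ : ℝ := hsymm.eigenvalues rfl k
    have hk : Q (b k) = μ • b k := hsymm.apply_eigenvectorBasis rfl k
    have hb : b k ≠ 0 := fun h0 => by
      have := b.norm_eq_one k
      rw [h0, norm_zero] at this
      exact zero_ne_one this
    have hμ : 0 < μ := by
      have h1 : 0 ≤ ⟪Q (b k), b k⟫_ℝ := hQ.inner_nonneg_left (b k)
      rw [hk, inner_smul_left, real_inner_self_eq_norm_sq, b.norm_eq_one] at h1
      have h2 : μ ≠ 0 := fun h0 => hb (Q.injective (by rw [hk, h0, zero_smul, map_zero]))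
      have h3 : 0 ≤ μ := by simpa using h1
      exact lt_of_le_of_ne h3 h2.symm
    change P (ι (b k)) = ι (Q (b k))
    rw [hk, map_smul]
    set d := P (ι (b k)) - μ • ι (b k) with hd
    -- A nonzero d would be an eigenvector of the positive operator P with negative eigenvalue.
    have hPd : P d = -(μ • d) := by
      rw [hd, map_sub, map_smul, h, hk, map_smul, hk, map_smul, map_smul]
      rw [smul_sub]
      abel
    have h4 : 0 ≤ ⟪P d, d⟫_ℝ := hP.inner_nonneg_left d
    rw [hPd, inner_neg_left, inner_smul_left, real_inner_self_eq_norm_sq] at h4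
    have h5 : ‖d‖ ^ 2 ≤ 0 := by
      have : μ * ‖d‖ ^ 2 ≤ 0 := by simpa using h4
      by_contra hc
      nlinarith
    have h6 : d = 0 := by
      rw [← norm_eq_zero]
      exact pow_eq_zero_iff two_ne_zero |>.1 (le_antisymm h5 (sq_nonneg _))
    exact sub_eq_zero.1 h6
  exact LinearMap.congr_fun key x

/-- The isometry of the polar decomposition of a restriction of `A`. -/
theorem polarIsometry_comp_eq {Y Z : Type*} [NormedAddCommGroup Y] [InnerProductSpace ℝ Y]
    [CompleteSpace Y] [NormedAddCommGroup Z] [InnerProductSpace ℝ Z] [CompleteSpace Z]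
    (A : X →L[ℝ] Y) (hA : ∃ c > 0, ∀ x, c * ‖x‖ ≤ ‖A x‖)
    (B : S →L[ℝ] Z) (hB : ∃ c > 0, ∀ x, c * ‖x‖ ≤ ‖B x‖) (ι : S →ₗ[ℝ] X) (κ : Z →ₗ[ℝ] Y)
    (h₁ : ∀ x, A.adjoint (A (ι x)) = ι (B.adjoint (B x))) (h₂ : ∀ x, A (ι x) = κ (B x)) (x : S) :
    polarIsometry A hA (ι x) = κ (polarIsometry B hB x) := by
  obtain ⟨z, rfl⟩ := (absOp B hB).surjective x
  have h3 := sqrt_comp_eq (absOp_isPositive A hA) (absOp_isPositive B hB) ι (fun z => by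
    change absOp A hA (absOp A hA (ι z)) = _
    rw [absOp_absOp, absOp_absOp, h₁]) z
  have h4 : ι (absOp B hB z) = absOp A hA (ι z) := h3.symm
  rw [h4, polarIsometry_absOp, polarIsometry_absOp, h₂]

end Sqrt

/-! ### The model case: orthogonal decompositions and the diagonal form of F. -/

namespace ModelCase

variable {H' H : Type*} [NormedAddCommGroup H'] [InnerProductSpace ℝ H'] [CompleteSpace H']
  [NormedAddCommGroup H] [InnerProductSpace ℝ H] [CompleteSpace H]

variable (M : ModelCase H' H)

theorem tgt_mono {t₁ t₂ : Finset ℕ} (h : t₁ ⊆ t₂) : M.tgt t₁ ≤ M.tgt t₂ :=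
  Submodule.map_mono (M.src_mono h)

theorem tgt_eq_sup (t : Finset ℕ) :
    M.tgt t = t.sup fun k => (M.E' k).map (M.l : H' →ₗ[ℝ] H) := by
  unfold tgt src
  induction t using Finset.induction_on with
  | empty => simp
  | insert a s ha ih => rw [Finset.sup_insert, Finset.sup_insert, Submodule.map_sup, ih]

theorem tgt_ortho {t₁ t₂ : Finset ℕ} (h : Disjoint t₁ t₂) : M.tgt t₁ ⟂ M.tgt t₂ := by
  rw [tgt_eq_sup, tgt_eq_sup, Submodule.isOrtho_iff_le]
  refine Finset.sup_le fun j hj => ?_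
  rw [← Submodule.isOrtho_iff_le, Submodule.isOrtho_comm, Submodule.isOrtho_iff_le]
  refine Finset.sup_le fun k hk => ?_
  rw [← Submodule.isOrtho_iff_le]
  exact M.ortho k j fun hkj => Finset.disjoint_left.1 h hj (hkj ▸ hk)

theorem E_le_tgt {t : Finset ℕ} {k : ℕ} (hk : k ∈ t) :
    (M.E' k).map (M.l : H' →ₗ[ℝ] H) ≤ M.tgt t :=
  Submodule.map_mono (Finset.le_sup (f := M.E') hk)

theorem src_sup_sdiff {t₁ t₂ : Finset ℕ} (h : t₁ ⊆ t₂) :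
    M.src t₂ = M.src t₁ ⊔ M.src (t₂ \ t₁) := by
  unfold src
  rw [← Finset.sup_union, Finset.union_sdiff_of_subset h]

theorem sub_proj_mem_src {t₁ t₂ : Finset ℕ} (h : t₁ ⊆ t₂) {z : H'} (hz : z ∈ M.src t₂) :
    z - (M.src t₁).orthogonalProjectionOnto z ∈ M.src (t₂ \ t₁) := by
  rw [M.src_sup_sdiff h, Submodule.mem_sup] at hz
  obtain ⟨a, ha, b, hb, rfl⟩ := hz
  have h1 : ((M.src t₁).orthogonalProjectionOnto (a + b) : H') = a :=
    Submodule.eq_starProjection_of_mem_of_inner_eq_zero ha fun w hw => by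
      rw [add_sub_cancel_left]
      exact (M.src_ortho Finset.sdiff_disjoint).inner_eq hb hw
  rw [h1, add_sub_cancel_left]
  exact hb

theorem tgt_sup_sdiff {t₁ t₂ : Finset ℕ} (h : t₁ ⊆ t₂) :
    M.tgt t₂ = M.tgt t₁ ⊔ M.tgt (t₂ \ t₁) := by
  unfold tgt
  rw [M.src_sup_sdiff h, Submodule.map_sup]

/-- The projection to `E_{t₂ \ t₁}` is the difference of the projections to `E_{t₂}` and
`E_{t₁}`. -/
theorem proj_sdiff {t₁ t₂ : Finset ℕ} (h : t₁ ⊆ t₂) (y : H) :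
    ((M.tgt (t₂ \ t₁)).orthogonalProjectionOnto y : H) =
      (M.tgt t₂).orthogonalProjectionOnto y - (M.tgt t₁).orthogonalProjectionOnto y := by
  have h1 : ((M.tgt t₂).orthogonalProjectionOnto y : H) ∈ M.tgt t₁ ⊔ M.tgt (t₂ \ t₁) :=
    (M.tgt_sup_sdiff h).le (Subtype.property _)
  rw [Submodule.mem_sup] at h1
  obtain ⟨a, ha, b, hb, hab⟩ := h1
  have hy : ∀ w ∈ M.tgt t₂, ⟪y - (a + b), w⟫_ℝ = 0 := fun w hw => by
    rw [hab]
    exact sub_orthogonalProjectionOnto_inner y ⟨w, hw⟩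
  have hort := M.tgt_ortho (t₁ := t₁) (t₂ := t₂ \ t₁) Finset.disjoint_sdiff
  have h2 : ((M.tgt t₁).orthogonalProjectionOnto y : H) = a :=
    Submodule.eq_starProjection_of_mem_of_inner_eq_zero ha fun w hw => by
      have h3 := hy w (M.tgt_mono h hw)
      have h4 : ⟪b, w⟫_ℝ = 0 := hort.symm.inner_eq hb hw
      rw [← sub_sub, inner_sub_left, h4, sub_zero] at h3
      exact h3
  have h3 : ((M.tgt (t₂ \ t₁)).orthogonalProjectionOnto y : H) = b :=
    Submodule.eq_starProjection_of_mem_of_inner_eq_zero hb fun w hw => by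
      have h3 := hy w (M.tgt_mono Finset.sdiff_subset hw)
      have h4 : ⟪a, w⟫_ℝ = 0 := hort.inner_eq ha hw
      rw [add_comm, ← sub_sub, inner_sub_left, h4, sub_zero] at h3
      exact h3
  rw [h2, h3, ← hab, add_sub_cancel_left]

theorem dense_tgt : (⊤ : Submodule ℝ H) ≤
    (⨆ i, M.tgt (Finset.Iic i)).topologicalClosure := by
  intro y _
  have h1 : (M.l : H' → H) '' ((⨆ k, M.E' k : Submodule ℝ H') : Set H') ⊆
      ((⨆ i, M.tgt (Finset.Iic i) : Submodule ℝ H) : Set H) := by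
    rintro _ ⟨v, hv, rfl⟩
    have h2 : (⨆ k, M.E' k) ≤ (⨆ i, M.tgt (Finset.Iic i)).comap (M.l : H' →ₗ[ℝ] H) := by
      refine iSup_le fun k v hv => ?_
      exact Submodule.mem_iSup_of_mem k
        (M.E_le_tgt (Finset.mem_Iic.2 le_rfl) (Submodule.mem_map_of_mem hv))
    exact h2 hv
  exact closure_mono h1 (M.l.surjective.denseRange.dense_image M.l.continuous M.dense y)

theorem monotone_tgt_Iic : Monotone fun i => M.tgt (Finset.Iic i) :=
  fun _ _ h => M.tgt_mono (Finset.Iic_subset_Iic.2 h)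

theorem tendsto_proj (y : H) :
    Tendsto (fun i => (M.tgt (Finset.Iic i)).starProjection y) atTop (𝓝 y) :=
  Submodule.starProjection_tendsto_self _ M.monotone_tgt_Iic y M.dense_tgt

/-- The orthogonal projections to the E_{≤ i} converge strongly to the identity, and all of them
kill z. -/
theorem eq_zero_of_proj_eq_zero {z : H} (hz : ∀ k, ∀ w ∈ (M.E' k).map (M.l : H' →ₗ[ℝ] H),
    ⟪z, w⟫_ℝ = 0) : z = 0 := by
  have h1 : ∀ i, (M.tgt (Finset.Iic i)).starProjection z = 0 := by
    intro i
    refine (Submodule.starProjection_apply_eq_zero_iff _).2 ?_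
    rw [Submodule.mem_orthogonal]
    intro u hu
    have h2 : M.tgt (Finset.Iic i) ≤ (Submodule.span ℝ {z})ᗮ := by
      rw [tgt_eq_sup]
      refine Finset.sup_le fun k _ w hw => ?_
      exact Submodule.mem_orthogonal_singleton_iff_inner_right.2 (hz k w hw)
    rw [real_inner_comm]
    exact Submodule.mem_orthogonal_singleton_iff_inner_right.1 (h2 hu)
  have h2 := M.tendsto_proj z
  simp only [h1] at h2
  exact (tendsto_nhds_unique h2 tendsto_const_nhds)

theorem inner_F_sub_F {v w : H'} {k : ℕ}
    (h : (M.E' k).orthogonalProjectionOnto v = (M.E' k).orthogonalProjectionOnto w) {y : H}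
    (hy : y ∈ (M.E' k).map (M.l : H' →ₗ[ℝ] H)) : ⟪M.F v - M.F w, y⟫_ℝ = 0 := by
  have h1 : ((M.E' k).map (M.l : H' →ₗ[ℝ] H)).orthogonalProjectionOnto (M.F v - M.F w) = 0 := by
    rw [map_sub, M.diag, M.diag, h, sub_self]
  rw [real_inner_comm]
  exact Submodule.orthogonalProjectionOnto_eq_zero_iff.1 h1 y hy

/-- `F_t(v)` depends only on the projection of `v` to `E'_t`. -/
theorem proj_F (t : Finset ℕ) (v : H') :
    (M.tgt t).orthogonalProjectionOnto (M.F ((M.src t).orthogonalProjectionOnto v)) =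
      (M.tgt t).orthogonalProjectionOnto (M.F v) := by
  rw [← sub_eq_zero, ← map_sub, Submodule.orthogonalProjectionOnto_eq_zero_iff,
    Submodule.mem_orthogonal]
  intro y hy
  have h2 : M.tgt t ≤
      (Submodule.span ℝ {M.F ((M.src t).orthogonalProjectionOnto v) - M.F v})ᗮ := by
    rw [tgt_eq_sup]
    refine Finset.sup_le fun k hk w hw => ?_
    exact Submodule.mem_orthogonal_singleton_iff_inner_right.2 (M.inner_F_sub_F
      (orthogonalProjectionOnto_coe_of_le (Finset.le_sup (f := M.E') hk) v) hw)
  rw [real_inner_comm]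
  exact Submodule.mem_orthogonal_singleton_iff_inner_right.1 (h2 hy)

/-- For `m ∈ E'_t` the difference of `F(m)` and `F_t(m)` does not depend on `m`. -/
theorem F_sub_part (t : Finset ℕ) (m : M.src t) :
    M.F m - M.part t m = M.F 0 - (M.tgt t).starProjection (M.F 0) := by
  -- Checked on each E_k. For k ∈ t the projection removes the component. For k ∉ t the vector m has
  -- no component in E'_k, so F m and F 0 have the same component in E_k.
  have h : M.F m - M.F 0 - (M.tgt t).orthogonalProjectionOnto (M.F m - M.F 0) = 0 := by
    refine M.eq_zero_of_proj_eq_zero fun k w hw => ?_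
    by_cases hk : k ∈ t
    · exact sub_orthogonalProjectionOnto_inner _ (⟨w, M.E_le_tgt hk hw⟩ : M.tgt t)
    · have hd : Disjoint {k} t := Finset.disjoint_singleton_left.2 hk
      have h1 : (M.E' k).orthogonalProjectionOnto (m : H') =
          (M.E' k).orthogonalProjectionOnto 0 := by
        rw [map_zero, Submodule.orthogonalProjectionOnto_eq_zero_iff, Submodule.mem_orthogonal]
        intro u hu
        exact (M.src_ortho hd).inner_eq (Finset.le_sup (f := M.E') (Finset.mem_singleton_self k) hu)
          m.2
      have h2 : ⟪((M.tgt t).orthogonalProjectionOnto (M.F m - M.F 0) : H), w⟫_ℝ = 0 :=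
        (M.tgt_ortho hd).symm.inner_eq (Subtype.property _)
          (M.E_le_tgt (Finset.mem_singleton_self k) hw)
      rw [inner_sub_left, M.inner_F_sub_F h1 hw, h2, sub_zero]
  rw [map_sub, Submodule.coe_sub] at h
  change M.F m - (M.tgt t).orthogonalProjectionOnto (M.F m) =
    M.F 0 - (M.tgt t).orthogonalProjectionOnto (M.F 0)
  rw [← sub_eq_zero, ← h]
  abel

end ModelCase

/-! ### The model algebra as a Bott system. -/

namespace ModelCase

variable {H' H : Type*} [NormedAddCommGroup H'] [InnerProductSpace ℝ H'] [CompleteSpace H']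
  [NormedAddCommGroup H] [InnerProductSpace ℝ H] [CompleteSpace H]

variable (M : ModelCase H' H)

/-- The unitaries `l̄_t` are compatible with the inclusions. -/
theorem polarUnitary_linPart {t₁ t₂ : Finset ℕ} (h : t₁ ⊆ t₂) (x : M.src t₁) :
    polarUnitary (M.linPart t₂) (inclIso (M.src_mono h) x) =
      inclIso (M.tgt_mono h) (polarUnitary (M.linPart t₁) x) := by
  -- Since l maps E'_{t₂ \ t₁} into the orthogonal complement of E_{t₁}, the operator l_{t₂}^*
  -- l_{t₂} preserves E'_{t₁} and restricts to l_{t₁}^* l_{t₁}. Square roots and polar isometries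
  -- then restrict as well.
  refine polarIsometry_comp_eq (M.linPart t₂ : M.src t₂ →L[ℝ] M.tgt t₂) _
    (M.linPart t₁ : M.src t₁ →L[ℝ] M.tgt t₁) _ (inclIso (M.src_mono h)).toLinearMap
    (inclIso (M.tgt_mono h)).toLinearMap (fun x => ?_) (fun x => rfl) x
  refine ext_inner_left ℝ fun z => ?_
  rw [ContinuousLinearMap.adjoint_inner_right]
  have h1 : ⟪z, inclIso (M.src_mono h)
      ((M.linPart t₁ : M.src t₁ →L[ℝ] M.tgt t₁).adjoint (M.linPart t₁ x))⟫_ℝ =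
      ⟪M.linPart t₁ ((M.src t₁).orthogonalProjectionOnto (z : H')), M.linPart t₁ x⟫_ℝ := by
    refine Eq.trans ?_ (ContinuousLinearMap.adjoint_inner_right
      (M.linPart t₁ : M.src t₁ →L[ℝ] M.tgt t₁) _ _)
    exact (Submodule.inner_orthogonalProjectionOnto_eq_of_mem_right
      ((M.linPart t₁ : M.src t₁ →L[ℝ] M.tgt t₁).adjoint (M.linPart t₁ x)) (z : H')).symm
  refine Eq.trans ?_ h1.symm
  have h2 : ⟪M.l (z - (M.src t₁).orthogonalProjectionOnto (z : H')), M.l x⟫_ℝ = 0 :=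
    (M.tgt_ortho Finset.sdiff_disjoint).inner_eq
      (Submodule.mem_map_of_mem (M.sub_proj_mem_src h z.2)) (Submodule.mem_map_of_mem x.2)
  rw [map_sub, inner_sub_left, sub_eq_zero] at h2
  exact h2

theorem polarUnitary_linPart_symm {t₁ t₂ : Finset ℕ} (h : t₁ ⊆ t₂) (y : M.tgt t₁) :
    (polarUnitary (M.linPart t₂)).symm (inclIso (M.tgt_mono h) y) =
      inclIso (M.src_mono h) ((polarUnitary (M.linPart t₁)).symm y) := by
  rw [LinearIsometryEquiv.symm_apply_eq, M.polarUnitary_linPart h,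
    LinearIsometryEquiv.apply_symm_apply]

theorem part_proj {t₁ t₂ : Finset ℕ} (h : t₁ ⊆ t₂) (v : M.src t₂) :
    M.part t₁ ((M.src t₁).orthogonalProjectionOnto (v : H')) =
      (M.tgt t₁).orthogonalProjectionOnto (M.part t₂ v : H) := by
  refine (M.proj_F t₁ v).trans ?_
  exact (orthogonalProjectionOnto_coe_of_le (M.tgt_mono h) (M.F v)).symm

/-- The induced Bott map of a pull-back is the pull-back of the standard Bott map. -/
theorem indBott_pull {i k : ℕ} (h : i ≤ k) (u : BFun (M.tgt (Finset.Iic i)) (M.tgt (Finset.Iic i))) :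
    M.indBott h (M.pull (Finset.Iic i) u) =
      M.pull (Finset.Iic k) (bott (M.monotone_tgt_Iic h) u) := by
  refine Subtype.ext (funext fun ⟨x, v⟩ => ?_)
  have hik : Finset.Iic i ⊆ Finset.Iic k := Finset.Iic_subset_Iic.2 h
  have hIoc : Finset.Ioc i k = Finset.Iic k \ Finset.Iic i := by
    ext a
    simp only [Finset.mem_Ioc, Finset.mem_sdiff, Finset.mem_Iic, not_le]
    exact and_comm
  have hIoc' : Finset.Ioc i k ⊆ Finset.Iic k := hIoc ▸ Finset.sdiff_subset
  set y := M.part (Finset.Iic k) v with hy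
  set T₁ := (polarUnitary (M.linPart (Finset.Iic i))).symm.toLinearIsometry with hT₁
  set T₂ := (polarUnitary (M.linPart (Finset.Iic k))).symm.toLinearIsometry with hT₂
  set ι₁ := inclIso (M.src_mono hik)
  set ι₂ := inclIso (M.tgt_mono hik)
  set N : M.src (Finset.Iic k) := inclIso (M.src_mono hIoc') (M.indClifford (Finset.Ioc i k)
    ((M.src (Finset.Ioc i k)).orthogonalProjectionOnto (v : H')))
  have hN : ∀ w, ⟪N, ι₁ w⟫_ℝ = 0 := fun w => by
    refine (M.src_ortho ?_).inner_eq (Submodule.coe_mem (M.indClifford (Finset.Ioc i k) _)) w.2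
    rw [hIoc]
    exact Finset.sdiff_disjoint
  have hpart := M.part_proj hik v
  rw [← hy] at hpart
  have h1 := bottFibre_map ι₁ T₁ (EPlus.mk x N) hN
    (fun t => u (t, M.part (Finset.Iic i) ((M.src (Finset.Iic i)).orthogonalProjectionOnto (v : H'))))
  have h2 := map_bottFibre T₂ ι₂ x (y - ι₂ ((M.tgt (Finset.Iic i)).orthogonalProjectionOnto (y : H)))
    (fun v => sub_orthogonalProjectionOnto_inner (y : H) v)
    (fun t => u (t, (M.tgt (Finset.Iic i)).orthogonalProjectionOnto (y : H)))
  refine Eq.trans ?_ ((h1.trans (bottFibre_congr ?_ ?_ ?_)).trans h2.symm)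
  · rfl
  · ext w
    exact congrArg Subtype.val (M.polarUnitary_linPart_symm hik w).symm
  · have h3 : N = T₂ (inclIso (M.tgt_mono hIoc') (M.part (Finset.Ioc i k)
        ((M.src (Finset.Ioc i k)).orthogonalProjectionOnto (v : H')))) :=
      (M.polarUnitary_linPart_symm hIoc' _).symm
    rw [h3, M.part_proj hIoc' v, ← hy]
    congr 2
    refine Subtype.ext ?_
    change ((M.tgt (Finset.Ioc i k)).orthogonalProjectionOnto (y : H) : H) =
      y - (M.tgt (Finset.Iic i)).orthogonalProjectionOnto (y : H)
    have h4 := M.proj_sdiff hik (y : H)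
    rw [← hIoc, Submodule.orthogonalProjectionOnto_mem_subspace_eq_self] at h4
    exact h4
  · exact funext fun t => congrArg (fun z => u (t, z)) hpart

/-- The homomorphism `u ↦ [u]`. -/
def seqHom (i : ℕ) : BFun (M.tgt (Finset.Iic i)) (M.tgt (Finset.Iic i)) →⋆ₙₐ[ℂ] M.Seqs :=
  (AsymAlg.mkHom (comap Sigma.fst atTop)
    (fun p : Σ j, ℝ × M.src (Finset.Iic j) => Cl (EPlus (M.src (Finset.Iic p.1))))).comp
  (famHom (X := fun j => M.src (Finset.Iic j)) (V := fun j => M.src (Finset.Iic j))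
    (fun k => i ≤ k)
    (fun k h => (pullBackHom (polarUnitary (M.linPart (Finset.Iic k))).symm.toLinearIsometry
      (M.part (Finset.Iic k))).comp (bottHom (M.monotone_tgt_Iic h)))
    (fun _ h u => (norm_pullBack_le _ _ _).trans (norm_bott_le (M.monotone_tgt_Iic h) u)))

theorem seq_apply {i k : ℕ} (h : i ≤ k)
    (u : BFun (M.tgt (Finset.Iic i)) (M.tgt (Finset.Iic i))) (x : ℝ) (v : M.src (Finset.Iic k)) :
    M.seq i (M.pull (Finset.Iic i) u) ⟨k, x, v⟩ =
      M.pull (Finset.Iic k) (bott (M.monotone_tgt_Iic h) u) (x, v) := by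
  rw [← M.indBott_pull h]
  exact dif_pos h

/-- The homomorphism applies the standard Bott map before pulling back, while the generators of the
model algebra apply the induced Bott map after pulling back. The two orders agree by `indBott_pull`.
-/
theorem seqHom_apply (i : ℕ) (u : BFun (M.tgt (Finset.Iic i)) (M.tgt (Finset.Iic i))) :
    M.seqHom i u = AsymAlg.mk _ _ (M.seq i (M.pull (Finset.Iic i) u)) := by
  refine AsymAlg.mk_eq_mk_of_eventually ?_
  rw [eventually_comap]
  filter_upwards [eventually_ge_atTop i] with k hk
  rintro ⟨_, x, v⟩ rfl
  rw [M.seq_apply hk]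
  exact dif_pos hk

theorem norm_seq_apply {i k : ℕ} (h : i ≤ k)
    (u : BFun (M.tgt (Finset.Iic i)) (M.tgt (Finset.Iic i))) (x : ℝ) (v : M.src (Finset.Iic k)) :
    ‖M.seq i (M.pull (Finset.Iic i) u) ⟨k, x, v⟩‖ =
      profile (M.tgt (Finset.Iic i)) u x (M.part (Finset.Iic k) v) := by
  rw [M.seq_apply h]
  exact (Cl.norm_map _ _).trans (norm_bott_apply (M.monotone_tgt_Iic h) u x _)

theorem seqHom_bott {i j : ℕ} (h : i ≤ j)
    (u : BFun (M.tgt (Finset.Iic i)) (M.tgt (Finset.Iic i))) :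
    M.seqHom j (bott (M.monotone_tgt_Iic h) u) = M.seqHom i u := by
  rw [seqHom_apply, seqHom_apply]
  refine AsymAlg.mk_eq_mk_of_eventually ?_
  rw [eventually_comap]
  filter_upwards [eventually_ge_atTop j] with k hk
  rintro ⟨_, x, v⟩ rfl
  rw [M.seq_apply hk, M.seq_apply (h.trans hk), bott_bott]

/-- On E'_{≤ k} the difference F − F_{≤ k} is constant, namely the tail of F(0). So the convergence
is uniform on the whole subspace and no radii are needed. -/
theorem eventually_norm_F_sub_part_le {ε : ℝ} (hε : 0 < ε) :
    ∀ᶠ k in atTop, ∀ v : M.src (Finset.Iic k), ‖M.F v - M.part (Finset.Iic k) v‖ ≤ ε := by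
  filter_upwards [Metric.tendsto_nhds.1 (M.tendsto_proj (M.F 0)) ε hε] with k hk v
  rw [M.F_sub_part, ← dist_eq_norm, dist_comm]
  exact hk.le

theorem dense_src {N : ℕ} : Dense (⋃ i, (M.src (Finset.Iic (N + i)) : Set H')) := by
  refine M.dense.mono ?_
  have hm : Monotone fun i => M.src (Finset.Iic (N + i)) := fun i j h =>
    M.src_mono (Finset.Iic_subset_Iic.2 (Nat.add_le_add_left h N))
  refine Set.Subset.trans ?_
    (Submodule.coe_iSup_of_chain ⟨fun i => M.src (Finset.Iic (N + i)), hm⟩).subset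
  change (⨆ k, M.E' k) ≤ ⨆ i, M.src (Finset.Iic (N + i))
  refine iSup_le fun k => le_iSup_of_le k ?_
  exact Finset.le_sup (f := M.E') (Finset.mem_Iic.2 (Nat.le_add_left k N))

theorem norm_seqHom_le_iff (i : ℕ) {u : BFun (M.tgt (Finset.Iic i)) (M.tgt (Finset.Iic i))}
    (hu : u ∈ SCliff (M.tgt (Finset.Iic i)) (M.tgt (Finset.Iic i))) {c : ℝ} (hc : 0 ≤ c) :
    ‖M.seqHom i u‖ ≤ c ↔ ∀ x v, profile (M.tgt (Finset.Iic i)) u x (M.F v) ≤ c := by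
  rw [seqHom_apply, AsymAlg.norm_mk_le_iff _ hc]
  constructor
  · intro h x v
    refine le_of_forall_pos_le_add fun ε hε => ?_
    obtain ⟨δ, hδ, hp⟩ := SCliff.exists_profile_sub_le hu (show 0 < ε / 3 by positivity)
    have h1 : ∀ᶠ v' in 𝓝 v, ‖M.F v - M.F v'‖ ≤ δ := by
      filter_upwards [(Metric.continuous_iff'.1 M.continuous_F) v δ hδ] with v' hv'
      rw [← dist_eq_norm, dist_comm]
      exact hv'.le
    obtain ⟨v', hv', hvF⟩ := (M.dense_src (N := 0)).inter_nhds_nonempty h1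
    obtain ⟨j₀, hj₀⟩ := Set.mem_iUnion.1 hv'
    obtain ⟨k, hk, hk', hki, hkj⟩ := ((eventually_comap.1 (h (ε / 3) (by positivity))).and
      ((M.eventually_norm_F_sub_part_le hδ).and
        ((eventually_ge_atTop i).and (eventually_ge_atTop (0 + j₀))))).exists
    have hvk : v' ∈ M.src (Finset.Iic k) := M.src_mono (Finset.Iic_subset_Iic.2 hkj) hj₀
    have h2 := hk ⟨k, x, ⟨v', hvk⟩⟩ rfl
    rw [M.norm_seq_apply hki] at h2
    have h3 := hp x _ _ (hk' ⟨v', hvk⟩)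
    have h4 := hp x _ _ hvF
    linarith
  · intro h ε hε
    obtain ⟨δ, hδ, hp⟩ := SCliff.exists_profile_sub_le hu hε
    rw [eventually_comap]
    filter_upwards [M.eventually_norm_F_sub_part_le hδ, eventually_ge_atTop i] with k hk hki
    rintro ⟨_, x, v⟩ rfl
    rw [M.norm_seq_apply hki]
    have h1 := hk v
    rw [norm_sub_rev] at h1
    exact (hp x _ _ h1).trans (by gcongr; exact h x v)

/-- The directed family of the algebras of the model case. -/
def system : BottSystem M.F M.Seqs ℕ where
  E i := M.tgt (Finset.Iic i)
  finite_dim i := inferInstance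
  mono := M.monotone_tgt_Iic
  S i := SCliff (M.tgt (Finset.Iic i)) (M.tgt (Finset.Iic i))
  S_le _ := le_rfl
  bott_mem _ _ h _ hu := SCliff.bott_mem _ hu
  hom := M.seqHom
  hom_bott _ _ h u _ := M.seqHom_bott h u
  norm_le_iff i _ hu _ hc := M.norm_seqHom_le_iff i hu hc
  dense E₀ _ u hu ε hε := by
    have hd : Dense (⋃ i, (M.tgt (Finset.Iic i) : Set H)) := by
      have h1 := Submodule.coe_iSup_of_chain
        ⟨fun i => M.tgt (Finset.Iic i), M.monotone_tgt_Iic⟩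
      intro y
      have h2 := M.dense_tgt (Submodule.mem_top (x := y))
      change y ∈ closure ((⨆ i, M.tgt (Finset.Iic i) : Submodule ℝ H) : Set H) at h2
      exact h1 ▸ h2
    obtain ⟨R, hR⟩ := exists_dense_approx M.F (fun i => M.tgt (Finset.Iic i))
      M.monotone_tgt_Iic hd hu hε
    obtain ⟨j, v, hv, -, hle⟩ := hR.exists
    exact ⟨j, v, hv, hle⟩

theorem system_hom_mem (i : ℕ) (u) (hu : u ∈ M.system.S i) : M.system.hom i u ∈
    cstarGen {a : M.Seqs | ∃ i u, u ∈ SCliff (M.tgt (Finset.Iic i)) (M.tgt (Finset.Iic i)) ∧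
      a = AsymAlg.mk _ _ (M.seq i (M.pull (Finset.Iic i) u))} :=
  subset_cstarGen _ ⟨i, u, hu, M.seqHom_apply i u⟩

theorem subset_closure_system :
    {a : M.Seqs | ∃ i u, u ∈ SCliff (M.tgt (Finset.Iic i)) (M.tgt (Finset.Iic i)) ∧
      a = AsymAlg.mk _ _ (M.seq i (M.pull (Finset.Iic i) u))} ⊆
      closure {a | ∃ i, ∃ u ∈ M.system.S i, M.system.hom i u = a} := by
  refine Set.Subset.trans ?_ subset_closure
  rintro _ ⟨i, u, hu, rfl⟩
  exact ⟨i, u, hu, M.seqHom_apply i u⟩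

end ModelCase

/-! ### The finite approximation of the model case by partial sums. -/

namespace ModelCase

variable {H' H : Type*} [NormedAddCommGroup H'] [InnerProductSpace ℝ H'] [CompleteSpace H']
  [NormedAddCommGroup H] [InnerProductSpace ℝ H] [CompleteSpace H]

variable (M : ModelCase H' H)

theorem norm_le_sum (t : Finset ℕ) (m : M.src t) :
    ‖m‖ ≤ ∑ k ∈ t, ‖(M.E' k).orthogonalProjectionOnto (m : H')‖ := by
  have h : (m : H') = ∑ k ∈ t, ((M.E' k).orthogonalProjectionOnto (m : H') : H') := by
    rw [← sub_eq_zero]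
    set z := (m : H') - ∑ k ∈ t, ((M.E' k).orthogonalProjectionOnto (m : H') : H') with hz
    have hmem : z ∈ M.src t := M.src t |>.sub_mem m.2 (Submodule.sum_mem _ fun k hk =>
      Finset.le_sup (f := M.E') hk (Subtype.property _))
    have hort : M.src t ≤ (Submodule.span ℝ {z})ᗮ := by
      refine Finset.sup_le fun k hk w hw => ?_
      rw [Submodule.mem_orthogonal_singleton_iff_inner_right, hz, inner_sub_left, sum_inner,
        Finset.sum_eq_single_of_mem k hk fun j _ hj =>
          (M.ortho' j k hj).inner_eq (Subtype.property _) hw, ← inner_sub_left]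
      exact sub_orthogonalProjectionOnto_inner (m : H') (⟨w, hw⟩ : M.E' k)
    exact inner_self_eq_zero.1
      (Submodule.mem_orthogonal_singleton_iff_inner_right.1 (hort hmem))
  change ‖(m : H')‖ ≤ _
  rw [h]
  refine (norm_sum_le _ _).trans_eq (Finset.sum_congr rfl fun k _ => ?_)
  rw [← h]
  rfl

/-- A bound on F_t(m) bounds each of its finitely many components. Properness of the F_k then
confines each component of m. -/
theorem exists_norm_lt (t : Finset ℕ) (s : ℝ) :
    ∃ R, ∀ m : M.src t, ‖M.part t m‖ < s → ‖m‖ < R := by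
  have h1 : ∀ k, ∃ R, ∀ w : M.E' k, ‖M.comp k w‖ ≤ s → ‖w‖ ≤ R := by
    intro k
    have h2 := (M.proper k).isCompact_preimage
      (isCompact_closedBall (0 : (M.E' k).map (M.l : H' →ₗ[ℝ] H)) s)
    obtain ⟨R, hR⟩ := h2.isBounded.exists_norm_le
    exact ⟨R, fun w hw => hR w (mem_closedBall_zero_iff.2 hw)⟩
  choose R hR using h1
  refine ⟨∑ k ∈ t, R k + 1, fun m hm => ?_⟩
  refine (M.norm_le_sum t m).trans_lt (lt_of_le_of_lt (Finset.sum_le_sum fun k hk => ?_)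
    (lt_add_one _))
  refine hR k _ ?_
  rw [← M.diag, ← orthogonalProjectionOnto_coe_of_le (M.E_le_tgt hk)]
  exact (Submodule.norm_orthogonalProjectionOnto_apply_le _ _).trans hm.le

theorem continuous_part (t : Finset ℕ) : Continuous (M.part t) :=
  (M.tgt t).orthogonalProjectionOnto.continuous.comp
    (M.continuous_F.comp continuous_subtype_val)

theorem norm_linPart_le (t : Finset ℕ) :
    ‖(M.linPart t : M.src t →L[ℝ] M.tgt t)‖ ≤ ‖(M.l : H' →L[ℝ] H)‖ :=
  ContinuousLinearMap.opNorm_le_bound _ (ContinuousLinearMap.opNorm_nonneg _) fun v =>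
    (M.l : H' →L[ℝ] H).le_opNorm v

theorem norm_linPart_mono {t₁ t₂ : Finset ℕ} (h : t₁ ⊆ t₂) :
    ‖(M.linPart t₁ : M.src t₁ →L[ℝ] M.tgt t₁)‖ ≤ ‖(M.linPart t₂ : M.src t₂ →L[ℝ] M.tgt t₂)‖ :=
  ContinuousLinearMap.opNorm_le_bound _ (ContinuousLinearMap.opNorm_nonneg _) fun v =>
    (M.linPart t₂ : M.src t₂ →L[ℝ] M.tgt t₂).le_opNorm (inclIso (M.src_mono h) v)

/-- The lower bound on ‖l_i‖ relative to ‖l‖ fails if the first l_i act on zero spaces while l ≠ 0;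
starting at N avoids this. Such an N exists, as otherwise l vanishes on a dense subspace. -/
theorem exists_norm_linPart_ne_zero : ∃ N, ‖(M.l : H' →L[ℝ] H)‖ = 0 ∨
    ‖(M.linPart (Finset.Iic N) : M.src (Finset.Iic N) →L[ℝ] M.tgt (Finset.Iic N))‖ ≠ 0 := by
  by_contra! hc
  refine (hc 0).1 (norm_eq_zero.2 ?_)
  refine ContinuousLinearMap.coe_injective (LinearMap.ext fun v => ?_)
  have h1 : ∀ v, M.l v = 0 := by
    refine fun v => (M.dense_src (N := 0)).induction (P := fun v => M.l v = 0) ?_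
      (isClosed_eq M.l.continuous continuous_const) v
    intro w hw
    obtain ⟨i, hi⟩ := Set.mem_iUnion.1 hw
    have h2 := (M.linPart (Finset.Iic (0 + i)) :
      M.src (Finset.Iic (0 + i)) →L[ℝ] M.tgt (Finset.Iic (0 + i))).le_opNorm ⟨w, hi⟩
    rw [(hc (0 + i)).2, zero_mul] at h2
    exact norm_le_zero_iff.1 h2
  exact h1 v

theorem exists_finApprox : ∃ (N : ℕ) (D : FinApprox M.F M.l),
    ∀ i, D.W' i = M.src (Finset.Iic (N + i)) ∧ (∀ m, (D.lin i m : H) = M.l m) ∧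
      ∀ m, (D.map i m : H) = (M.tgt (Finset.Iic (N + i))).starProjection (M.F m) := by
  obtain ⟨N, hN⟩ := M.exists_norm_linPart_ne_zero
  choose ρ hρ using fun i : ℕ => M.exists_norm_lt (Finset.Iic (N + i)) ((i : ℝ) + 1)
  -- Partial sums of |ρ j| + 1 are strictly increasing, at least i + 1 = s_i, and larger than ρ i.
  let r : ℕ → ℝ := fun i => ∑ j ∈ Finset.range (i + 1), (|ρ j| + 1)
  have hr : ∀ i : ℕ, (i : ℝ) + 1 ≤ r i := by
    intro i
    have : ∑ j ∈ Finset.range (i + 1), (1 : ℝ) ≤ r i :=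
      Finset.sum_le_sum fun j _ => by linarith [abs_nonneg (ρ j)]
    simpa using this
  have hρr : ∀ i, ρ i < r i := by
    intro i
    have h1 : |ρ i| + 1 ≤ r i := Finset.single_le_sum (f := fun j => |ρ j| + 1)
      (fun j _ => by positivity) (Finset.self_mem_range_succ i)
    linarith [le_abs_self (ρ i)]
  have hIic : ∀ {i j : ℕ}, i ≤ j → Finset.Iic (N + i) ⊆ Finset.Iic (N + j) := fun h =>
    Finset.Iic_subset_Iic.2 (Nat.add_le_add_left h N)
  have hs : Tendsto (fun i : ℕ => (i : ℝ) + 1) atTop atTop :=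
    tendsto_atTop_add_const_right _ _ tendsto_natCast_atTop_atTop
  refine ⟨N, {
    W' := fun i => M.src (Finset.Iic (N + i))
    finite_dim := fun i => inferInstance
    mono' := fun i j h => M.src_mono (hIic h)
    dense := M.dense_src
    W := fun i => M.tgt (Finset.Iic (N + i))
    mono := fun i j h => M.tgt_mono (hIic h)
    lin := fun i => M.linPart (Finset.Iic (N + i))
    map := fun i => M.part (Finset.Iic (N + i))
    continuous_map := fun i => M.continuous_part _
    s := fun i => (i : ℝ) + 1
    r := r
    s_pos := by norm_num
    s_mono := fun i j h => by
      have : (i : ℝ) < j := Nat.cast_lt.2 h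
      linarith
    s_tendsto := hs
    r_mono := strictMono_nat_of_lt_succ fun i => by
      change r i < ∑ j ∈ Finset.range (i + 1 + 1), (|ρ j| + 1)
      rw [Finset.sum_range_succ]
      linarith [abs_nonneg (ρ (i + 1))]
    r_tendsto := tendsto_atTop_mono hr hs
    s_le_r := hr
    proper := fun i m hm => (hρ i m hm).trans (hρr i)
    map_tendsto := fun i₀ ε hε => by
      filter_upwards [(tendsto_add_atTop_nat N).eventually
        (M.eventually_norm_F_sub_part_le hε)] with i hi h m _
      have := hi
      rw [Nat.add_comm i N] at this
      exact this (inclIso (M.src_mono (hIic h)) m)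
    asymUnitary := M.asymUnitary
    lin_tendsto := fun i₀ ε hε => Eventually.of_forall fun i h m => by
      have h0 : M.l m - M.linPart (Finset.Iic (N + i)) (inclIso (M.src_mono (hIic h)) m) = 0 :=
        sub_self _
      rw [h0, norm_zero]
      positivity
    lin_bound := ?_ }, fun i => ⟨rfl, fun m => rfl, fun m => rfl⟩⟩
  set a := ‖(M.l : H' →L[ℝ] H)‖ with ha
  have hle := fun i => M.norm_linPart_le (Finset.Iic (N + i))
  have hge := fun i => M.norm_linPart_mono (Finset.Iic_subset_Iic.2 (Nat.le_add_right N i))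
  rcases hN with h0 | h0
  · refine ⟨1, one_pos, fun i => ?_⟩
    have h1 := hle i
    rw [← ha, h0] at h1
    rw [h0, mul_zero, mul_zero]
    exact ⟨ContinuousLinearMap.opNorm_nonneg _, h1⟩
  -- The norms ‖l_i‖ increase from b to at most a = ‖l‖, so C = a / b works.
  · set b := ‖(M.linPart (Finset.Iic N) : M.src (Finset.Iic N) →L[ℝ] M.tgt (Finset.Iic N))‖
    have hb : 0 < b := lt_of_le_of_ne (ContinuousLinearMap.opNorm_nonneg _) h0.symm
    have hab : b ≤ a := M.norm_linPart_le _
    have ha0 : 0 < a := hb.trans_le hab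
    refine ⟨a / b, by positivity, fun i => ⟨?_, ?_⟩⟩
    · rw [inv_div, div_mul_cancel₀ _ ha0.ne']
      exact hge i
    · refine (hle i).trans ?_
      exact le_mul_of_one_le_left ha0.le ((one_le_div hb).2 hab)

end ModelCase

/-! ### Almost orthogonality and the normal vectors of the Bott maps β_{ba}. -/

section LinearBott

set_option linter.unusedSectionVars false

variable {H' H : Type*} [NormedAddCommGroup H'] [InnerProductSpace ℝ H'] [CompleteSpace H']
  [NormedAddCommGroup H] [InnerProductSpace ℝ H] [CompleteSpace H]

variable (l : H' ≃L[ℝ] H)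

theorem polarUnitary_indOp (x : H') : polarUnitary l (indOp l x) = l x :=
  (polarUnitary l).apply_symm_apply (l x)

theorem indOp_eq_absOp (x : H') :
    indOp l x = absOp (l : H' →L[ℝ] H) (bounded_below_of_equiv l) x := by
  refine (polarUnitary l).injective ?_
  rw [polarUnitary_indOp]
  exact (polarIsometry_absOp (l : H' →L[ℝ] H) (bounded_below_of_equiv l) x).symm

theorem inner_indOp_left (x y : H') : ⟪indOp l x, y⟫_ℝ = ⟪x, indOp l y⟫_ℝ := by
  rw [indOp_eq_absOp, indOp_eq_absOp]
  exact (absOp_isPositive (l : H' →L[ℝ] H) (bounded_below_of_equiv l)).isSymmetric x y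

theorem norm_le_indOp (x : H') : ‖x‖ ≤ ‖((indOp l).symm : H' →L[ℝ] H')‖ * ‖indOp l x‖ := by
  simpa using ((indOp l).symm : H' →L[ℝ] H').le_opNorm (indOp l x)

theorem indOp_le_norm (x : H') : ‖indOp l x‖ ≤ ‖(indOp l : H' →L[ℝ] H')‖ * ‖x‖ :=
  (indOp l : H' →L[ℝ] H').le_opNorm x

/-- For large `E`, the subspaces `C(E)` and `C(Eᗮ)` are almost orthogonal. -/
theorem AsymUnitary.exists_norm_proj_le {l : H' ≃L[ℝ] H} (hl : AsymUnitary l) {ε : ℝ}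
    (hε : 0 < ε) : ∃ E₀ : FinSub H', ∀ E ≥ E₀, ∀ w ∈ E.1ᗮ,
      ‖(barSub l E.1).orthogonalProjectionOnto (indOp l w)‖ ≤ ε * ‖w‖ := by
  set a := ‖(indOp l : H' →L[ℝ] H')‖
  set b := ‖((indOp l).symm : H' →L[ℝ] H')‖
  have ha : 0 ≤ a := ContinuousLinearMap.opNorm_nonneg _
  have hb : 0 ≤ b := ContinuousLinearMap.opNorm_nonneg _
  obtain ⟨V, hV, h⟩ := hl (ε / ((a + 1) * (b + 1))) (by positivity)
  refine ⟨⟨V, hV⟩, fun E hE w hw => ?_⟩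
  set η := ε / ((a + 1) * (b + 1)) with hη
  have hη0 : 0 < η := by positivity
  have hVE : V ≤ E.1 := hE
  have h1 : ‖indOp l w - w‖ ≤ η * ‖w‖ := by
    rw [← (polarUnitary l).norm_map, map_sub, polarUnitary_indOp]
    exact h w (Submodule.orthogonal_le hVE hw)
  have h2 : ‖indOp l (indOp l w) - w‖ ≤ (a + 1) * (η * ‖w‖) := by
    have h3 : indOp l (indOp l w) - w = indOp l (indOp l w - w) + (indOp l w - w) := by
      rw [map_sub]; abel
    rw [h3]
    refine (norm_add_le _ _).trans ?_
    have h4 : ‖indOp l (indOp l w - w)‖ ≤ a * (η * ‖w‖) :=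
      (indOp_le_norm l _).trans (by gcongr)
    linarith
  set p := (barSub l E.1).orthogonalProjectionOnto (indOp l w) with hp
  obtain ⟨e, he, hep⟩ := p.2
  -- With p = C e and C symmetric, ⟪p, p⟫ = ⟪C w, C e⟫ = ⟪C² w − w, e⟫, as w is orthogonal to e ∈ E.
  -- On Vᗮ the operator C is close to 1, so C² w − w is small, and ‖e‖ ≤ ‖C⁻¹‖ ‖p‖.
  have h5 : ‖p‖ ^ 2 = ⟪indOp l (indOp l w) - w, e⟫_ℝ := by
    have h6 : ⟪w, e⟫_ℝ = 0 := by rw [real_inner_comm]; exact hw e he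
    have h7 : ⟪p, p⟫_ℝ = ⟪indOp l w, (p : H')⟫_ℝ :=
      Submodule.inner_orthogonalProjectionOnto_eq_of_mem_right p (indOp l w)
    have h8 : (p : H') = indOp l e := hep.symm
    rw [← real_inner_self_eq_norm_sq, h7, h8, ← inner_indOp_left, inner_sub_left, h6, sub_zero]
  have h9 : ‖e‖ ≤ b * ‖p‖ := by
    have := norm_le_indOp l e
    have h8 : indOp l e = (p : H') := hep
    rw [h8] at this
    exact this
  have h10 : ‖p‖ ^ 2 ≤ ((a + 1) * (η * ‖w‖)) * (b * ‖p‖) := by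
    rw [h5]
    exact (real_inner_le_norm _ _).trans (by gcongr)
  have h11 : (a + 1) * (η * ‖w‖) * b ≤ ε * ‖w‖ := by
    have : ε = η * ((a + 1) * (b + 1)) := by rw [hη]; field_simp
    have h12 : ε * ‖w‖ = (a + 1) * (η * ‖w‖) * (b + 1) := by
      rw [this]; ring
    rw [h12]
    gcongr
    linarith
  by_cases h0 : ‖p‖ = 0
  · rw [h0]; positivity
  · have h13 : 0 < ‖p‖ := lt_of_le_of_ne (norm_nonneg _) (Ne.symm h0)
    by_contra hc
    have h14 : ε * ‖w‖ * ‖p‖ < ‖p‖ * ‖p‖ := by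
      have := not_le.1 hc
      gcongr
    nlinarith

variable {l} {Ea Eb Ec : Submodule ℝ H'} [FiniteDimensional ℝ Ea] [FiniteDimensional ℝ Eb]
  [FiniteDimensional ℝ Ec]

theorem prHat_apply (h : Ea ≤ Eb) (z : barSub l (Eb ⊓ Eaᗮ)) :
    (prHat l Ea Eb z : H') = z - (barSub l Ea).orthogonalProjectionOnto (z : H') := by
  have hle : barSub l Ea ≤ barSub l Eb := Submodule.map_mono h
  refine Submodule.eq_starProjection_of_mem_of_inner_eq_zero ⟨?_, ?_⟩ fun w hw => ?_
  · exact (barSub l Eb).sub_mem (Submodule.map_mono inf_le_left z.2) (hle (Subtype.property _))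
  · exact Submodule.sub_starProjection_mem_orthogonal _
  · change ⟪(z : H') - (z - (barSub l Ea).orthogonalProjectionOnto (z : H')), w⟫_ℝ = 0
    rw [sub_sub_cancel]
    exact hw.2 _ (Subtype.property _)

theorem prHat_adjoint (z : (barSub l Eb ⊓ (barSub l Ea)ᗮ : Submodule ℝ H')) :
    (prHat l Ea Eb).adjoint z =
      (barSub l (Eb ⊓ Eaᗮ)).orthogonalProjectionOnto (z : H') := by
  refine ext_inner_left ℝ fun v => ?_
  rw [ContinuousLinearMap.adjoint_inner_right]
  change ⟪(barSub l Eb ⊓ (barSub l Ea)ᗮ).orthogonalProjectionOnto (v : H'), z⟫_ℝ = _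
  rw [Submodule.inner_orthogonalProjectionOnto_eq_of_mem_right,
    Submodule.inner_orthogonalProjectionOnto_eq_of_mem_left]

/-- This measures how far the projection is from being isometric: the defect is governed by the
component of z in Ē'_a, which almost orthogonality makes small. -/
theorem sub_prHat_adjoint (h : Ea ≤ Eb) (z : barSub l (Eb ⊓ Eaᗮ)) :
    z - (prHat l Ea Eb).adjoint (prHat l Ea Eb z) = (barSub l (Eb ⊓ Eaᗮ)).orthogonalProjectionOnto
      ((barSub l Ea).orthogonalProjectionOnto (z : H') : H') := by
  rw [prHat_adjoint, prHat_apply h, map_sub,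
    Submodule.orthogonalProjectionOnto_mem_subspace_eq_self, sub_sub_cancel]

/-- Two errors occur, one from replacing the projection by its polar isometry and one from replacing
C w by its projection. Each is at most the component of C w in Ē'_a. -/
theorem norm_linNormal_sub_le (h : Ea ≤ Eb) (y : Eb) :
    ‖(linNormal (l := l) h y : H') - indOp l (y - Ea.starProjection y)‖ ≤
      2 * ‖(barSub l Ea).orthogonalProjectionOnto (indOp l (y - Ea.starProjection y))‖ := by
  set z : barSub l (Eb ⊓ Eaᗮ) := ⟨indOp l (y - Ea.starProjection y), Submodule.mem_map_of_mem
      ⟨Eb.sub_mem y.2 (h (Submodule.starProjection_apply_mem _ _)),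
        Submodule.sub_starProjection_mem_orthogonal _⟩⟩ with hz
  have h1 := norm_polarIsometry_sub_le (prHat l Ea Eb) (prHat_bounded_below h) z
  rw [sub_prHat_adjoint h] at h1
  have h2 := h1.trans (Submodule.norm_orthogonalProjectionOnto_apply_le _ _)
  have h3 : (linNormal (l := l) h y : H') - indOp l (y - Ea.starProjection y) =
      ((polarIsometry (prHat l Ea Eb) (prHat_bounded_below h) z - prHat l Ea Eb z :
        (barSub l Eb ⊓ (barSub l Ea)ᗮ : Submodule ℝ H')) : H') -
      (barSub l Ea).orthogonalProjectionOnto (z : H') := by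
    rw [Submodule.coe_sub, prHat_apply h]
    change (polarIsometry (prHat l Ea Eb) (prHat_bounded_below h) z : H') - (z : H') = _
    abel
  rw [h3, two_mul]
  exact (norm_sub_le _ _).trans (add_le_add h2 le_rfl)

theorem norm_linNormal (h : Ea ≤ Eb) (y : Eb) :
    ‖linNormal (l := l) h y‖ = ‖indOp l (y - Ea.starProjection y)‖ :=
  (polarIsometry (prHat l Ea Eb) (prHat_bounded_below h)).norm_map _

theorem linNormal_add (h : Ea ≤ Eb) (y y' : Eb) :
    linNormal (l := l) h (y + y') = linNormal h y + linNormal h y' := by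
  unfold linNormal
  rw [← map_add, ← map_add]
  congr 2
  refine Subtype.ext ?_
  simp only [Submodule.coe_add, map_add, AddMemClass.mk_add_mk, map_sub]
  abel

theorem linNormal_sub (h : Ea ≤ Eb) (y y' : Eb) :
    linNormal (l := l) h (y - y') = linNormal h y - linNormal h y' := by
  rw [eq_sub_iff_add_eq, ← linNormal_add, sub_add_cancel]

theorem continuous_linNormal (h : Ea ≤ Eb) : Continuous (linNormal (l := l) h) := by
  unfold linNormal
  refine (inclIso _).continuous.comp ((LinearIsometry.continuous _).comp ?_)
  refine Continuous.subtype_mk ?_ _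
  exact (indOp l).continuous.comp (continuous_subtype_val.sub
    (Ea.starProjection.continuous.comp continuous_subtype_val))

/-- The projection to `C(Eb ⊖ Ea)` in terms of the projection to `C⁻¹(Ea)`. -/
theorem proj_barSub_inf (h : Ea.map ((indOp l).symm : H' →ₗ[ℝ] H') ≤ barSub l Eb) {z : H'}
    (hz : z ∈ barSub l Eb) :
    ((barSub l (Eb ⊓ Eaᗮ)).orthogonalProjectionOnto z : H') =
      z - (Ea.map ((indOp l).symm : H' →ₗ[ℝ] H')).starProjection z := by
  set G := Ea.map ((indOp l).symm : H' →ₗ[ℝ] H')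
  refine Submodule.eq_starProjection_of_mem_of_inner_eq_zero ?_ fun w hw => ?_
  · obtain ⟨x, hx, hxz⟩ := (barSub l Eb).sub_mem hz (h (Submodule.starProjection_apply_mem G z))
    refine ⟨x, ⟨hx, fun e he => ?_⟩, hxz⟩
    have h1 : ⟪(indOp l).symm e, z - G.starProjection z⟫_ℝ = 0 :=
      Submodule.sub_starProjection_mem_orthogonal z _ (Submodule.mem_map_of_mem he)
    have h2 : z - G.starProjection z = indOp l x := hxz.symm
    rw [h2, ← inner_indOp_left, ContinuousLinearEquiv.apply_symm_apply] at h1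
    exact h1
  · rw [sub_sub_cancel]
    obtain ⟨e, he, hez⟩ := Submodule.starProjection_apply_mem G z
    obtain ⟨x, hx, rfl⟩ := hw
    have h2 : G.starProjection z = (indOp l).symm e := hez.symm
    rw [h2]
    change ⟪(indOp l).symm e, indOp l x⟫_ℝ = 0
    rw [← inner_indOp_left, ContinuousLinearEquiv.apply_symm_apply]
    exact hx.2 e he

/-- The maps `linNormal` do not depend on the larger subspace if it is large enough. -/
theorem linNormal_of_le (hab : Ea ≤ Eb) (hbc : Eb ≤ Ec)
    (h : Ea.map ((indOp l).symm : H' →ₗ[ℝ] H') ≤ barSub l Eb) (y : Eb) :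
    (linNormal (l := l) (hab.trans hbc) (inclIso hbc y) : H') = linNormal (l := l) hab y := by
  have hbc' : barSub l Eb ≤ barSub l Ec := Submodule.map_mono hbc
  have h1 : barSub l (Eb ⊓ Eaᗮ) ≤ barSub l (Ec ⊓ Eaᗮ) :=
    Submodule.map_mono (inf_le_inf_right _ hbc)
  have h2 : (barSub l Eb ⊓ (barSub l Ea)ᗮ : Submodule ℝ H') ≤ barSub l Ec ⊓ (barSub l Ea)ᗮ :=
    inf_le_inf_right _ hbc'
  -- Once C⁻¹(E'_a) ⊆ Ē'_b, the projection to C(E'_b ⊖ E'_a) subtracts the component in C⁻¹(E'_a),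
  -- whatever the larger subspace is. So pr^* pr and the polar isometry for E'_c restrict to those
  -- for E'_b.
  have key := polarIsometry_comp_eq (prHat l Ea Ec) (prHat_bounded_below (hab.trans hbc))
    (prHat l Ea Eb) (prHat_bounded_below hab) (Submodule.inclusion h1) (Submodule.inclusion h2)
    (fun z => by
      have h3 := congrArg Subtype.val (sub_prHat_adjoint (hab.trans hbc) (Submodule.inclusion h1 z))
      have h4 := congrArg Subtype.val (sub_prHat_adjoint hab z)
      have h5 : ((barSub l Ea).orthogonalProjectionOnto (z : H') : H') ∈ barSub l Eb :=
        Submodule.map_mono hab (Subtype.property _)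
      rw [Submodule.coe_sub, proj_barSub_inf h h5] at h4
      rw [Submodule.coe_sub] at h3
      have h6 := h3.trans (proj_barSub_inf (h.trans hbc') (hbc' h5))
      refine Subtype.ext ?_
      have h7 := h6.trans h4.symm
      exact sub_right_injective h7)
    (fun z => Subtype.ext (by
      rw [prHat_apply (hab.trans hbc)]
      exact (prHat_apply hab z).symm))
  have h8 := congrArg Subtype.val (key ⟨indOp l (y - Ea.starProjection y),
    Submodule.mem_map_of_mem ⟨Eb.sub_mem y.2 (hab (Submodule.starProjection_apply_mem _ _)),
        Submodule.sub_starProjection_mem_orthogonal _⟩⟩)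
  exact h8

/-- On vectors orthogonal to a large subspace `linNormal` is the operator `C`. -/
theorem linNormal_of_mem_orthogonal (hab : Ea ≤ Eb) (y : Eb) (hy : (y : H') ∈ Eaᗮ)
    (hy' : ∀ e ∈ Ea, ⟪indOp l (indOp l e), (y : H')⟫_ℝ = 0) :
    (linNormal (l := l) hab y : H') = indOp l y := by
  have h1 := norm_linNormal_sub_le (l := l) hab y
  have h2 : Ea.starProjection (y : H') = 0 := (Submodule.starProjection_apply_eq_zero_iff _).2 hy
  -- Under `hy'`, C y is orthogonal to Ē'_a, and the error bound of the previous lemmas becomes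
  -- zero.
  have h3 : (barSub l Ea).orthogonalProjectionOnto (indOp l (y : H')) = 0 := by
    rw [Submodule.orthogonalProjectionOnto_eq_zero_iff, Submodule.mem_orthogonal]
    rintro _ ⟨e, he, rfl⟩
    change ⟪indOp l e, indOp l (y : H')⟫_ℝ = 0
    rw [← inner_indOp_left]
    exact hy' e he
  rw [h2, sub_zero, h3, norm_zero, mul_zero] at h1
  exact sub_eq_zero.1 (norm_le_zero_iff.1 h1)

end LinearBott

/-! ### The classes of the nets l^*(β(u)) and their approximation by generators of S𝔠_l(H'). -/

section LinearHom

set_option linter.unusedSectionVars false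

variable {H' H : Type*} [NormedAddCommGroup H'] [InnerProductSpace ℝ H'] [CompleteSpace H']
  [NormedAddCommGroup H] [InnerProductSpace ℝ H] [CompleteSpace H]

variable (l : H' ≃L[ℝ] H)

/-- The image of a finite-dimensional subspace under `l`. -/
abbrev imageSub (E : Submodule ℝ H') : Submodule ℝ H := E.map (l : H' →ₗ[ℝ] H)

/-- The point `l v` of `l(E)`. -/
def imagePoint (E : Submodule ℝ H') (v : E) : imageSub l E := ⟨l v, Submodule.mem_map_of_mem v.2⟩

/-- The net `E' ↦ l^*(β(u))`. -/
def linFam (W : Submodule ℝ H) [FiniteDimensional ℝ W] (u : BFun W W) :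
    lp (fun p : Σ E : FinSub H', ℝ × E.1 => Cl (EPlus (barSub l p.1.1))) ∞ :=
  famOf (X := fun E : FinSub H' => E.1) (V := fun E : FinSub H' => barSub l E.1)
    (fun E' => W ≤ imageSub l E'.1) (fun E' h => linPull l E'.1 (bott h u)) ‖u‖
    fun _ h => (norm_pullBack_le _ _ _).trans (norm_bott_le h u)

/-- The homomorphism that sends `u` to the class of the net `E' ↦ l^*(β(u))`. -/
def linHom (W : Submodule ℝ H) [FiniteDimensional ℝ W] : BFun W W →⋆ₙₐ[ℂ] LinNets l :=
  (AsymAlg.mkHom (comap Sigma.fst atTop)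
    (fun p : Σ E : FinSub H', ℝ × E.1 => Cl (EPlus (barSub l p.1.1)))).comp
  (famHom (X := fun E : FinSub H' => E.1) (V := fun E : FinSub H' => barSub l E.1)
    (fun E' => W ≤ imageSub l E'.1)
    (fun E' h => (pullBackHom (polarInv l E'.1) (imagePoint l E'.1)).comp (bottHom h))
    (fun _ h u => (norm_pullBack_le _ _ _).trans (norm_bott_le h u)))

theorem linHom_apply (W : Submodule ℝ H) [FiniteDimensional ℝ W] (u : BFun W W) :
    linHom l W u = AsymAlg.mk _ _ (linFam l W u) := rfl

variable {W W₁ W₂ : Submodule ℝ H} [FiniteDimensional ℝ W] [FiniteDimensional ℝ W₁]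
  [FiniteDimensional ℝ W₂]

theorem linFam_apply (u : BFun W W) (E : FinSub H') (h : W ≤ imageSub l E.1) (x : ℝ) (v : E.1) :
    linFam l W u ⟨E, x, v⟩ = linPull l E.1 (bott h u) (x, v) := dif_pos h

theorem linNet_apply {E E' : FinSub H'} (h : BFun E.1 (barSub l E.1)) (hE : E ≤ E') (x : ℝ)
    (v : E'.1) : linNet l E h ⟨E', x, v⟩ = linBott hE h (x, v) := dif_pos hE

theorem norm_linFam_apply (u : BFun W W) (E : FinSub H') (h : W ≤ imageSub l E.1) (x : ℝ)
    (v : E.1) : ‖linFam l W u ⟨E, x, v⟩‖ = profile W u x (l v) := by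
  rw [linFam_apply l u E h]
  exact (Cl.norm_map _ _).trans (norm_bott_apply h u x (imagePoint l E.1 v))

/-- A finite-dimensional subspace of the source whose image contains `W`. -/
def preimageSub (W : Submodule ℝ H) [FiniteDimensional ℝ W] : FinSub H' :=
  ⟨W.map (l.symm : H →ₗ[ℝ] H'), inferInstance⟩

theorem le_imageSub {E : FinSub H'} (h : preimageSub l W ≤ E) : W ≤ imageSub l E.1 := by
  intro w hw
  have h' : W.map (l.symm : H →ₗ[ℝ] H') ≤ E.1 := h
  exact ⟨l.symm w, h' (Submodule.mem_map_of_mem hw), l.apply_symm_apply w⟩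

/-- As in the hub: the member at E has norm the supremum of the profiles over l(E), and the
subspaces E exhaust H'. -/
theorem norm_linHom_le_iff (u : BFun W W) {c : ℝ} (hc : 0 ≤ c) :
    ‖linHom l W u‖ ≤ c ↔ ∀ x v, profile W u x (l v) ≤ c := by
  rw [linHom_apply]
  refine (AsymAlg.norm_mk_le_iff (linFam l W u) hc).trans ?_
  constructor
  · intro hu x v
    refine le_of_forall_pos_le_add fun ε hε => ?_
    have := hu ε hε
    rw [eventually_comap, eventually_atTop] at this
    obtain ⟨E₀, hE₀⟩ := this
    let E' : FinSub H' := ⟨E₀.1 ⊔ ((preimageSub l W).1 ⊔ Submodule.span ℝ {v}), inferInstance⟩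
    have h1 : v ∈ E'.1 := (le_sup_right.trans le_sup_right : _ ≤ E'.1)
      (Submodule.mem_span_singleton_self _)
    have h2 : preimageSub l W ≤ E' := Subtype.coe_le_coe.1 (le_sup_left.trans le_sup_right)
    have h3 := hE₀ E' (Subtype.coe_le_coe.1 le_sup_left) ⟨E', x, ⟨v, h1⟩⟩ rfl
    rw [norm_linFam_apply l u E' (le_imageSub l h2)] at h3
    exact h3
  · intro hu ε hε
    rw [eventually_comap, eventually_atTop]
    refine ⟨preimageSub l W, ?_⟩
    rintro _ hE' ⟨E', x, v⟩ rfl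
    rw [norm_linFam_apply l u E' (le_imageSub l hE')]
    exact (hu x v).trans (by linarith)

theorem linHom_bott (h : W₁ ≤ W₂) (u : BFun W₁ W₁) :
    linHom l W₂ (bott h u) = linHom l W₁ u := by
  rw [linHom_apply, linHom_apply]
  refine AsymAlg.mk_eq_mk_of_eventually ?_
  rw [eventually_comap, eventually_atTop]
  refine ⟨preimageSub l W₂, ?_⟩
  rintro _ hE' ⟨E', x, v⟩ rfl
  have h2 := le_imageSub l hE'
  rw [linFam_apply l _ E' h2, linFam_apply l _ E' (h.trans h2), bott_bott]

/-- The directed family of the algebras `S𝔠(W)`, mapped to nets over the source. -/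
def linSystem : BottSystem (fun v => l v) (LinNets l) (FinSub H) where
  E := Subtype.val
  finite_dim i := i.2
  mono _ _ h := h
  S W := SCliff W.1 W.1
  S_le _ := le_rfl
  bott_mem _ _ _ _ hu := SCliff.bott_mem _ hu
  hom W := linHom l W.1
  hom_bott _ _ h u _ := linHom_bott l h u
  norm_le_iff _ u _ _ hc := norm_linHom_le_iff l u hc
  dense E₀ _ u hu ε hε := ⟨⟨E₀, inferInstance⟩, u, hu, by
    rw [sub_self, norm_zero]
    exact hε.le⟩

theorem AsymAlg.norm_mk_sub_mk_le {P : Type*} {F : Filter P} {B : P → Type*}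
    [∀ p, NonUnitalCStarAlgebra (B p)] {a b : lp B ∞} {ε : ℝ} (hε : 0 ≤ ε)
    (h : ∀ᶠ p in F, ‖a p - b p‖ ≤ ε) : ‖AsymAlg.mk F B a - AsymAlg.mk F B b‖ ≤ ε := by
  have h1 : AsymAlg.mk F B a - AsymAlg.mk F B b = AsymAlg.mk F B (a - b) :=
    (map_sub (AsymAlg.mkHom F B) a b).symm
  rw [h1]
  refine (AsymAlg.norm_mk_le_iff _ hε).2 fun η hη => ?_
  filter_upwards [h] with p hp
  change ‖a p - b p‖ ≤ _
  linarith

/-- The unitary l̄ carries Ē' onto l(E'), so it intertwines the two projections. -/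
theorem proj_imageSub (E : Submodule ℝ H') [FiniteDimensional ℝ E] (z : H') :
    ((imageSub l E).orthogonalProjectionOnto (polarUnitary l z) : H) =
      polarUnitary l ((barSub l E).orthogonalProjectionOnto z) := by
  refine Submodule.eq_starProjection_of_mem_of_inner_eq_zero ?_ fun w hw => ?_
  · obtain ⟨e, he, hep⟩ := ((barSub l E).orthogonalProjectionOnto z).2
    refine ⟨e, he, ?_⟩
    rw [← hep]
    exact (polarUnitary_indOp l e).symm
  · obtain ⟨e, he, rfl⟩ := hw
    change ⟪_, l e⟫_ℝ = 0
    rw [← polarUnitary_indOp l e, ← map_sub, LinearIsometryEquiv.inner_map_map]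
    exact sub_orthogonalProjectionOnto_inner z
      (⟨indOp l e, Submodule.mem_map_of_mem he⟩ : barSub l E)

theorem norm_proj_imageSub (E : Submodule ℝ H') [FiniteDimensional ℝ E] (v : H') :
    ‖(imageSub l E).orthogonalProjectionOnto (l v)‖ =
      ‖(barSub l E).orthogonalProjectionOnto (indOp l v)‖ := by
  have h := congrArg norm (proj_imageSub l E (indOp l v))
  rw [polarUnitary_indOp, LinearIsometryEquiv.norm_map] at h
  exact h

theorem linPull_bott_apply {E : Submodule ℝ H'} [FiniteDimensional ℝ E] (h : W ≤ imageSub l E)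
    (u : BFun W W) (x : ℝ) (y : E) (hN : ∀ w, ⟪polarInv l E (imagePoint l E y -
        inclIso h (W.orthogonalProjectionOnto (l y))), (polarInv l E).comp (inclIso h) w⟫_ℝ = 0) :
    linPull l E (bott h u) (x, y) = bottFibre ((polarInv l E).comp (inclIso h))
      (EPlus.mk x (polarInv l E (imagePoint l E y - inclIso h (W.orthogonalProjectionOnto (l y)))))
      hN (fun t => u (t, W.orthogonalProjectionOnto (l y))) :=
  map_bottFibre (polarInv l E) (inclIso h) x
    (imagePoint l E y - inclIso h (W.orthogonalProjectionOnto (l y)))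
    (fun v => sub_orthogonalProjectionOnto_inner (l y) v)
    (fun t => u (t, W.orthogonalProjectionOnto (l y)))

theorem polarInv_inner {E : Submodule ℝ H'} [FiniteDimensional ℝ E] (h : W ≤ imageSub l E)
    (y : E) (w : W) : ⟪polarInv l E (imagePoint l E y -
        inclIso h (W.orthogonalProjectionOnto (l y))), (polarInv l E).comp (inclIso h) w⟫_ℝ = 0 :=
  ((polarInv l E).inner_map_map _ _).trans (sub_orthogonalProjectionOnto_inner (l y) w)

theorem polarInv_coe_sub {E : Submodule ℝ H'} [FiniteDimensional ℝ E] (h : W ≤ imageSub l E)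
    (y : E) : (polarInv l E (imagePoint l E y - inclIso h (W.orthogonalProjectionOnto (l y))) : H') =
      indOp l y - (polarUnitary l).symm (W.orthogonalProjectionOnto (l y)) :=
  map_sub (polarUnitary l).symm _ _

/-- This converts errors proportional to ‖y‖ into the form admitted by
`SCliff.exists_bottFibre_sub_le`. -/
theorem norm_le_of_imagePoint {E : Submodule ℝ H'} [FiniteDimensional ℝ E]
    (h : W ≤ imageSub l E) (x : ℝ) (y : E) :
    ‖(y : H')‖ ≤ ‖((indOp l).symm : H' →L[ℝ] H')‖ * (‖EPlus.mk x (polarInv l E (imagePoint l E y -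
      inclIso h (W.orthogonalProjectionOnto (l y))))‖ + ‖W.orthogonalProjectionOnto (l y)‖) := by
  refine (norm_le_indOp l _).trans ?_
  have hb := ContinuousLinearMap.opNorm_nonneg ((indOp l).symm : H' →L[ℝ] H')
  gcongr
  rw [← (polarUnitary l).norm_map, polarUnitary_indOp]
  have h1 := norm_add_le (imagePoint l E y - inclIso h (W.orthogonalProjectionOnto (l y)))
    (inclIso h (W.orthogonalProjectionOnto (l y)))
  rw [sub_add_cancel, LinearIsometry.norm_map] at h1
  refine h1.trans (add_le_add ?_ le_rfl)
  rw [← (polarInv l E).norm_map]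
  exact EPlus.norm_le_norm_mk _ _

/-- The inclusion `Ē'_a → Ē'_b`. -/
def barIncl (l : H' ≃L[ℝ] H) {Ea Eb : Submodule ℝ H'} (h : Ea ≤ Eb) :
    barSub l Ea →ₗᵢ[ℝ] barSub l Eb :=
  inclIso (Submodule.map_mono h)

theorem linNormal_inner {Ea Eb : Submodule ℝ H'} [FiniteDimensional ℝ Ea] [FiniteDimensional ℝ Eb]
    (h : Ea ≤ Eb) (y : Eb) (v : barSub l Ea) : ⟪linNormal (l := l) h y, barIncl l h v⟫_ℝ = 0 := by
  have h1 : ⟪(v : H'), (linNormal (l := l) h y : H')⟫_ℝ = 0 :=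
    (polarIsometry (prHat l Ea Eb) (prHat_bounded_below h) _).2.2 v v.2
  rw [real_inner_comm] at h1
  exact h1

theorem linBott_apply {Ea Eb : Submodule ℝ H'} [FiniteDimensional ℝ Ea] [FiniteDimensional ℝ Eb]
    (h : Ea ≤ Eb) (g : BFun Ea (barSub l Ea)) (x : ℝ) (y : Eb) :
    linBott h g (x, y) = bottFibre (barIncl l h) (EPlus.mk x (linNormal h y))
      (linNormal_inner l h y) (fun t => g (t, Ea.orthogonalProjectionOnto (y : H'))) := rfl

theorem linBott_linPull_apply {E Eb : Submodule ℝ H'} [FiniteDimensional ℝ E]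
    [FiniteDimensional ℝ Eb] (h : W ≤ imageSub l E) (hE : E ≤ Eb) (u : BFun W W) (x : ℝ) (y : Eb)
    (yE : E) (hyE : yE = E.orthogonalProjectionOnto (y : H')) :
    linBott hE (linPull l E (bott h u)) (x, y) =
      bottFibre ((barIncl l hE).comp ((polarInv l E).comp (inclIso h)))
        (EPlus.mk x (linNormal hE y + barIncl l hE (polarInv l E (imagePoint l E yE -
          inclIso h (W.orthogonalProjectionOnto (l yE))))))
        (inner_add_comp_eq_zero (linNormal_inner l hE y) (polarInv_inner l h yE))
        (fun t => u (t, W.orthogonalProjectionOnto (l yE))) := by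
  subst hyE
  refine Eq.trans ?_ (bottFibre_bottFibre (barIncl l hE) ((polarInv l E).comp (inclIso h)) x
    (linNormal hE y) _ (linNormal_inner l hE y) (polarInv_inner l h _) _)
  refine (linBott_apply l hE _ x y).trans ?_
  exact bottFibre_congr (hn₁ := linNormal_inner l hE y) (hn₂ := linNormal_inner l hE y) rfl rfl
    (funext fun t => linPull_bott_apply l h u t _ (polarInv_inner l h _))

/-- The class of the net `l^*(β(u))` is the limit of the elements of the direct limit given by its
members. -/
theorem exists_linHom_sub_le (hl : AsymUnitary l) {u : BFun W W} (hu : u ∈ SCliff W W) {ε : ℝ}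
    (hε : 0 < ε) : ∃ E₀ : FinSub H', ∀ E ≥ E₀, ∀ h : W ≤ imageSub l E.1,
      ‖linHom l W u - AsymAlg.mk _ _ (linNet l E (linPull l E.1 (bott h u)))‖ ≤ ε := by
  obtain ⟨δ, hδ, key⟩ := SCliff.exists_bottFibre_sub_le hu hε
  set b := ‖((indOp l).symm : H' →L[ℝ] H')‖ with hb
  have hb0 : 0 ≤ b := ContinuousLinearMap.opNorm_nonneg _
  -- Three errors of size η‖y‖ arise, two from replacing `linNormal` by C and one from the
  -- projection to W. The factor b + 1 bounds ‖y‖ by the data of the fibre.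
  set η := δ / (3 * (b + 1)) with hη
  have hη0 : 0 < η := by positivity
  obtain ⟨E₀, hE₀⟩ := hl.exists_norm_proj_le hη0
  refine ⟨E₀, fun E hE h => ?_⟩
  rw [linHom_apply]
  refine AsymAlg.norm_mk_sub_mk_le hε.le ?_
  rw [eventually_comap, eventually_atTop]
  refine ⟨E, ?_⟩
  rintro _ hEb ⟨Eb, x, y⟩ rfl
  have hEb' : E.1 ≤ Eb.1 := hEb
  have hb' : W ≤ imageSub l Eb.1 := h.trans (Submodule.map_mono hEb')
  rw [linFam_apply l u Eb hb', linNet_apply l _ hEb, linPull_bott_apply l hb' u x y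
    (polarInv_inner l hb' y)]
  set yE := E.1.orthogonalProjectionOnto (y : H')
  set N₁ := polarInv l Eb.1 (imagePoint l Eb.1 y - inclIso hb' (W.orthogonalProjectionOnto (l y)))
    with hN₁
  set N₂ := polarInv l E.1 (imagePoint l E.1 yE - inclIso h (W.orthogonalProjectionOnto (l yE)))
    with hN₂
  rw [linBott_linPull_apply l h hEb' u x y yE rfl]
  set w : H' := y - E.1.starProjection (y : H') with hw
  have hwE : w ∈ E.1ᗮ := Submodule.sub_starProjection_mem_orthogonal _
  have hwy : ‖w‖ ≤ ‖(y : H')‖ := by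
    have h2 : w = (E.1ᗮ).starProjection (y : H') :=
      (Submodule.starProjection_orthogonal_val (y : H')).symm
    rw [h2]
    exact Submodule.norm_starProjection_apply_le _ _
  have hp : ‖(barSub l E.1).orthogonalProjectionOnto (indOp l w)‖ ≤ η * ‖(y : H')‖ :=
    (hE₀ E hE w hwE).trans (by gcongr)
  have hyb := norm_le_of_imagePoint l hb' x y
  rw [← hb, ← hN₁] at hyb
  have hbound : 3 * (η * ‖(y : H')‖) ≤
      δ * (1 + ‖EPlus.mk x N₁‖ + ‖W.orthogonalProjectionOnto (l y)‖) := by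
    have h2 : 3 * (η * ‖(y : H')‖) ≤ 3 * (η * ((b + 1) * (‖EPlus.mk x N₁‖ +
        ‖W.orthogonalProjectionOnto (l y)‖))) := by
      have : ‖(y : H')‖ ≤ (b + 1) * (‖EPlus.mk x N₁‖ + ‖W.orthogonalProjectionOnto (l y)‖) :=
        hyb.trans (by gcongr; linarith)
      gcongr
    have h3 : 3 * (η * ((b + 1) * (‖EPlus.mk x N₁‖ + ‖W.orthogonalProjectionOnto (l y)‖))) =
        δ * (‖EPlus.mk x N₁‖ + ‖W.orthogonalProjectionOnto (l y)‖) := by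
      rw [hη]; field_simp
    rw [h3] at h2
    refine h2.trans ?_
    gcongr
    linarith
  have hyw : l y - l yE = l w := by
    rw [← map_sub]
    rfl
  have hW : ‖W.orthogonalProjectionOnto (l y) - W.orthogonalProjectionOnto (l yE)‖ ≤
      η * ‖(y : H')‖ := by
    rw [← map_sub, hyw, ← orthogonalProjectionOnto_coe_of_le h]
    refine (Submodule.norm_orthogonalProjectionOnto_apply_le _ _).trans ?_
    exact (norm_proj_imageSub l E.1 w).trans_le hp
  refine key _ _ _ _ _ (polarInv_inner l hb' y) _ _ _ (fun v => ?_) ?_ ?_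
  · have h2 : (polarInv l Eb.1).comp (inclIso hb') v =
        (barIncl l hEb').comp ((polarInv l E.1).comp (inclIso h)) v := rfl
    rw [h2, sub_self, norm_zero]
    positivity
  · rw [EPlus.mk_sub_mk, sub_self]
    refine (EPlus.norm_inr _).trans_le (le_trans ?_ hbound)
    -- Split y = yE + w along E. The normal vectors differ by the error of `linNormal` on w and by
    -- l̄⁻¹ of the change in the projection to W.
    have h2 : ((N₁ - (linNormal hEb' y + barIncl l hEb' N₂) :
        barSub l Eb.1) : H') = -((linNormal (l := l) hEb' y : H') - indOp l w) -
          (polarUnitary l).symm ((W.orthogonalProjectionOnto (l y) -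
            W.orthogonalProjectionOnto (l yE) : W) : H) := by
      rw [Submodule.coe_sub, Submodule.coe_add]
      change (N₁ : H') - (_ + (N₂ : H')) = _
      rw [hN₁, polarInv_coe_sub l hb' y, hN₂, polarInv_coe_sub l h yE, hw, map_sub,
        Submodule.coe_sub, map_sub]
      change _ = -(_ - (indOp l y - indOp l yE)) - _
      abel
    change ‖((N₁ - (linNormal hEb' y + barIncl l hEb' N₂) :
        barSub l Eb.1) : H')‖ ≤ _
    rw [h2]
    refine (norm_sub_le _ _).trans ?_
    rw [norm_neg, LinearIsometryEquiv.norm_map]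
    have h3 := norm_linNormal_sub_le (l := l) hEb' y
    have h4 : ‖((W.orthogonalProjectionOnto (l y) - W.orthogonalProjectionOnto (l yE) : W) : H)‖ ≤
      η * ‖(y : H')‖ := hW
    linarith
  · refine hW.trans (le_trans ?_ hbound)
    have : 0 ≤ η * ‖(y : H')‖ := by positivity
    linarith

end LinearHom

/-! ### Approximation of the generators of S𝔠_l(H') by classes of nets l^*(β(u)). -/

section LinearGen

set_option linter.unusedSectionVars false

variable {H' H : Type*} [NormedAddCommGroup H'] [InnerProductSpace ℝ H'] [CompleteSpace H']
  [NormedAddCommGroup H] [InnerProductSpace ℝ H] [CompleteSpace H]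

variable (l : H' ≃L[ℝ] H)

theorem norm_sub_proj_le {E : Submodule ℝ H'} [FiniteDimensional ℝ E] (y : H') :
    ‖y - E.starProjection y‖ ≤ ‖y‖ := by
  rw [← Submodule.starProjection_orthogonal_val]
  exact Submodule.norm_starProjection_apply_le _ _

theorem norm_le_proj_add {E : Submodule ℝ H'} [FiniteDimensional ℝ E] (y : H') :
    ‖y‖ ≤ (‖((indOp l).symm : H' →L[ℝ] H')‖ + 1) *
      (‖indOp l (y - E.starProjection y)‖ + ‖E.orthogonalProjectionOnto y‖) := by
  have h1 := norm_add_le (y - E.starProjection y) (E.starProjection y)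
  rw [sub_add_cancel] at h1
  have h2 := norm_le_indOp l (y - E.starProjection y)
  have h3 : ‖E.starProjection y‖ = ‖E.orthogonalProjectionOnto y‖ := rfl
  have h4 := ContinuousLinearMap.opNorm_nonneg ((indOp l).symm : H' →L[ℝ] H')
  have h5 := norm_nonneg (indOp l (y - E.starProjection y))
  have h6 := norm_nonneg (E.orthogonalProjectionOnto y)
  nlinarith [mul_nonneg h4 h6]

theorem linPull_mem (E : Submodule ℝ H') [FiniteDimensional ℝ E]
    {u : BFun (imageSub l E) (imageSub l E)} (hu : u ∈ SCliff (imageSub l E) (imageSub l E)) :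
    linPull l E u ∈ SCliff E (barSub l E) := by
  refine SCliff.pullBack_mem hu (polarInv l E) ?_ fun R => ?_
  · exact Continuous.subtype_mk (l.continuous.comp continuous_subtype_val) _
  · set b := ‖(l.symm : H →L[ℝ] H')‖
    have hb : 0 ≤ b := ContinuousLinearMap.opNorm_nonneg _
    refine ⟨(b + 1) * R, fun y hy => ?_⟩
    have h1 : ‖(y : H')‖ ≤ b * ‖l (y : H')‖ := by
      simpa using (l.symm : H →L[ℝ] H').le_opNorm (l y)
    have h2 : ‖l (y : H')‖ < R := hy
    have h3 := norm_nonneg (l (y : H'))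
    change ‖(y : H')‖ < _
    nlinarith

/-- The isometry `l̄ : Ē' → l(E')`. -/
def polarTo (E : Submodule ℝ H') : barSub l E →ₗᵢ[ℝ] imageSub l E where
  toFun y := ⟨polarUnitary l y, by
    obtain ⟨_, v, hv, rfl⟩ := y
    exact ⟨v, hv, (polarUnitary_indOp l v).symm⟩⟩
  map_add' _ _ := Subtype.ext (by simp)
  map_smul' _ _ := Subtype.ext (by simp)
  norm_map' y := (polarUnitary l).norm_map y

/-- The point `l⁻¹ y` of `E`. -/
def imageInv (E : Submodule ℝ H') (y : imageSub l E) : E := ⟨l.symm y, by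
  obtain ⟨_, v, hv, rfl⟩ := y
  exact (l.symm_apply_apply v).symm ▸ hv⟩

/-- The inverse of `l^*`. -/
def linPush (E : Submodule ℝ H') : BFun E (barSub l E) → BFun (imageSub l E) (imageSub l E) :=
  pullBack (polarTo l E) (imageInv l E)

theorem linPush_mem (E : Submodule ℝ H') [FiniteDimensional ℝ E]
    {h : BFun E (barSub l E)} (hh : h ∈ SCliff E (barSub l E)) :
    linPush l E h ∈ SCliff (imageSub l E) (imageSub l E) := by
  refine SCliff.pullBack_mem hh (polarTo l E) ?_ fun R => ?_
  · exact Continuous.subtype_mk (l.symm.continuous.comp continuous_subtype_val) _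
  · set b := ‖(l : H' →L[ℝ] H)‖
    have hb : 0 ≤ b := ContinuousLinearMap.opNorm_nonneg _
    refine ⟨(b + 1) * R, fun y hy => ?_⟩
    have h1 : ‖(y : H)‖ ≤ b * ‖l.symm (y : H)‖ := by
      simpa using (l : H' →L[ℝ] H).le_opNorm (l.symm y)
    have h2 : ‖l.symm (y : H)‖ < R := hy
    have h3 := norm_nonneg (l.symm (y : H))
    change ‖(y : H)‖ < _
    nlinarith

variable {l} {Ea Eb Ec : Submodule ℝ H'} [FiniteDimensional ℝ Ea] [FiniteDimensional ℝ Eb]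
  [FiniteDimensional ℝ Ec]

theorem linBott_mem (h : Ea ≤ Eb) {g : BFun Ea (barSub l Ea)} (hg : g ∈ SCliff Ea (barSub l Ea)) :
    linBott h g ∈ SCliff Eb (barSub l Eb) := by
  set b := ‖((indOp l).symm : H' →L[ℝ] H')‖
  have hb : 0 ≤ b := ContinuousLinearMap.opNorm_nonneg _
  refine SCliff.bottMap_mem (K := b + 1) hg (barIncl l h) (linNormal_inner l h)
    (Ea.orthogonalProjectionOnto.continuous.comp continuous_subtype_val)
    (continuous_linNormal h) fun y => ?_
  rw [norm_linNormal]
  exact norm_le_proj_add l y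

theorem linPull_bott_linPush_apply (hab : Ea ≤ Eb) (hbc : imageSub l Eb ≤ imageSub l Ec)
    (g : BFun Ea (barSub l Ea)) (x : ℝ) (y : Ec) (y' : Eb)
    (hy' : y' = imageInv l Eb ((imageSub l Eb).orthogonalProjectionOnto (l y))) :
    linPull l Ec (bott hbc (linPush l Eb (linBott hab g))) (x, y) =
      bottFibre ((((polarInv l Ec).comp (inclIso hbc)).comp (polarTo l Eb)).comp (barIncl l hab))
        (EPlus.mk x (polarInv l Ec (imagePoint l Ec y -
          inclIso hbc ((imageSub l Eb).orthogonalProjectionOnto (l y))) +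
          (((polarInv l Ec).comp (inclIso hbc)).comp (polarTo l Eb)) (linNormal hab y')))
        (inner_add_comp_eq_zero (fun v => polarInv_inner l hbc y (polarTo l Eb v))
          (linNormal_inner l hab y'))
        (fun t => g (t, Ea.orthogonalProjectionOnto (y' : H'))) := by
  subst hy'
  refine (linPull_bott_apply l hbc _ x y (polarInv_inner l hbc y)).trans ?_
  refine (bottFibre_map ((polarInv l Ec).comp (inclIso hbc)) (polarTo l Eb)
    (EPlus.mk x (polarInv l Ec (imagePoint l Ec y -
          inclIso hbc ((imageSub l Eb).orthogonalProjectionOnto (l y)))))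
    (polarInv_inner l hbc y) (fun t => linBott hab g (t, imageInv l Eb
      ((imageSub l Eb).orthogonalProjectionOnto (l y))))).trans ?_
  exact bottFibre_bottFibre (((polarInv l Ec).comp (inclIso hbc)).comp (polarTo l Eb))
    (barIncl l hab) x _ _ (fun v => polarInv_inner l hbc y (polarTo l Eb v))
    (linNormal_inner l hab _) _

/-- On the part of y in E'_b the normal vector does not depend on E'_c, by `h`. The part orthogonal
to E'_b is simply mapped by C, by `h'`. -/
theorem linNormal_eq_add (hab : Ea ≤ Eb) (hbc : Eb ≤ Ec)
    (h : Ea.map ((indOp l).symm : H' →ₗ[ℝ] H') ≤ barSub l Eb)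
    (h' : ∀ e ∈ Ea, indOp l (indOp l e) ∈ Eb) (y : Ec) :
    (linNormal (l := l) (hab.trans hbc) y : H') =
      linNormal (l := l) hab (Eb.orthogonalProjectionOnto (y : H')) +
        indOp l (y - Eb.orthogonalProjectionOnto (y : H')) := by
  set y₁ := Eb.orthogonalProjectionOnto (y : H')
  have h1 : y = inclIso hbc y₁ + (y - inclIso hbc y₁) := by abel
  have h2 : ((y - inclIso hbc y₁ : Ec) : H') ∈ Ebᗮ :=
    Submodule.sub_starProjection_mem_orthogonal _
  have h3 := linNormal_of_mem_orthogonal (l := l) (hab.trans hbc) (y - inclIso hbc y₁)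
    (Submodule.orthogonal_le hab h2) fun e he => h2 _ (h' e he)
  conv_lhs => rw [h1]
  rw [linNormal_add, Submodule.coe_add, linNormal_of_le hab hbc h, h3]
  rfl

/-- The element u is β_{ba}(g) carried to l(E'_b) by the inverse of l^*. Over E'_c the two nets
differ only because one projects y to E'_b and the other projects l y to l(E'_b). Almost
orthogonality makes these points close. -/
theorem exists_linNet_sub_le (hl : AsymUnitary l) (Ea : FinSub H') {g : BFun Ea.1 (barSub l Ea.1)}
    (hg : g ∈ SCliff Ea.1 (barSub l Ea.1)) {ε : ℝ} (hε : 0 < ε) :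
    ∃ (W : FinSub H), ∃ u ∈ SCliff W.1 W.1,
      ‖AsymAlg.mk _ _ (linNet l Ea g) - linHom l W.1 u‖ ≤ ε := by
  obtain ⟨δ, hδ, key⟩ := SCliff.exists_bottFibre_sub_le hg hε
  set a := ‖(indOp l : H' →L[ℝ] H')‖ with ha
  set b := ‖((indOp l).symm : H' →L[ℝ] H')‖ with hb
  have ha0 : 0 ≤ a := ContinuousLinearMap.opNorm_nonneg _
  have hb0 : 0 ≤ b := ContinuousLinearMap.opNorm_nonneg _
  -- The difference of the two projected points costs b η‖y‖. Both `linNormal` and C enlarge it by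
  -- at most a, and ‖y‖ contributes a second factor b + 1.
  set η := δ / ((2 * a + 1) * ((b + 1) * (b + 1))) with hη
  have hη0 : 0 < η := by positivity
  obtain ⟨E₀, hE₀⟩ := hl.exists_norm_proj_le hη0
  let C : H' →ₗ[ℝ] H' := (indOp l : H' →ₗ[ℝ] H')
  let C' : H' →ₗ[ℝ] H' := ((indOp l).symm : H' →ₗ[ℝ] H')
  -- E₀ gives almost orthogonality. C²(E'_a) makes C map vectors orthogonal to E'_b to vectors
  -- orthogonal to Ē'_a. C⁻²(E'_a) gives C⁻¹(E'_a) ⊆ Ē'_b.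
  let Eb : FinSub H' := ⟨E₀.1 ⊔ (Ea.1 ⊔ ((Ea.1.map C).map C ⊔ (Ea.1.map C').map C')), inferInstance⟩
  have hE₀b : E₀ ≤ Eb := Subtype.coe_le_coe.1 le_sup_left
  have hab : Ea.1 ≤ Eb.1 := le_sup_left.trans le_sup_right
  have hC : ∀ e ∈ Ea.1, indOp l (indOp l e) ∈ Eb.1 := fun e he =>
    (le_sup_left.trans (le_sup_right.trans le_sup_right) : (Ea.1.map C).map C ≤ Eb.1)
      (Submodule.mem_map_of_mem (Submodule.mem_map_of_mem he))
  have hC' : Ea.1.map C' ≤ barSub l Eb.1 := by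
    intro z hz
    refine ⟨(indOp l).symm z, ?_, (indOp l).apply_symm_apply z⟩
    exact (le_sup_right.trans (le_sup_right.trans le_sup_right) : (Ea.1.map C').map C' ≤ Eb.1)
      (Submodule.mem_map_of_mem hz)
  refine ⟨⟨imageSub l Eb.1, inferInstance⟩, linPush l Eb.1 (linBott hab g),
    linPush_mem l Eb.1 (linBott_mem hab hg), ?_⟩
  rw [linHom_apply]
  refine AsymAlg.norm_mk_sub_mk_le hε.le ?_
  rw [eventually_comap, eventually_atTop]
  refine ⟨Eb, ?_⟩
  rintro _ hbc ⟨Ec, x, y⟩ rfl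
  have hbc' : Eb.1 ≤ Ec.1 := hbc
  have hac : Ea ≤ Ec := Subtype.coe_le_coe.1 (hab.trans hbc')
  have hbi : imageSub l Eb.1 ≤ imageSub l Ec.1 := Submodule.map_mono hbc'
  set q := (imageSub l Eb.1).orthogonalProjectionOnto (l y) with hq
  set y' := imageInv l Eb.1 q with hy'
  rw [linNet_apply l g hac, linFam_apply l _ Ec hbi,
    linPull_bott_linPush_apply hab hbi g x y y' rfl, linBott_apply]
  set y₁ := Eb.1.orthogonalProjectionOnto (y : H') with hy₁
  set w : H' := y - y₁ with hw
  have hwE : w ∈ Eb.1ᗮ := Submodule.sub_starProjection_mem_orthogonal _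
  have hwy : ‖w‖ ≤ ‖(y : H')‖ := by
    have h2 : w = (Eb.1ᗮ).starProjection (y : H') :=
      (Submodule.starProjection_orthogonal_val (y : H')).symm
    rw [h2]
    exact Submodule.norm_starProjection_apply_le _ _
  have hly' : l y' = q := l.apply_symm_apply _
  -- Here l y' is the projection of l y to l(E'_b), and l y₁ − l y' is minus the projection of l w
  -- to l(E'_b), where w is orthogonal to E'_b.
  have hd : ‖(y₁ : H') - y'‖ ≤ b * (η * ‖(y : H')‖) := by
    refine (norm_le_indOp l _).trans ?_
    gcongr
    rw [← (polarUnitary l).norm_map, polarUnitary_indOp, map_sub, hly']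
    have h2 : l y₁ - q = -(((imageSub l Eb.1).orthogonalProjectionOnto (l w) : imageSub l Eb.1) : H) := by
      have h3 : l (y : H') = l y₁ + l w := by rw [← map_add, hw, add_sub_cancel]
      have h4 : (imageSub l Eb.1).orthogonalProjectionOnto (l y₁) = imagePoint l Eb.1 y₁ :=
        Submodule.orthogonalProjectionOnto_mem_subspace_eq_self (imagePoint l Eb.1 y₁)
      rw [hq, h3, map_add, h4, Submodule.coe_add]
      change l y₁ - (l y₁ + _) = _
      abel
    rw [h2, norm_neg]
    exact (norm_proj_imageSub l Eb.1 w).trans_le ((hE₀ Eb hE₀b w hwE).trans (by gcongr))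
  set n := linNormal (l := l) hac y with hn
  set w₁ := Ea.1.orthogonalProjectionOnto (y : H') with hw₁
  have hyb : ‖(y : H')‖ ≤ (b + 1) * (1 + ‖EPlus.mk x n‖ + ‖w₁‖) := by
    have h2 := norm_le_proj_add (E := Ea.1) l (y : H')
    rw [← norm_linNormal (l := l) hac y, ← hb] at h2
    refine h2.trans ?_
    have h3 := EPlus.norm_le_norm_mk x n
    gcongr
    linarith
  have hbound : (2 * a + 1) * (b * (η * ‖(y : H')‖)) ≤ δ * (1 + ‖EPlus.mk x n‖ + ‖w₁‖) := by
    have h2 : (2 * a + 1) * (b * (η * ‖(y : H')‖)) ≤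
        (2 * a + 1) * ((b + 1) * (η * ((b + 1) * (1 + ‖EPlus.mk x n‖ + ‖w₁‖)))) := by
      gcongr
      linarith
    refine h2.trans_eq ?_
    rw [hη]
    field_simp
  have h0 : 0 ≤ b * (η * ‖(y : H')‖) := by positivity
  refine key _ _ _ _ _ (linNormal_inner l hac y) _ _ _ (fun v => ?_) ?_ ?_
  · have h2 : barIncl l hac v = (((polarInv l Ec.1).comp (inclIso hbi)).comp
        (polarTo l Eb.1)).comp (barIncl l hab) v :=
      Subtype.ext ((polarUnitary l).symm_apply_apply _).symm
    rw [h2, sub_self, norm_zero]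
    positivity
  · rw [EPlus.mk_sub_mk, sub_self]
    refine (EPlus.norm_inr _).trans_le (le_trans ?_ hbound)
    have h3 : (((((polarInv l Ec.1).comp (inclIso hbi)).comp (polarTo l Eb.1))
        (linNormal hab y') : barSub l Ec.1) : H') = linNormal (l := l) hab y' :=
      (polarUnitary l).symm_apply_apply _
    -- By additivity of `linNormal` all terms cancel except those in y₁ − y'.
    have h2 : ((n - (polarInv l Ec.1 (imagePoint l Ec.1 y - inclIso hbi q) +
        (((polarInv l Ec.1).comp (inclIso hbi)).comp (polarTo l Eb.1)) (linNormal hab y')) :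
        barSub l Ec.1) : H') =
        (linNormal (l := l) hab (y₁ - y') : H') - indOp l ((y₁ : H') - y') := by
      have h4 : (polarUnitary l).symm (q : H) = indOp l y' := by
        rw [LinearIsometryEquiv.symm_apply_eq, polarUnitary_indOp, hly']
      rw [Submodule.coe_sub, Submodule.coe_add, h3, polarInv_coe_sub l hbi y, ← hq, h4,
        linNormal_sub, Submodule.coe_sub, hn, linNormal_eq_add hab hbc' hC' hC y, ← hy₁,
        map_sub, map_sub]
      abel
    change ‖((n - (polarInv l Ec.1 (imagePoint l Ec.1 y - inclIso hbi q) +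
        (((polarInv l Ec.1).comp (inclIso hbi)).comp (polarTo l Eb.1)) (linNormal hab y')) :
        barSub l Ec.1) : H')‖ ≤ _
    rw [h2]
    have h5 := norm_linNormal_sub_le (l := l) hab (y₁ - y')
    have h6 : ‖(linNormal (l := l) hab (y₁ - y') : H')‖ ≤ a * ‖(y₁ : H') - y'‖ := by
      refine (norm_linNormal (l := l) hab (y₁ - y')).trans_le ((indOp_le_norm l _).trans ?_)
      gcongr
      exact norm_sub_proj_le (E := Ea.1) ((y₁ : H') - y')
    have h7 := indOp_le_norm l ((y₁ : H') - y')
    refine (norm_sub_le _ _).trans ?_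
    have h8 : a * ‖(y₁ : H') - y'‖ ≤ a * (b * (η * ‖(y : H')‖)) := by gcongr
    rw [← ha] at h7
    linarith
  · have h2 : w₁ - Ea.1.orthogonalProjectionOnto (y' : H') =
        Ea.1.orthogonalProjectionOnto ((y₁ : H') - y') := by
      rw [map_sub, hw₁, ← orthogonalProjectionOnto_coe_of_le hab (y : H')]
    rw [h2]
    refine (Submodule.norm_orthogonalProjectionOnto_apply_le _ _).trans
      (hd.trans (le_trans ?_ hbound))
    exact le_mul_of_one_le_left h0 (by linarith)

variable (l)

theorem mem_cstarGen_of_forall {A : Type*} [NonUnitalCStarAlgebra A] {s : Set A} {a : A}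
    (h : ∀ ε > 0, ∃ b ∈ s, ‖a - b‖ ≤ ε) : a ∈ cstarGen s := by
  have hclosed : IsClosed (cstarGen s : Set A) :=
    NonUnitalStarSubalgebra.isClosed_topologicalClosure _
  change a ∈ (cstarGen s : Set A)
  rw [← hclosed.closure_eq, Metric.mem_closure_iff]
  intro ε hε
  obtain ⟨b, hb, hab⟩ := h (ε / 2) (half_pos hε)
  refine ⟨b, subset_cstarGen s hb, ?_⟩
  rw [dist_eq_norm]
  linarith

theorem linSystem_hom_mem (hl : AsymUnitary l) (W : FinSub H) (u) (hu : u ∈ (linSystem l).S W) :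
    (linSystem l).hom W u ∈ cstarGen {a : LinNets l | ∃ (E : FinSub H')
      (h : BFun E.1 (barSub l E.1)), h ∈ SCliff E.1 (barSub l E.1) ∧
        a = AsymAlg.mk _ _ (linNet l E h)} := by
  refine mem_cstarGen_of_forall fun ε hε => ?_
  have hu' : u ∈ SCliff W.1 W.1 := hu
  obtain ⟨E₀, hE₀⟩ := exists_linHom_sub_le l hl hu' hε
  obtain ⟨E, hE, hWE⟩ := exists_ge_ge E₀ (preimageSub l W.1)
  have h := le_imageSub l hWE
  exact ⟨_, ⟨E, linPull l E.1 (bott h u), linPull_mem l E.1 (SCliff.bott_mem h hu'), rfl⟩,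
    hE₀ E hE h⟩

theorem subset_closure_linSystem (hl : AsymUnitary l) :
    {a : LinNets l | ∃ (E : FinSub H') (h : BFun E.1 (barSub l E.1)),
      h ∈ SCliff E.1 (barSub l E.1) ∧ a = AsymAlg.mk _ _ (linNet l E h)} ⊆
      closure {a | ∃ W, ∃ u ∈ (linSystem l).S W, (linSystem l).hom W u = a} := by
  rintro _ ⟨E, g, hg, rfl⟩
  rw [Metric.mem_closure_iff]
  intro ε hε
  obtain ⟨W, u, hu, h⟩ := exists_linNet_sub_le hl E hg (half_pos hε)
  refine ⟨linHom l W.1 u, ⟨W, u, hu, rfl⟩, ?_⟩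
  exact (dist_eq_norm (AsymAlg.mk _ _ (linNet l E g)) (linHom l W.1 u)).trans_lt
    (h.trans_lt (half_lt_self hε))

end LinearGen

/-! ### The three isomorphisms. -/

section Conclusions

variable {H' H : Type*} [NormedAddCommGroup H'] [InnerProductSpace ℝ H'] [CompleteSpace H']
  [NormedAddCommGroup H] [InnerProductSpace ℝ H] [CompleteSpace H]

/-- In the linear case, the induced Clifford algebra is the direct limit algebra. -/
theorem FinApprox.exists_equiv_linAlg {l : H' ≃L[ℝ] H} (hl : AsymUnitary l)
    (D : FinApprox (fun v => l v) l) : ∃ Φ : D.InducedAlg ≃⋆ₐ[ℂ] LinAlg l,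
      ∀ i u (hu : D.Compatible i u), (Φ (D.cls i u hu) : LinNets l) = linHom l (D.W i) u := by
  have h := BottSystem.exists_equiv_of_system_eq (D.system l.continuous) (linSystem l) _ _
    (D.system_hom_mem l.continuous) (D.subset_closure_system l.continuous)
    (linSystem_hom_mem l hl) (subset_closure_linSystem l hl)
  obtain ⟨Φ, hΦ⟩ := h
  -- The linear system is indexed by all finite-dimensional subspaces, so W_i is itself an index and
  -- u has the same hub class on both sides.
  exact ⟨Φ, fun i u hu => hΦ i u hu ⟨D.W i, inferInstance⟩ u hu.1 rfl⟩

/-- The isomorphism of the linear case on the classes of compatible sequences. -/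
theorem FinApprox.exists_equiv_linNet {l : H' ≃L[ℝ] H} (hl : AsymUnitary l)
    (D : FinApprox (fun v => l v) l) : ∃ Φ : D.InducedAlg ≃⋆ₐ[ℂ] LinAlg l,
      ∀ i u (hu : D.Compatible i u), ∀ ε > 0, ∃ E₀ : FinSub H', ∀ E ≥ E₀,
        ∀ h : D.W i ≤ E.1.map (l : H' →ₗ[ℝ] H),
          ‖(Φ (D.cls i u hu) : LinNets l) -
            AsymAlg.mk _ _ (linNet l E (linPull l E.1 (bott h u)))‖ ≤ ε := by
  obtain ⟨Φ, hΦ⟩ := D.exists_equiv_linAlg hl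
  refine ⟨Φ, fun i u hu ε hε => ?_⟩
  obtain ⟨E₀, hE₀⟩ := exists_linHom_sub_le l hl hu.1 hε
  refine ⟨E₀, fun E hE h => ?_⟩
  rw [hΦ i u hu]
  exact hE₀ E hE h

/-- The induced Clifford algebra does not depend on the finite approximation. -/
theorem FinApprox.exists_equiv {F : H' → H} {l : H' ≃L[ℝ] H} (hF : Continuous F)
    (D₁ D₂ : FinApprox F l) : ∃ Φ : D₁.InducedAlg ≃⋆ₐ[ℂ] D₂.InducedAlg,
      ∀ i u (hu : D₁.Compatible i u) j v (hv : D₂.Compatible j v),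
        ‖Φ (D₁.cls i u hu) - D₂.cls j v hv‖ ≤
          ‖bott (le_sup_left : D₁.W i ≤ D₁.W i ⊔ D₂.W j) u -
            bott (le_sup_right : D₂.W j ≤ D₁.W i ⊔ D₂.W j) v‖ :=
  BottSystem.exists_equiv_of_system (D₁.system hF) (D₂.system hF) _ _
    (D₁.system_hom_mem hF) (D₁.subset_closure_system hF)
    (D₂.system_hom_mem hF) (D₂.subset_closure_system hF)

/-- In the model case, the induced Clifford algebra is the model algebra. -/
theorem ModelCase.exists_equiv (M : ModelCase H' H) (D : FinApprox M.F M.l) :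
    ∃ Φ : D.InducedAlg ≃⋆ₐ[ℂ] M.Alg, ∀ i u (hu : D.Compatible i u) j v
      (hv : v ∈ SCliff (M.tgt (Finset.Iic j)) (M.tgt (Finset.Iic j))),
      ‖Φ (D.cls i u hu) - M.cls j v hv‖ ≤
        ‖bott (le_sup_left : D.W i ≤ D.W i ⊔ M.tgt (Finset.Iic j)) u -
          bott (le_sup_right : M.tgt (Finset.Iic j) ≤ D.W i ⊔ M.tgt (Finset.Iic j)) v‖ := by
  obtain ⟨Φ, hΦ⟩ := BottSystem.exists_equiv_of_system (D.system M.continuous_F) M.system _ _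
    (D.system_hom_mem M.continuous_F) (D.subset_closure_system M.continuous_F)
    M.system_hom_mem M.subset_closure_system
  refine ⟨Φ, fun i u hu j v hv => ?_⟩
  have h1 : M.cls j v hv = ⟨M.system.hom j v, M.system_hom_mem j v hv⟩ :=
    Subtype.ext (M.seqHom_apply j v).symm
  rw [h1]
  exact hΦ i u hu j v hv

end Conclusions

end

end InducedClifford

theorem mainTheorem10 {H' : Type*} {H : Type*}
    [NormedAddCommGroup H'] [InnerProductSpace ℝ H'] [CompleteSpace H']
    [NormedAddCommGroup H] [InnerProductSpace ℝ H] [CompleteSpace H] :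
    -- (1) the model case
    (∀ M : ModelCase H' H,
      (∃ (N : ℕ) (D : FinApprox M.F M.l), ∀ i, D.W' i = M.src (Finset.Iic (N + i)) ∧
        (∀ m, (D.lin i m : H) = M.l m) ∧
        ∀ m, (D.map i m : H) = (M.tgt (Finset.Iic (N + i))).starProjection (M.F m)) ∧
      ∀ D : FinApprox M.F M.l, ∃ Φ : D.InducedAlg ≃⋆ₐ[ℂ] M.Alg,
        ∀ i u (hu : D.Compatible i u) j v
          (hv : v ∈ SCliff (M.tgt (Finset.Iic j)) (M.tgt (Finset.Iic j))),
          ‖Φ (D.cls i u hu) - M.cls j v hv‖ ≤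
            ‖bott (le_sup_left : D.W i ≤ D.W i ⊔ M.tgt (Finset.Iic j)) u -
              bott (le_sup_right : M.tgt (Finset.Iic j) ≤ D.W i ⊔ M.tgt (Finset.Iic j)) v‖) ∧
    -- (2) the case `F = l`
    (∀ l : H' ≃L[ℝ] H, AsymUnitary l → ∀ D : FinApprox (fun v => l v) l,
      ∃ Φ : D.InducedAlg ≃⋆ₐ[ℂ] LinAlg l,
        ∀ i u (hu : D.Compatible i u), ∀ ε > 0, ∃ E₀ : FinSub H', ∀ E ≥ E₀,
          ∀ h : D.W i ≤ E.1.map (l : H' →ₗ[ℝ] H),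
            ‖(Φ (D.cls i u hu) : LinNets l) -
              AsymAlg.mk _ _ (linNet l E (linPull l E.1 (bott h u)))‖ ≤ ε) ∧
    -- (3) independence of the finite approximation
    (∀ (Γ : Type*) [Group Γ] (ρ' : Γ →* (H' ≃ₗᵢ[ℝ] H')) (ρ : Γ →* (H ≃ₗᵢ[ℝ] H))
      (F : H' → H) (l : H' ≃L[ℝ] H), Continuous F →
      Tendsto F (Bornology.cobounded H') (Bornology.cobounded H) →
      (∀ γ v, F (ρ' γ v) = ρ γ (F v)) → (∀ γ v, l (ρ' γ v) = ρ γ (l v)) →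
      ∀ D₁ D₂ : FinApprox F l,
        (∀ γ, Dense (⋃ i, ((fun v => ρ' γ v) '' (D₁.W' i : Set H') ∩ (D₁.W' i : Set H')))) →
        (∀ γ, Dense (⋃ i, ((fun v => ρ' γ v) '' (D₂.W' i : Set H') ∩ (D₂.W' i : Set H')))) →
        ∃ Φ : D₁.InducedAlg ≃⋆ₐ[ℂ] D₂.InducedAlg,
          ∀ i u (hu : D₁.Compatible i u) j v (hv : D₂.Compatible j v),
            ‖Φ (D₁.cls i u hu) - D₂.cls j v hv‖ ≤
              ‖bott (le_sup_left : D₁.W i ≤ D₁.W i ⊔ D₂.W j) u -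
                bott (le_sup_right : D₂.W j ≤ D₁.W i ⊔ D₂.W j) v‖) := by
  refine ⟨fun M => ⟨M.exists_finApprox, M.exists_equiv⟩, fun l hl D => D.exists_equiv_linNet hl,
    fun _ _ _ _ F l hF _ _ _ D₁ D₂ _ _ => FinApprox.exists_equiv hF D₁ D₂⟩
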